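/- Let $\mathbb K=\bigoplus_m\mathbb K_m$ be a commutative $\mathbb Z$-graded ring concentrated in even degrees and containing $\mathbb Q$, with the discrete topology, and let $W$ be a graded profinite $\mathbb K$-module, i.e. a topologically free module $W=\prod_{i\in I}\mathbb K x_i$ with a homogeneous topological basis $(x_i)_{i\in I}$ ($I$ an arbitrary set, degrees $|x_i|\in\mathbb Z$), with the product topology. All tensor products are completed ($\mathbb K^X\hat\otimes\mathbb K^Y=\mathbb K^{X\times Y}$), signs follow the Koszul rule, and the module spanned by a set means its closed linear span (all convergent, possibly infinite, linear combinations). For a graded profinite module $V$ let $\widehat TV=\prod_{n\ge0}V^{\hat\otimes n}$, let $\widehat SV$ be the quotient of $\widehat TV$ by the closed two-sided ideal generated by all $x\otimes y-(-1)^{|x||y|}y\otimes x$ ($x,y\in V$), and let $\widehat LV\subset\widehat TV$ be the closed span of the Lie monomials in elements of $V$, where $[f,g]=fg-(-1)^{|f||g|}gf$. For $F\in\{\widehat T,\widehat S,\widehat L\}$ the differential envelope of $F(W)$ is $\Omega(FW)=F(W\oplus\Sigma^{-1}W)$, with topological generators $x_i$ and $dx_i$, $|dx_i|=|x_i|+1$,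 and $d$ the continuous derivation of degree one with $x_i\mapsto dx_i$, $dx_i\mapsto 0$. The de Rham complexes, with the induced differentials, are $$DR_{Ass}(\widehat TW)=\Omega/[\Omega,\Omega],\qquad DR_{Com}(\widehat SW)=\Omega,\qquad DR_{Lie}(\widehat LW)=\Omega\hat\otimes\Omega\big/\big(x\otimes y=(-1)^{|x||y|}y\otimes x,\ x\otimes[y,z]=[x,y]\otimes z\big),$$ with $\Omega=\Omega(\widehat TW),\Omega(\widehat SW),\Omega(\widehat LW)$ respectively and the relations understood as closed subspaces. $DR^n$ is the part with $n$ letters $dx_i$, graded by $|x_i|=|dx_i|$. Let $S_n$ act on $W^{\hat\otimes n}$ with Koszul signs. There are $\mathbb K$-linear homeomorphisms that preserve degree (in each of (i)–(iii), an element is homogeneous of degree $m$ if and only if its image is): (i) $\zeta_{Ass}:\{\omega\in DR^2_{Ass}(\widehat TW): d\omega=0\}\to[\widehat TW,\widehat TW]$, with $\zeta_{Ass}(d(dx\cdot y))=[x,y]$ for $x\in W$, $y\in\widehat TW$; (ii) $\zeta_{Com}:\{\omega\in DR^2_{Com}(\widehat SW): d\omega=0\}\to[W,\prod_{n\ge0}(W^{\hat\otimes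 n})^{S_n}]$, with $\zeta_{Com}(d(dx\cdot \bar y))=[x,i(y)]$ for $x\in W$ and $y\in\widehat TW$ with image $\bar y\in\widehat SW$, where $i(y_1\otimes\dots\otimes y_n)=\sum_{\sigma\in S_n}\sigma\cdot(y_1\otimes\dots\otimes y_n)$; (iii) $\zeta_{Lie}:\{\omega\in DR^2_{Lie}(\widehat LW): d\omega=0\}\to[\widehat LW,\widehat LW]$, with $\zeta_{Lie}(d(dx\otimes y))=[x,y]$ for $x\in W$, $y\in\widehat LW$. Here $[A,B]$ denotes the closed span in $\widehat TW$ of all $[a,b]$ with $a\in A$, $b\in B$. -/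

import Mathlib

/-!
Conventions.  `K` is the (evenly graded, commutative) ground ring with the discrete topology.  A
graded profinite module with homogeneous topological basis `(x_i)_{i : I}`, `|x_i| = deg i`, is
`W = (I → K)` with the product topology.  Completed tensor products are taken with respect to
topological bases: `K^X ⊗̂ K^Y = K^(X × Y)`.  All spaces `Y → K` carry the product topology, and the
module "generated" by a set (all convergent infinite linear combinations) is a closed span.

Since `K` is concentrated in even degrees, every Koszul sign depends only on degrees of words;
operations given in the literature on homogeneous elements are written here in the (unique)
continuous bilinear extension to all elements.

The differential envelope `Ω(X)` of an algebra `X` is the formal differential graded algebra (of the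
same type) that is free on the algebra `X`.  For the pro-free algebras `X = F(W)`, `F = T̂, Ŝ, L̂`, it
is the formal differential graded algebra that is free on the module `W`, that is
`Ω(F(W)) = F(W ⊕ Σ⁻¹W)` with generators `x_i` and `dx_i`, `|dx_i| = |x_i| + 1`.
-/

namespace FormalGeom

section Series

variable {K : Type*} [CommRing K] {X : Type*}

/-- The completed tensor algebra `T̂V = ∏ₙ V^⊗̂n` on the profinite module `V = K^X`: formal
noncommutative power series in the letters `X`; `f w` is the coefficient of the word `w`. -/
abbrev Series (K : Type*) (X : Type*) := List X → K

/-- The completed tensor square `T̂V ⊗̂ T̂V`. -/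
abbrev Series2 (K : Type*) (X : Type*) := List X × List X → K

/-- The degree of a word, for letters of degree `δ`. -/
def wdeg (δ : X → ℤ) (w : List X) : ℤ := (w.map δ).sum

/-- The inclusion `V → T̂V`. -/
def gen : (X → K) →ₗ[K] Series K X where
  toFun v w := match w with
    | [x] => v x
    | _ => 0
  map_add' v v' := by
    funext w
    rcases w with _ | ⟨a, _ | ⟨b, w⟩⟩ <;> simp
  map_smul' c v := by
    funext w
    rcases w with _ | ⟨a, _ | ⟨b, w⟩⟩ <;> simp

/-- `f ⊗ g`. -/
def tens (f g : Series K X) : Series2 K X := fun p => f p.1 * g p.2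

/-- The symmetry `f ⊗ g ↦ (-1)^(|f||g|) g ⊗ f`. -/
def tswap (δ : X → ℤ) : Series2 K X →ₗ[K] Series2 K X where
  toFun F p := (wdeg δ p.1 * wdeg δ p.2).negOnePow • F (p.2, p.1)
  map_add' F G := by funext p; simp
  map_smul' c F := by funext p; simp [mul_smul_comm]

/-- The multiplication `T̂V ⊗̂ T̂V → T̂V`, concatenation of words. -/
def concat : Series2 K X →ₗ[K] Series K X where
  toFun F w := ∑ k ∈ Finset.range (w.length + 1), F (w.take k, w.drop k)
  map_add' F G := by funext w; simp [Finset.sum_add_distrib]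
  map_smul' c F := by funext w; simp [Finset.mul_sum]

/-- The product `f · g` in `T̂V`. -/
def nmul (f g : Series K X) : Series K X := concat (tens f g)

/-- The graded commutator `[f, g] = f · g - (-1)^(|f||g|) g · f` in `T̂V`. -/
def bracket (δ : X → ℤ) (f g : Series K X) : Series K X :=
  concat (tens f g - tswap δ (tens f g))

/-- Lie monomials in elements of `V`. -/
inductive LieMonomial (δ : X → ℤ) : Series K X → Prop
  | of (v : X → K) : LieMonomial δ (gen v)
  | bracket {f g : Series K X} (hf : LieMonomial δ f) (hg : LieMonomial δ g) :
      LieMonomial δ (bracket δ f g)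

/-- The sign in `σ · (v₁ ⊗ ⋯ ⊗ vₙ) = ± v_{σ⁻¹(1)} ⊗ ⋯ ⊗ v_{σ⁻¹(n)}` when `|v_i| = a i`. -/
def koszulSign {n : ℕ} (σ : Equiv.Perm (Fin n)) (a : Fin n → ℤ) : ℤˣ :=
  ∏ p : Fin n × Fin n with p.1 < p.2 ∧ σ p.2 < σ p.1, (a p.1 * a p.2).negOnePow

/-- The coefficient of the word `l` in `σ · f`, for `σ` in the symmetric group on `l.length`
letters acting on `V^⊗̂(l.length)`. -/
def permCoeff (δ : X → ℤ) (f : Series K X) (l : List X) (σ : Equiv.Perm (Fin l.length)) : K :=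
  koszulSign σ (fun k => δ (l.get (σ k))) • f (List.ofFn fun k => l.get (σ k))

/-- `∏ₙ (V^⊗̂n)^{Sₙ}`, as a set of series. -/
def symInvariants (K : Type*) [CommRing K] (δ : X → ℤ) : Set (Series K X) :=
  {f | ∀ (l : List X) (σ : Equiv.Perm (Fin l.length)), permCoeff δ f l σ = f l}

/-- The (unnormalised) symmetrisation `v₁ ⊗ ⋯ ⊗ vₙ ↦ ∑_{σ ∈ Sₙ} σ · (v₁ ⊗ ⋯ ⊗ vₙ)`. -/
def symmetrise (δ : X → ℤ) (f : Series K X) : Series K X :=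
  fun l => ∑ σ : Equiv.Perm (Fin l.length), permCoeff δ f l σ

/-- `f` is homogeneous of degree `m` in `K^Y`, where the basis element `y` has degree `δ y` and
`K` has the grading `𝒦`. -/
def IsHomog (𝒦 : ℤ → AddSubgroup K) {Y : Type*} (δ : Y → ℤ) (m : ℤ) (f : Y → K) : Prop :=
  ∀ y, f y ∈ 𝒦 (m - δ y)

section Closed

variable [TopologicalSpace K] [DiscreteTopology K]

/-- The closed submodule of `K^Y` generated by a set. -/
def closedSpan {Y : Type*} (S : Set (Y → K)) : Submodule K (Y → K) :=
  (Submodule.span K S).topologicalClosure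

/-- `[A, B]`: all convergent linear combinations of the `[a, b]`, `a ∈ A`, `b ∈ B`. -/
def commutators (δ : X → ℤ) (A B : Set (Series K X)) : Submodule K (Series K X) :=
  closedSpan {h | ∃ a ∈ A, ∃ b ∈ B, h = bracket δ a b}

/-- The closed two-sided ideal of `T̂V` generated by `x ⊗ y - (-1)^(|x||y|) y ⊗ x`, `x, y ∈ V`;
the quotient of `T̂V` by it is `ŜV`. -/
def symIdeal (K : Type*) [CommRing K] [TopologicalSpace K] [DiscreteTopology K] (δ : X → ℤ) :
    Submodule K (Series K X) :=
  closedSpan {h | ∃ (a b : Series K X) (x y : X → K),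
    h = nmul (nmul a (bracket δ (gen x) (gen y))) b}

/-- The pro-free Lie algebra `L̂V ⊆ T̂V`. -/
def lieSeries (K : Type*) [CommRing K] [TopologicalSpace K] [DiscreteTopology K] (δ : X → ℤ) :
    Submodule K (Series K X) :=
  closedSpan {f | LieMonomial δ f}

/-- `L̂V ⊗̂ L̂V`, as a closed submodule of `T̂V ⊗̂ T̂V`. -/
def lieTens (K : Type*) [CommRing K] [TopologicalSpace K] [DiscreteTopology K] (δ : X → ℤ) :
    Submodule K (Series2 K X) :=
  closedSpan {F | ∃ x ∈ lieSeries K δ, ∃ y ∈ lieSeries K δ, F = tens x y}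

/-- The relations `x ⊗ y = (-1)^(|x||y|) y ⊗ x` and `x ⊗ [y, z] = [x, y] ⊗ z` on
`L̂V ⊗̂ L̂V`. -/
def lieRel (K : Type*) [CommRing K] [TopologicalSpace K] [DiscreteTopology K] (δ : X → ℤ) :
    Submodule K (Series2 K X) :=
  closedSpan
    ({F | ∃ x ∈ lieSeries K δ, ∃ y ∈ lieSeries K δ, F = tens x y - tswap δ (tens x y)} ∪
     {F | ∃ x ∈ lieSeries K δ, ∃ y ∈ lieSeries K δ, ∃ z ∈ lieSeries K δ,
        F = tens x (bracket δ y z) - tens (bracket δ x y) z})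

end Closed

end Series

section Forms

variable {K : Type*} [CommRing K] {I : Type*}

/-- Total degree of the generators `x_i = inl i` and `dx_i = inr i` of the differential
envelope: `|dx_i| = |x_i| + 1`. -/
def tdeg (deg : I → ℤ) : I ⊕ I → ℤ := Sum.elim deg (fun i => deg i + 1)

/-- Degree of the generators `x_i`, `dx_i` in the modules of `n`-forms (the `n`-fold suspension
of the part of form degree `n`): both have degree `|x_i|`. -/
def ideg (deg : I → ℤ) : I ⊕ I → ℤ := Sum.elim deg deg

/-- The number of letters `dx_i` in a word. -/
def formDeg (w : List (I ⊕ I)) : ℕ := w.countP Sum.isRight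

/-- The inclusion `T̂W → T̂(W ⊕ Σ⁻¹W)`. -/
def incl (y : Series K I) : Series K (I ⊕ I) :=
  fun w => (w.mapM Sum.getLeft?).elim 0 y

/-- For `x ∈ W` the element `dx ∈ Σ⁻¹W`. -/
def dgen (x : I → K) : Series K (I ⊕ I) := gen (Sum.elim 0 x)

/-- The differential of the differential envelope `Ω(T̂W) = T̂(W ⊕ Σ⁻¹W)`: the continuous
derivation of degree one with `d(x_i) = dx_i`, `d(dx_i) = 0`, i.e.
`d(u₁⋯uₙ) = ∑_{u_k = x_i} (-1)^{|u₁|+⋯+|u_{k-1}|} u₁⋯u_{k-1} dx_i u_{k+1}⋯uₙ`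
on words, written in coefficients. -/
def diff (deg : I → ℤ) : Series K (I ⊕ I) →ₗ[K] Series K (I ⊕ I) where
  toFun f w := ∑ k ∈ Finset.range w.length, match w[k]? with
    | some (Sum.inr i) => (wdeg (tdeg deg) (w.take k)).negOnePow • f (w.set k (Sum.inl i))
    | _ => 0
  map_add' f g := by
    funext w
    simp only [Pi.add_apply, ← Finset.sum_add_distrib]
    refine Finset.sum_congr rfl fun k _ => ?_
    split <;> simp
  map_smul' c f := by
    funext w
    simp only [Pi.smul_apply, Finset.smul_sum, RingHom.id_apply]
    refine Finset.sum_congr rfl fun k _ => ?_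
    split <;> simp [mul_smul_comm]

/-- `d(x ⊗ y) = dx ⊗ y + (-1)^|x| x ⊗ dy`. -/
def diff2 (deg : I → ℤ) : Series2 K (I ⊕ I) →ₗ[K] Series2 K (I ⊕ I) where
  toFun F p := diff deg (fun u => F (u, p.2)) p.1 +
    (wdeg (tdeg deg) p.1).negOnePow • diff deg (fun v => F (p.1, v)) p.2
  map_add' F G := by
    funext p
    have h1 : (fun u => (F + G) (u, p.2)) = (fun u => F (u, p.2)) + fun u => G (u, p.2) := rfl
    have h2 : (fun u => (F + G) (p.1, u)) = (fun u => F (p.1, u)) + fun u => G (p.1, u) := rfl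
    rw [h1, h2, map_add, map_add]
    simp only [Pi.add_apply, smul_add]
    exact add_add_add_comm _ _ _ _
  map_smul' c F := by
    funext p
    have h1 : (fun u => (c • F) (u, p.2)) = c • (fun u => F (u, p.2)) := rfl
    have h2 : (fun u => (c • F) (p.1, u)) = c • (fun u => F (p.1, u)) := rfl
    rw [h1, h2, map_smul, map_smul]
    simp only [Pi.smul_apply, RingHom.id_apply, smul_eq_mul, mul_add, mul_smul_comm]

end Forms

section Leibniz

variable {K : Type*} [CommRing K] {I : Type*}

/-- The sign operator `f ↦ (-1)^|f| f`. -/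
def sgn {X : Type*} (δ : X → ℤ) : Series K X →ₗ[K] Series K X where
  toFun f w := (wdeg δ w).negOnePow • f w
  map_add' f g := by funext w; simp
  map_smul' c f := by funext w; simp [mul_smul_comm]

theorem wdeg_append {X : Type*} (δ : X → ℤ) (u v : List X) :
    wdeg δ (u ++ v) = wdeg δ u + wdeg δ v := by
  simp [wdeg]

theorem wdeg_take_add_drop {X : Type*} (δ : X → ℤ) (w : List X) (k : ℕ) :
    wdeg δ (w.take k) + wdeg δ (w.drop k) = wdeg δ w := by
  rw [← wdeg_append, List.take_append_drop]

theorem diff_apply (deg : I → ℤ) (f : Series K (I ⊕ I)) (w : List (I ⊕ I)) :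
    diff deg f w = ∑ k ∈ Finset.range w.length, match w[k]? with
      | some (Sum.inr i) => (wdeg (tdeg deg) (w.take k)).negOnePow • f (w.set k (Sum.inl i))
      | _ => 0 := rfl

theorem diff_concat (deg : I → ℤ) (F : Series2 K (I ⊕ I)) :
    diff deg (concat F) = concat (diff2 deg F) := by
  funext w
  let T : ℕ → ℕ → K := fun m k => match w[k]? with
    | some (Sum.inr i) => (wdeg (tdeg deg) (w.take k)).negOnePow •
        F ((w.set k (Sum.inl i)).take m, (w.set k (Sum.inl i)).drop m)
    | _ => 0
  have hL : diff deg (concat F) w =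
      ∑ k ∈ Finset.range w.length, ∑ m ∈ Finset.range (w.length + 1), T m k := by
    rw [diff_apply]
    refine Finset.sum_congr rfl fun k _ => ?_
    simp only [T]
    split
    · simp [concat, Finset.smul_sum]
    · simp
  have hR : concat (diff2 deg F) w =
      ∑ m ∈ Finset.range (w.length + 1), ∑ k ∈ Finset.range w.length, T m k := by
    change ∑ m ∈ Finset.range (w.length + 1), diff2 deg F (w.take m, w.drop m) = _
    refine Finset.sum_congr rfl fun m hm => ?_
    have hm' : m ≤ w.length := Nat.lt_succ_iff.mp (Finset.mem_range.mp hm)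
    obtain ⟨r, hr⟩ := Nat.exists_eq_add_of_le hm'
    rw [hr, Finset.sum_range_add]
    change diff deg (fun u => F (u, w.drop m)) (w.take m) +
      (wdeg (tdeg deg) (w.take m)).negOnePow • diff deg (fun v => F (w.take m, v)) (w.drop m) = _
    rw [diff_apply, diff_apply]
    congr 1
    · rw [List.length_take, min_eq_left hm']
      refine Finset.sum_congr rfl fun k hk => ?_
      have hk' : k < m := Finset.mem_range.mp hk
      simp only [T, List.getElem?_take_of_lt hk', List.take_take, min_eq_left hk'.le]
      split
      · rw [List.take_set, List.drop_set_of_lt hk']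
      · rfl
    · rw [List.length_drop, hr, Nat.add_sub_cancel_left, Finset.smul_sum]
      refine Finset.sum_congr rfl fun k _ => ?_
      simp only [T, List.getElem?_drop]
      split
      · have h1 : w.take (m + k) = w.take m ++ (w.drop m).take k := List.take_add
        have h2 : (w.set (m + k) (Sum.inl ‹I›)).take m = w.take m := by
          rw [List.take_set, List.set_eq_of_length_le]
          simp
        rw [h1, wdeg_append, Int.negOnePow_add, mul_smul, h2, List.drop_set]
        simp
      · simp
  rw [hL, hR, Finset.sum_comm]

theorem diff_congr (deg : I → ℤ) (w : List (I ⊕ I)) {f g : Series K (I ⊕ I)} (c : ℤˣ)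
    (h : ∀ k i, w[k]? = some (Sum.inr i) → f (w.set k (Sum.inl i)) = c • g (w.set k (Sum.inl i))) :
    diff deg f w = c • diff deg g w := by
  rw [diff_apply, diff_apply, Finset.smul_sum]
  refine Finset.sum_congr rfl fun k _ => ?_
  split
  · rw [h _ _ ‹_›, smul_comm]
  · simp

theorem negOnePow_sub_one (n : ℤ) : (n - 1).negOnePow = - n.negOnePow := by
  rw [Int.negOnePow_sub, Int.negOnePow_one]; simp

theorem wdeg_set (deg : I → ℤ) (w : List (I ⊕ I)) (k : ℕ) (i : I)
    (h : w[k]? = some (Sum.inr i)) :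
    wdeg (tdeg deg) (w.set k (Sum.inl i)) = wdeg (tdeg deg) w - 1 := by
  induction w generalizing k with
  | nil => simp at h
  | cons a w ih =>
    cases k with
    | zero =>
      simp at h
      subst h
      simp [wdeg, tdeg]
      ring
    | succ k =>
      have := ih k (by simpa using h)
      simp only [wdeg, List.set_cons_succ, List.map_cons, List.sum_cons] at this ⊢
      rw [this]; ring

theorem diff2_tswap (deg : I → ℤ) (F : Series2 K (I ⊕ I)) :
    diff2 deg (tswap (tdeg deg) F) = tswap (tdeg deg) (diff2 deg F) := by
  funext ⟨u, v⟩
  change diff deg (fun a => (wdeg (tdeg deg) a * wdeg (tdeg deg) v).negOnePow • F (v, a)) u +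
      (wdeg (tdeg deg) u).negOnePow •
        diff deg (fun b => (wdeg (tdeg deg) u * wdeg (tdeg deg) b).negOnePow • F (b, u)) v =
    (wdeg (tdeg deg) u * wdeg (tdeg deg) v).negOnePow •
      (diff deg (fun b => F (b, u)) v +
        (wdeg (tdeg deg) v).negOnePow • diff deg (fun a => F (v, a)) u)
  rw [diff_congr deg u (g := fun a => F (v, a))
    (((wdeg (tdeg deg) u * wdeg (tdeg deg) v).negOnePow * (wdeg (tdeg deg) v).negOnePow)),
    diff_congr deg v (g := fun a => F (a, u))
    (((wdeg (tdeg deg) u).negOnePow * (wdeg (tdeg deg) u * wdeg (tdeg deg) v).negOnePow))]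
  · rw [smul_add, smul_smul, smul_smul, ← mul_assoc, Int.units_mul_self, one_mul, add_comm]
  · intro k i h
    rw [wdeg_set deg v k i h, mul_sub, mul_one, Int.negOnePow_sub, mul_comm]
  · intro k i h
    rw [wdeg_set deg u k i h, sub_mul, one_mul, Int.negOnePow_sub]

theorem diff2_tens (deg : I → ℤ) (f g : Series K (I ⊕ I)) :
    diff2 deg (tens f g) = tens (diff deg f) g + tens (sgn (tdeg deg) f) (diff deg g) := by
  funext ⟨u, v⟩
  have h1 : (fun a => tens f g (a, v)) = g v • f := by
    funext a; simp [tens, mul_comm]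
  have h2 : (fun b => tens f g (u, b)) = f u • g := rfl
  change diff deg (fun a => tens f g (a, v)) u +
    (wdeg (tdeg deg) u).negOnePow • diff deg (fun b => tens f g (u, b)) v = _
  simp only [h1, h2, map_smul]
  simp [tens, sgn, mul_comm (g v), smul_mul_assoc]

theorem tens_sgn_sgn {X : Type*} (δ : X → ℤ) (f g : Series K X) (u v : List X) :
    tens (sgn δ f) (sgn δ g) (u, v) = (wdeg δ u + wdeg δ v).negOnePow • tens f g (u, v) := by
  simp only [tens, sgn, Int.negOnePow_add, mul_smul, smul_mul_assoc, mul_smul_comm,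
    LinearMap.coe_mk, AddHom.coe_mk]
  exact smul_comm _ _ _

theorem tens_add_left {X : Type*} (f f' g : Series K X) :
    tens (f + f') g = tens f g + tens f' g := by
  funext p; simp [tens, add_mul]

theorem tens_add_right {X : Type*} (f g g' : Series K X) :
    tens f (g + g') = tens f g + tens f g' := by
  funext p; simp [tens, mul_add]

theorem sgn_nmul {X : Type*} (δ : X → ℤ) (f g : Series K X) :
    sgn δ (nmul f g) = nmul (sgn δ f) (sgn δ g) := by
  funext w
  change (wdeg δ w).negOnePow • (∑ k ∈ Finset.range (w.length + 1), tens f g (w.take k, w.drop k))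
    = ∑ k ∈ Finset.range (w.length + 1), tens (sgn δ f) (sgn δ g) (w.take k, w.drop k)
  rw [Finset.smul_sum]
  refine Finset.sum_congr rfl fun k _ => ?_
  rw [tens_sgn_sgn, wdeg_take_add_drop]

theorem sgn_bracket {X : Type*} (δ : X → ℤ) (f g : Series K X) :
    sgn δ (bracket δ f g) = bracket δ (sgn δ f) (sgn δ g) := by
  funext w
  change (wdeg δ w).negOnePow • (∑ k ∈ Finset.range (w.length + 1),
      (tens f g (w.take k, w.drop k) - (wdeg δ (w.take k) * wdeg δ (w.drop k)).negOnePow •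
        tens f g (w.drop k, w.take k)))
    = ∑ k ∈ Finset.range (w.length + 1), (tens (sgn δ f) (sgn δ g) (w.take k, w.drop k) -
      (wdeg δ (w.take k) * wdeg δ (w.drop k)).negOnePow •
        tens (sgn δ f) (sgn δ g) (w.drop k, w.take k))
  rw [Finset.smul_sum]
  refine Finset.sum_congr rfl fun k _ => ?_
  rw [tens_sgn_sgn, tens_sgn_sgn, add_comm (wdeg δ (w.drop k)), wdeg_take_add_drop, smul_sub,
    smul_comm]

theorem diff_nmul (deg : I → ℤ) (f g : Series K (I ⊕ I)) :
    diff deg (nmul f g) = nmul (diff deg f) g + nmul (sgn (tdeg deg) f) (diff deg g) := by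
  rw [nmul, diff_concat, diff2_tens, map_add]; rfl

theorem diff_bracket (deg : I → ℤ) (f g : Series K (I ⊕ I)) :
    diff deg (bracket (tdeg deg) f g) =
      bracket (tdeg deg) (diff deg f) g + bracket (tdeg deg) (sgn (tdeg deg) f) (diff deg g) := by
  rw [bracket, diff_concat, map_sub, diff2_tswap, diff2_tens, bracket, bracket, ← map_add]
  congr 1
  rw [map_add]
  abel

theorem diff_gen (deg : I → ℤ) (v : I ⊕ I → K) :
    diff deg (gen v) = gen (Sum.elim 0 fun i => v (Sum.inl i)) := by
  funext w
  rw [diff_apply]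
  rcases w with _ | ⟨a, _ | ⟨b, w⟩⟩
  · simp [gen]
  · rcases a with i | i <;> simp [gen, wdeg]
  · change _ = 0
    refine Finset.sum_eq_zero fun k _ => ?_
    split
    · rcases k with _ | _ | k <;> simp [gen]
    · rfl

theorem sgn_gen {X : Type*} (δ : X → ℤ) (v : X → K) :
    sgn δ (gen v) = gen (fun x => (δ x).negOnePow • v x) := by
  funext w
  rcases w with _ | ⟨a, _ | ⟨b, w⟩⟩ <;> simp [gen, sgn, wdeg]

theorem bracket_add_left {X : Type*} (δ : X → ℤ) (f f' g : Series K X) :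
    bracket δ (f + f') g = bracket δ f g + bracket δ f' g := by
  rw [bracket, tens_add_left, map_add, add_sub_add_comm, map_add]; rfl

theorem nmul_add_left {X : Type*} (f f' g : Series K X) :
    nmul (f + f') g = nmul f g + nmul f' g := by
  rw [nmul, tens_add_left, map_add]; rfl

theorem nmul_add_right {X : Type*} (f g g' : Series K X) :
    nmul f (g + g') = nmul f g + nmul f g' := by
  rw [nmul, tens_add_right, map_add]; rfl

theorem lieMonomial_sgn {X : Type*} (δ : X → ℤ) {f : Series K X} (hf : LieMonomial δ f) :
    LieMonomial δ (sgn δ f) := by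
  induction hf with
  | of v => rw [sgn_gen]; exact .of _
  | bracket _ _ h1 h2 => rw [sgn_bracket]; exact .bracket h1 h2

theorem lieMonomial_diff (deg : I → ℤ) {f : Series K (I ⊕ I)}
    (hf : LieMonomial (tdeg deg) f) :
    diff deg f ∈ Submodule.span K {g : Series K (I ⊕ I) | LieMonomial (tdeg deg) g} := by
  have key1 : ∀ g : Series K (I ⊕ I), LieMonomial (tdeg deg) g →
      ∀ h ∈ Submodule.span K {g : Series K (I ⊕ I) | LieMonomial (tdeg deg) g},
      bracket (tdeg deg) h g ∈ Submodule.span K {g : Series K (I ⊕ I) | LieMonomial (tdeg deg) g} ∧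
      bracket (tdeg deg) g h ∈
        Submodule.span K {g : Series K (I ⊕ I) | LieMonomial (tdeg deg) g} := by
    intro g hg h hh
    induction hh using Submodule.span_induction with
    | mem x hx => exact ⟨Submodule.subset_span (.bracket hx hg),
        Submodule.subset_span (.bracket hg hx)⟩
    | zero =>
      have h1 : tens (0 : Series K (I ⊕ I)) g = 0 := by funext p; simp [tens]
      have h2 : tens g (0 : Series K (I ⊕ I)) = 0 := by funext p; simp [tens]
      simp [bracket, h1, h2]
    | add x y _ _ hx hy =>
      have h2 : bracket (tdeg deg) g (x + y) =
          bracket (tdeg deg) g x + bracket (tdeg deg) g y := by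
        rw [bracket, tens_add_right, map_add, add_sub_add_comm, map_add]; rfl
      rw [bracket_add_left, h2]
      exact ⟨add_mem hx.1 hy.1, add_mem hx.2 hy.2⟩
    | smul c x _ hx =>
      have h1 : tens (c • x) g = c • tens x g := by funext p; simp [tens, mul_assoc]
      have h2 : tens g (c • x) = c • tens g x := by
        funext p; simp [tens, mul_left_comm]
      have h3 : bracket (tdeg deg) (c • x) g = c • bracket (tdeg deg) x g := by
        rw [bracket, h1, map_smul, ← smul_sub, map_smul]; rfl
      have h4 : bracket (tdeg deg) g (c • x) = c • bracket (tdeg deg) g x := by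
        rw [bracket, h2, map_smul, ← smul_sub, map_smul]; rfl
      rw [h3, h4]
      exact ⟨Submodule.smul_mem _ _ hx.1, Submodule.smul_mem _ _ hx.2⟩
  induction hf with
  | of v => rw [diff_gen]; exact Submodule.subset_span (.of _)
  | bracket hf hg h1 h2 =>
    rw [diff_bracket]
    exact add_mem (key1 _ hg _ h1).1 (key1 _ (lieMonomial_sgn _ hf) _ h2).2

end Leibniz

section Descent

variable {K : Type*} [CommRing K] [TopologicalSpace K] [DiscreteTopology K] {I : Type*}

theorem closedSpan_map_le {Y Z : Type*} (S : Set (Y → K)) (L : (Y → K) →ₗ[K] (Z → K))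
    (hL : Continuous L) (P : Submodule K (Z → K)) (hP : IsClosed (P : Set (Z → K)))
    (h : ∀ s ∈ S, L s ∈ P) : closedSpan S ≤ P.comap L := by
  refine Submodule.topologicalClosure_minimal _ (Submodule.span_le.mpr h) ?_
  exact hP.preimage hL

theorem isClosed_closedSpan {Y : Type*} (S : Set (Y → K)) :
    IsClosed (closedSpan S : Set (Y → K)) :=
  Submodule.isClosed_topologicalClosure _

theorem subset_closedSpan {Y : Type*} {S : Set (Y → K)} {f : Y → K} (h : f ∈ S) :
    f ∈ closedSpan S :=
  Submodule.le_topologicalClosure _ (Submodule.subset_span h)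

theorem continuous_units_smul {Y : Type*} [TopologicalSpace Y] (c : ℤˣ) {f : Y → K}
    (hf : Continuous f) : Continuous fun y => c • f y :=
  (continuous_of_discreteTopology (f := fun a : K => c • a)).comp hf

theorem continuous_diff (deg : I → ℤ) :
    Continuous (diff deg : Series K (I ⊕ I) →ₗ[K] Series K (I ⊕ I)) := by
  refine continuous_pi fun w => ?_
  simp only [diff_apply]
  refine continuous_finsetSum _ fun k _ => ?_
  split
  · exact continuous_units_smul _ (continuous_apply _)
  · exact continuous_const

theorem continuous_diff2 (deg : I → ℤ) :
    Continuous (diff2 deg : Series2 K (I ⊕ I) →ₗ[K] Series2 K (I ⊕ I)) := by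
  refine continuous_pi fun p => Continuous.add ?_ (continuous_units_smul _ ?_)
  · exact ((continuous_apply p.1).comp (continuous_diff deg)).comp
      (continuous_pi fun u => continuous_apply (u, p.2))
  · exact ((continuous_apply p.2).comp (continuous_diff deg)).comp
      (continuous_pi fun u => continuous_apply (p.1, u))

theorem continuous_sgn {X : Type*} (δ : X → ℤ) :
    Continuous (sgn δ : Series K X →ₗ[K] Series K X) :=
  continuous_pi fun w => continuous_units_smul _ (continuous_apply w)

theorem diff_mem_commutators (deg : I → ℤ) :
    commutators (K := K) (tdeg deg) Set.univ Set.univ ≤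
      (commutators (tdeg deg) Set.univ Set.univ).comap (diff deg) := by
  refine closedSpan_map_le _ _ (continuous_diff deg) _ (isClosed_closedSpan _) ?_
  rintro _ ⟨a, -, b, -, rfl⟩
  rw [diff_bracket]
  exact add_mem (subset_closedSpan ⟨_, trivial, _, trivial, rfl⟩)
    (subset_closedSpan ⟨_, trivial, _, trivial, rfl⟩)

theorem diff_mem_symIdeal (deg : I → ℤ) :
    symIdeal K (tdeg deg) ≤ (symIdeal K (tdeg deg)).comap (diff deg) := by
  refine closedSpan_map_le _ _ (continuous_diff deg) _ (isClosed_closedSpan _) ?_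
  rintro _ ⟨a, b, x, y, rfl⟩
  rw [diff_nmul, diff_nmul, diff_bracket, sgn_nmul, sgn_bracket, nmul_add_right, nmul_add_left,
    nmul_add_left, diff_gen, diff_gen, sgn_gen, sgn_gen]
  exact add_mem (add_mem (subset_closedSpan ⟨_, _, _, _, rfl⟩)
    (add_mem (subset_closedSpan ⟨_, _, _, _, rfl⟩) (subset_closedSpan ⟨_, _, _, _, rfl⟩)))
    (subset_closedSpan ⟨_, _, _, _, rfl⟩)

theorem sgn_mem_lieSeries {X : Type*} (δ : X → ℤ) :
    lieSeries K δ ≤ (lieSeries K δ).comap (sgn δ) :=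
  closedSpan_map_le _ _ (continuous_sgn δ) _ (isClosed_closedSpan _)
    fun _ hf => subset_closedSpan (lieMonomial_sgn δ hf)

theorem diff_mem_lieSeries (deg : I → ℤ) :
    lieSeries K (tdeg deg) ≤ (lieSeries K (tdeg deg)).comap (diff deg) :=
  closedSpan_map_le _ _ (continuous_diff deg) _ (isClosed_closedSpan _)
    fun _ hf => Submodule.le_topologicalClosure _ (lieMonomial_diff deg hf)

theorem diff2_mem_lieTens (deg : I → ℤ) :
    lieTens K (tdeg deg) ≤ (lieTens K (tdeg deg)).comap (diff2 deg) := by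
  refine closedSpan_map_le _ _ (continuous_diff2 deg) _ (isClosed_closedSpan _) ?_
  rintro _ ⟨x, hx, y, hy, rfl⟩
  rw [diff2_tens]
  exact add_mem (subset_closedSpan ⟨_, diff_mem_lieSeries deg hx, _, hy, rfl⟩)
    (subset_closedSpan ⟨_, sgn_mem_lieSeries _ hx, _, diff_mem_lieSeries deg hy, rfl⟩)

theorem diff2_mem_lieRel (deg : I → ℤ) :
    lieRel K (tdeg deg) ≤ (lieRel K (tdeg deg)).comap (diff2 deg) := by
  refine closedSpan_map_le _ _ (continuous_diff2 deg) _ (isClosed_closedSpan _) ?_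
  rintro _ (⟨x, hx, y, hy, rfl⟩ | ⟨x, hx, y, hy, z, hz, rfl⟩)
  · rw [map_sub, diff2_tswap, diff2_tens, map_add, add_sub_add_comm]
    exact add_mem (subset_closedSpan (.inl ⟨_, diff_mem_lieSeries deg hx, _, hy, rfl⟩))
      (subset_closedSpan (.inl ⟨_, sgn_mem_lieSeries _ hx, _, diff_mem_lieSeries deg hy, rfl⟩))
  · have hx' := diff_mem_lieSeries deg hx
    have hy' := diff_mem_lieSeries deg hy
    have hz' := diff_mem_lieSeries deg hz
    have sx := sgn_mem_lieSeries _ hx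
    have sy := sgn_mem_lieSeries _ hy
    have e : diff2 deg (tens x (bracket (tdeg deg) y z) - tens (bracket (tdeg deg) x y) z) =
        (tens (diff deg x) (bracket (tdeg deg) y z) -
          tens (bracket (tdeg deg) (diff deg x) y) z) +
        (tens (sgn (tdeg deg) x) (bracket (tdeg deg) (diff deg y) z) -
          tens (bracket (tdeg deg) (sgn (tdeg deg) x) (diff deg y)) z) +
        (tens (sgn (tdeg deg) x) (bracket (tdeg deg) (sgn (tdeg deg) y) (diff deg z)) -
          tens (bracket (tdeg deg) (sgn (tdeg deg) x) (sgn (tdeg deg) y)) (diff deg z)) := by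
      rw [map_sub, diff2_tens, diff2_tens, diff_bracket, diff_bracket, sgn_bracket,
        tens_add_left, tens_add_right]
      abel
    rw [e]
    exact add_mem (add_mem (subset_closedSpan (.inr ⟨_, hx', _, hy, _, hz, rfl⟩))
      (subset_closedSpan (.inr ⟨_, sx, _, hy', _, hz, rfl⟩)))
      (subset_closedSpan (.inr ⟨_, sx, _, sy, _, hz', rfl⟩))

end Descent

section DeRham

variable (K : Type*) [CommRing K] [TopologicalSpace K] [DiscreteTopology K] {I : Type*}

/-- The de Rham complex of `T̂W`: the differential envelope `T̂(W ⊕ Σ⁻¹W)` modulo (graded)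
commutators. -/
abbrev DRAss (deg : I → ℤ) : Type _ :=
  Series K (I ⊕ I) ⧸ commutators (K := K) (tdeg deg) Set.univ Set.univ

/-- The de Rham complex of `ŜW`: the differential envelope `Ŝ(W ⊕ Σ⁻¹W)`. -/
abbrev DRCom (deg : I → ℤ) : Type _ := Series K (I ⊕ I) ⧸ symIdeal K (tdeg deg)

/-- The de Rham complex of `L̂W`: the quotient of `Ω ⊗̂ Ω`, where `Ω = L̂(W ⊕ Σ⁻¹W)` is the
differential envelope, by `x ⊗ y = (-1)^(|x||y|) y ⊗ x` and `x ⊗ [y, z] = [x, y] ⊗ z`. -/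
abbrev DRLie (deg : I → ℤ) : Type _ :=
  lieTens K (tdeg deg) ⧸ (lieRel K (tdeg deg)).submoduleOf (lieTens K (tdeg deg))

/-- The differential of `DR(T̂W)`. -/
def dAss (deg : I → ℤ) : DRAss K deg →ₗ[K] DRAss K deg :=
  Submodule.mapQ _ _ (diff deg) (diff_mem_commutators deg)

/-- The differential of `DR(ŜW)`. -/
def dCom (deg : I → ℤ) : DRCom K deg →ₗ[K] DRCom K deg :=
  Submodule.mapQ _ _ (diff deg) (diff_mem_symIdeal deg)

/-- The differential of `DR(L̂W)`. -/
def dLie (deg : I → ℤ) : DRLie K deg →ₗ[K] DRLie K deg :=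
  Submodule.mapQ _ _ ((diff2 deg).restrict (diff2_mem_lieTens deg))
    (fun _ hx => diff2_mem_lieRel deg hx)

/-- Elements of `T̂(W ⊕ Σ⁻¹W)` of form degree `n`. -/
def formsT (I : Type*) (n : ℕ) : Submodule K (Series K (I ⊕ I)) where
  carrier := {f | ∀ w, f w ≠ 0 → formDeg w = n}
  add_mem' {f g} hf hg w h := by
    by_contra hn
    exact h (by simp [not_imp_comm.mp (hf w) hn, not_imp_comm.mp (hg w) hn])
  zero_mem' w h := absurd rfl h
  smul_mem' c f hf w h := hf w fun h0 => h (by simp [h0])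

/-- Elements of `L̂(W ⊕ Σ⁻¹W) ⊗̂ L̂(W ⊕ Σ⁻¹W)` of form degree `n`. -/
def formsL (deg : I → ℤ) (n : ℕ) : Submodule K (lieTens K (tdeg deg)) where
  carrier := {F | ∀ p, F.1 p ≠ 0 → formDeg p.1 + formDeg p.2 = n}
  add_mem' {f g} hf hg w h := by
    by_contra hn
    exact h (by simp [not_imp_comm.mp (hf w) hn, not_imp_comm.mp (hg w) hn])
  zero_mem' w h := absurd rfl h
  smul_mem' c f hf w h := hf w fun h0 => h (by simp [h0])

/-- The closed 2-forms in `DR²(T̂W)`. -/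
def closedAss (deg : I → ℤ) : Submodule K (DRAss K deg) :=
  (formsT K I 2).map (Submodule.mkQ _) ⊓ LinearMap.ker (dAss K deg)

/-- The closed 2-forms in `DR²(ŜW)`. -/
def closedCom (deg : I → ℤ) : Submodule K (DRCom K deg) :=
  (formsT K I 2).map (Submodule.mkQ _) ⊓ LinearMap.ker (dCom K deg)

/-- The closed 2-forms in `DR²(L̂W)`. -/
def closedLie (deg : I → ℤ) : Submodule K (DRLie K deg) :=
  (formsL K deg 2).map (Submodule.mkQ _) ⊓ LinearMap.ker (dLie K deg)

variable {K}

/-- Homogeneous elements of degree `m` of `DR(T̂W)`, for the grading with `|x_i| = |dx_i|`. -/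
def HomogAss (𝒦 : ℤ → AddSubgroup K) (deg : I → ℤ) (m : ℤ) (ω : DRAss K deg) : Prop :=
  ∃ f : Series K (I ⊕ I), IsHomog 𝒦 (wdeg (ideg deg)) m f ∧ ω = Submodule.Quotient.mk f

/-- Homogeneous elements of degree `m` of `DR(ŜW)`, for the grading with `|x_i| = |dx_i|`. -/
def HomogCom (𝒦 : ℤ → AddSubgroup K) (deg : I → ℤ) (m : ℤ) (ω : DRCom K deg) : Prop :=
  ∃ f : Series K (I ⊕ I), IsHomog 𝒦 (wdeg (ideg deg)) m f ∧ ω = Submodule.Quotient.mk f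

/-- Homogeneous elements of degree `m` of `DR(L̂W)`, for the grading with `|x_i| = |dx_i|`. -/
def HomogLie (𝒦 : ℤ → AddSubgroup K) (deg : I → ℤ) (m : ℤ) (ω : DRLie K deg) : Prop :=
  ∃ F : lieTens K (tdeg deg),
    IsHomog 𝒦 (fun p => wdeg (ideg deg) p.1 + wdeg (ideg deg) p.2) m (F : Series2 K (I ⊕ I)) ∧
    ω = Submodule.Quotient.mk F

end DeRham

end FormalGeom

open FormalGeom

/-!
The three isomorphisms come from one map on `Ω = T̂(W ⊕ Σ⁻¹W)`, whose words are treated as cyclic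
words.

Let `t` be the cyclic rotation of words with Koszul signs (`rot`) and `N = 1 + t + ⋯ + tⁿ⁻¹` on words
of length `n` (`norm`).  As `n` is invertible, a series without constant term is a sum of commutators
if and only if `N` kills it (`mem_commutators_iff`); so `N` identifies `Ω/[Ω, Ω]` with the cyclically
invariant series.  Let `d` be the differential and `ι` the derivation `dx_i ↦ x_i`, `x_i ↦ 0`.
Cartan's formula `dι + ιd = n` (`diff_iota_add_iota_diff`) shows that a closed 2-form is `d` of a
1-form, unique up to exact forms.  A 1-form is, modulo commutators, `∑ dx_i · y_i` with unique
`y_i ∈ T̂W` (`headD`, `liftD`), and `dx · y ↦ [x, y]` is the operator `1 - t⁻¹` on `∑ x_i · y_i`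
(`headBracket`).  An exact 1-form `dg` corresponds to `N g` (`headD_diff`), and the image of `N` is the
kernel of `1 - t⁻¹`, while the image of `1 - t⁻¹` is the kernel of `N`.  Hence
`ζ(ω) = ∑ [x_i, y_i]`, where `n⁻¹ ιω = ∑ dx_i · y_i` modulo commutators, is an isomorphism of the closed 2-forms with
`[T̂W, T̂W]` (`zetaMap`); its inverse is `h ↦ d(∑ dx_i · y_i)`, where `∑ x_i · y_i` solves
`(1 - t⁻¹)(∑ x_i · y_i) = h` (`etaMap`).

In the commutative case the symmetrisation embeds `ŜV` in `T̂V` (`mem_symIdeal_iff`), its image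
consists of cyclically invariant series, it commutes with `d` and `ι`, and it sends `dx · ȳ` to the
cyclic symmetrisation of `dx · i(y)` (`symL_liftD`).  So `ζ` is the restriction of the associative
one.

In the Lie case the multiplication `x ⊗ y ↦ xy` embeds `DR(L̂W)` in `Ω/[Ω, Ω]` (`mem_lieRel_iff`).  A
retraction is built as follows.  Each cyclic rotation of a product `uv` of Lie words that starts with
a letter of `u` contributes to a series `∑ x_i · g_i` (`pairing`); by the recursion
`pairing [b, c] v = pairing b [c, v] ± pairing c [b, v]` the tails `g_i` are Lie series, and
`∑ x_i ⊗ g_i` is equivalent to `|u| · u ⊗ v` under the relations of `DR(L̂W)`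
(`LieWord.toTens_pairing`).  As `N(uv)` is the sum of the contributions of `u` and `v`, the series
`(|u| + |v|)⁻¹ N(uv)`, with each word `x w` read as `x ⊗ w`, represents `u ⊗ v`.  The Dynkin operator
`x₁ ⋯ xₙ ↦ [x₁, [x₂, … xₙ]]`, which is multiplication by `n` on Lie series (`dynkin_of_mem`), extends
this to a linear map defined on all of `T̂(W ⊕ Σ⁻¹W)` (`splitLie`).  By the Jacobi identity
`[L̂W, L̂W]` is generated by the `[x, y]` with `x ∈ W` (`commutators_lieSeries_le`), so the associative
`ζ` restricts to an isomorphism onto it.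

All maps are given by coefficients of words, so they are defined on all series and continuous, and
identities between them are checked on words and extended by density (`eq_of_mono`,
`map_mem_of_lieWord`).
-/

set_option linter.unusedSectionVars false

namespace FormalGeom

/-! ### Closed spans and continuous linear maps on products -/

section Density

variable {K : Type*} [CommRing K] [TopologicalSpace K] [DiscreteTopology K] {Y : Type*}

open Classical in
theorem tendsto_sum_single (f : Y → K) :
    Filter.Tendsto (fun J : Finset Y => ∑ y ∈ J, f y • (Pi.single y 1 : Y → K)) Filter.atTop
      (nhds f) := by
  refine tendsto_pi_nhds.mpr fun y => ?_
  refine tendsto_const_nhds.congr' ?_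
  filter_upwards [Filter.eventually_ge_atTop {y}] with J hJ
  have hy : y ∈ J := hJ (Finset.mem_singleton_self y)
  rw [Finset.sum_apply, Finset.sum_eq_single y]
  · simp
  · intro b _ hb
    simp [hb.symm]
  · exact fun h => absurd hy h

open Classical in
/-- A continuous linear map on `K^Y` that sends the topological basis into a closed submodule
sends everything into it. -/
theorem map_mem_of_single {M : Type*} [AddCommGroup M] [Module K M] [TopologicalSpace M]
    (L : (Y → K) →ₗ[K] M) (hL : Continuous L) (P : Submodule K M) (hP : IsClosed (P : Set M))
    (h : ∀ y, L (Pi.single y 1) ∈ P) (f : Y → K) : L f ∈ P := by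
  refine hP.mem_of_tendsto ((hL.tendsto f).comp (tendsto_sum_single f)) ?_
  refine Filter.Eventually.of_forall fun J => ?_
  change L _ ∈ P
  rw [map_sum]
  exact P.sum_mem fun y _ => by rw [map_smul]; exact P.smul_mem _ (h y)

open Classical in
theorem eq_of_single {M : Type*} [AddCommGroup M] [Module K M] [TopologicalSpace M] [T2Space M]
    {L L' : (Y → K) →ₗ[K] M} (hL : Continuous L) (hL' : Continuous L')
    (h : ∀ y, L (Pi.single y 1) = L' (Pi.single y 1)) (f : Y → K) : L f = L' f := by
  have h1 := (hL.tendsto f).comp (tendsto_sum_single f)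
  have h2 := (hL'.tendsto f).comp (tendsto_sum_single f)
  refine tendsto_nhds_unique h1 (h2.congr fun J => ?_)
  simp [map_sum, h]

/-- Two continuous linear maps that agree on a set agree on its closed span. -/
theorem eq_on_closedSpan {M : Type*} [AddCommGroup M] [Module K M] [TopologicalSpace M] [T2Space M]
    {L L' : (Y → K) →ₗ[K] M} (hL : Continuous L) (hL' : Continuous L') {S : Set (Y → K)}
    (h : ∀ s ∈ S, L s = L' s) {f : Y → K} (hf : f ∈ closedSpan S) : L f = L' f := by
  have : closedSpan S ≤ LinearMap.eqLocus L L' :=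
    Submodule.topologicalClosure_minimal _ (Submodule.span_le.mpr h) (isClosed_eq hL hL')
  exact this hf

theorem mem_of_closedSpan {M : Type*} [AddCommGroup M] [Module K M] [TopologicalSpace M]
    {L : (Y → K) →ₗ[K] M} (hL : Continuous L) (P : Submodule K M) (hP : IsClosed (P : Set M))
    {S : Set (Y → K)} (h : ∀ s ∈ S, L s ∈ P) {f : Y → K} (hf : f ∈ closedSpan S) : L f ∈ P := by
  have : closedSpan S ≤ P.comap L :=
    Submodule.topologicalClosure_minimal _ (Submodule.span_le.mpr h) (hP.preimage hL)
  exact this hf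

theorem closedSpan_le {S : Set (Y → K)} {P : Submodule K (Y → K)}
    (hP : IsClosed (P : Set (Y → K))) (h : S ⊆ P) : closedSpan S ≤ P :=
  Submodule.topologicalClosure_minimal _ (Submodule.span_le.mpr h) hP

end Density

section Transport

/-- An isomorphism between a submodule of a quotient `M ⧸ S` and a submodule of `P`, induced by
continuous linear maps `Z : M → P` and `H : P → M`. -/
theorem exists_equiv_of_maps {K M P : Type*} [CommRing K] [AddCommGroup M] [Module K M]
    [TopologicalSpace M] [AddCommGroup P] [Module K P] [TopologicalSpace P]
    {S : Submodule K M} {C : Submodule K (M ⧸ S)} {T : Submodule K P}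
    (Z : M →ₗ[K] P) (hZ : Continuous Z) (H : P →ₗ[K] M) (hH : Continuous H)
    (hS : ∀ f ∈ S, Z f = 0) (hT : ∀ f, Submodule.Quotient.mk f ∈ C → Z f ∈ T)
    (hC : ∀ h ∈ T, Submodule.Quotient.mk (H h) ∈ C) (hZH : ∀ h ∈ T, Z (H h) = h)
    (hinj : ∀ f, Submodule.Quotient.mk f ∈ C → Z f = 0 → f ∈ S) :
    ∃ ζ : C ≃L[K] T, (∀ (ω : C) (f : M), (ω : M ⧸ S) = Submodule.Quotient.mk f → (ζ ω : P) = Z f) ∧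
      ∀ (ω : C), (ω : M ⧸ S) = Submodule.Quotient.mk (H (ζ ω)) := by
  have hS' : S ≤ LinearMap.ker Z := hS
  let F : (M ⧸ S) →ₗ[K] P := S.liftQ Z hS'
  have hF : Continuous F := continuous_quot_lift _ hZ
  have hFT : ∀ ω ∈ C, F ω ∈ T := by
    intro ω hω
    obtain ⟨f, rfl⟩ := Submodule.Quotient.mk_surjective _ ω
    exact hT f hω
  let A : C →ₗ[K] T := F.restrict hFT
  let G : T →ₗ[K] C := (S.mkQ.comp H).restrict hC
  have hAG : ∀ h, A (G h) = h := fun h => Subtype.ext (hZH h h.2)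
  have hinjA : Function.Injective A := by
    rw [← LinearMap.ker_eq_bot, LinearMap.ker_eq_bot']
    rintro ⟨ω, hω⟩ h0
    obtain ⟨f, rfl⟩ := Submodule.Quotient.mk_surjective _ ω
    have h1 : Z f = 0 := congrArg Subtype.val h0
    exact Subtype.ext ((Submodule.Quotient.mk_eq_zero _).mpr (hinj f hω h1))
  have hGA : ∀ c, G (A c) = c := fun c => hinjA (hAG _)
  let e : C ≃ₗ[K] T := LinearEquiv.ofLinearMap A G (LinearMap.ext hAG) (LinearMap.ext hGA)
  refine ⟨⟨e, ?_, ?_⟩, ?_, ?_⟩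
  · exact (hF.comp continuous_subtype_val).subtype_mk _
  · exact ((continuous_quot_mk.comp hH).comp continuous_subtype_val).subtype_mk _
  · rintro ⟨ω, hω⟩ f hf
    change F ω = Z f
    change ω = _ at hf
    rw [hf]; rfl
  · intro ω
    exact (congrArg Subtype.val (hGA ω)).symm

end Transport

/-! ### Words, products and degrees -/

section Words

variable {K : Type*} [CommRing K] {X : Type*}

/-- `∂_a f`: the coefficients of `f` on the words that begin with the letter `a`. -/
def lead (a : X) : Series K X →ₗ[K] Series K X where
  toFun f w := f (a :: w)
  map_add' _ _ := rfl
  map_smul' _ _ := rfl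

@[simp] theorem lead_apply (a : X) (f : Series K X) (w : List X) : lead a f w = f (a :: w) := rfl

/-- Multiplication by `c n` on the part of word length `n`. -/
def scale (c : ℕ → K) : Series K X →ₗ[K] Series K X where
  toFun f w := c w.length * f w
  map_add' f g := by funext w; simp [mul_add]
  map_smul' r f := by funext w; simp [mul_left_comm]

@[simp] theorem scale_apply (c : ℕ → K) (f : Series K X) (w : List X) :
    scale c f w = c w.length * f w := rfl

open Classical in
/-- A word, as an element of `T̂V`. -/
noncomputable def mono (w : List X) : Series K X := Pi.single w 1

open Classical in
theorem mono_apply (w v : List X) : (mono w : Series K X) v = if v = w then 1 else 0 := by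
  simp [mono, Pi.single_apply]

theorem lead_mono_self (a : X) (w : List X) : lead a (mono (a :: w) : Series K X) = mono w := by
  classical
  funext v; simp [mono_apply]

theorem lead_mono_of_ne {a b : X} (h : a ≠ b) (w : List X) :
    lead a (mono (b :: w) : Series K X) = 0 := by
  classical
  funext v; simp [mono_apply, h]

theorem lead_mono_nil (a : X) : lead a (mono [] : Series K X) = 0 := by
  classical
  funext v; simp [mono_apply]

theorem series_ext {f g : Series K X} (h0 : f [] = g []) (h : ∀ a, lead a f = lead a g) :
    f = g := by
  funext w
  cases w with
  | nil => exact h0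
  | cons a w => exact congrFun (h a) w

theorem concat_nil (F : Series2 K X) : concat F [] = F ([], []) := by
  simp [concat]

theorem concat_cons (F : Series2 K X) (a : X) (w : List X) :
    concat F (a :: w) = F ([], a :: w) + concat (fun p => F (a :: p.1, p.2)) w := by
  change ∑ k ∈ Finset.range ((a :: w).length + 1), _ = _ + ∑ k ∈ Finset.range (w.length + 1), _
  rw [List.length_cons, Finset.sum_range_succ', add_comm]
  rfl

theorem nmul_nil (f g : Series K X) : nmul f g [] = f [] * g [] := concat_nil _

theorem nmul_cons (f g : Series K X) (a : X) (w : List X) :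
    nmul f g (a :: w) = f [] * g (a :: w) + nmul (lead a f) g w := concat_cons _ _ _

/-- The product as a bilinear map. -/
def mulL : Series K X →ₗ[K] Series K X →ₗ[K] Series K X :=
  LinearMap.mk₂ K nmul nmul_add_left
    (fun c f g => by
      rw [nmul, nmul, ← map_smul]; congr 1; funext p; simp [tens, mul_assoc])
    nmul_add_right
    (fun c f g => by
      rw [nmul, nmul, ← map_smul]; congr 1; funext p; simp [tens, mul_left_comm])

theorem mulL_apply (f g : Series K X) : mulL f g = nmul f g := rfl

theorem zero_nmul (g : Series K X) : nmul 0 g = 0 := by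
  rw [← mulL_apply, map_zero]; rfl

theorem smul_nmul (c : K) (f g : Series K X) : nmul (c • f) g = c • nmul f g := by
  rw [← mulL_apply, map_smul]; rfl

theorem units_smul_nmul (c : ℤˣ) (f g : Series K X) : nmul (c • f) g = c • nmul f g := by
  rcases Int.units_eq_one_or c with rfl | rfl
  · simp
  · simp [← mulL_apply]

theorem nmul_units_smul (c : ℤˣ) (f g : Series K X) : nmul f (c • g) = c • nmul f g := by
  rcases Int.units_eq_one_or c with rfl | rfl
  · simp
  · simp [← mulL_apply]

theorem nmul_sub_left (f f' g : Series K X) : nmul (f - f') g = nmul f g - nmul f' g := by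
  simp [← mulL_apply]

theorem nmul_sub_right (f g g' : Series K X) : nmul f (g - g') = nmul f g - nmul f g' := by
  simp [← mulL_apply]

theorem lead_nmul (a : X) (f g : Series K X) :
    lead a (nmul f g) = f [] • lead a g + nmul (lead a f) g := by
  funext w; exact nmul_cons f g a w

theorem nmul_assoc (f g h : Series K X) : nmul (nmul f g) h = nmul f (nmul g h) := by
  funext w
  induction w generalizing f with
  | nil => simp [nmul_nil, mul_assoc]
  | cons a w ih =>
    rw [nmul_cons, nmul_cons, lead_nmul, nmul_add_left, smul_nmul, nmul_nil, nmul_cons]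
    simp only [Pi.add_apply, Pi.smul_apply, ih, smul_eq_mul]
    ring

theorem mono_nil_nmul (g : Series K X) : nmul (mono []) g = g := by
  refine series_ext (by simp [nmul_nil, mono_apply]) fun a => ?_
  rw [lead_nmul, lead_mono_nil, zero_nmul]
  simp [mono_apply]

theorem mono_nmul_mono (u v : List X) :
    nmul (mono u) (mono v) = (mono (u ++ v) : Series K X) := by
  induction u with
  | nil => exact mono_nil_nmul _
  | cons a u ih =>
    refine series_ext (by simp [nmul_nil, mono_apply]) fun b => ?_
    rw [lead_nmul]
    by_cases h : b = a
    · subst h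
      rw [lead_mono_self, ih, List.cons_append, lead_mono_self]
      simp [mono_apply]
    · rw [lead_mono_of_ne h, List.cons_append, lead_mono_of_ne h, zero_nmul]
      simp [mono_apply]

theorem gen_nil (x : X → K) : gen x [] = 0 := rfl

theorem lead_gen (a : X) (x : X → K) : lead a (gen x) = x a • (mono [] : Series K X) := by
  funext w
  cases w with
  | nil => simp [gen, mono_apply]
  | cons b w => simp [gen, mono_apply]

theorem gen_nmul_nil (x : X → K) (g : Series K X) : nmul (gen x) g [] = 0 := by
  rw [nmul_nil, gen_nil, zero_mul]

theorem lead_gen_nmul (a : X) (x : X → K) (g : Series K X) :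
    lead a (nmul (gen x) g) = x a • g := by
  rw [lead_nmul, lead_gen, smul_nmul, mono_nil_nmul, gen_nil, zero_smul, zero_add]

theorem gen_nmul_cons (x : X → K) (g : Series K X) (a : X) (w : List X) :
    nmul (gen x) g (a :: w) = x a * g w := congrFun (lead_gen_nmul a x g) w

open Classical in
theorem gen_single (a : X) : (gen (Pi.single a 1) : Series K X) = mono [a] := by
  refine series_ext (by simp [gen_nil, mono_apply]) fun b => ?_
  rw [lead_gen]
  by_cases h : b = a
  · subst h; simp [lead_mono_self]
  · simp [lead_mono_of_ne h, h]

theorem wdeg_nil (δ : X → ℤ) : wdeg δ [] = 0 := rfl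

theorem wdeg_cons (δ : X → ℤ) (a : X) (w : List X) : wdeg δ (a :: w) = δ a + wdeg δ w := rfl

/-- `f` is a combination of words of degree `p` and length `n`. -/
def IsPure (δ : X → ℤ) (p : ℤ) (n : ℕ) (f : Series K X) : Prop :=
  ∀ w, f w ≠ 0 → wdeg δ w = p ∧ w.length = n

theorem isPure_mono (δ : X → ℤ) (w : List X) :
    IsPure δ (wdeg δ w) w.length (mono w : Series K X) := by
  classical
  intro v hv
  have : v = w := by
    by_contra h
    simp [mono_apply, h] at hv
  subst this; exact ⟨rfl, rfl⟩

theorem nmul_ne_zero {f g : Series K X} {w : List X} (h : nmul f g w ≠ 0) :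
    ∃ u v, w = u ++ v ∧ f u ≠ 0 ∧ g v ≠ 0 := by
  obtain ⟨k, -, hk⟩ := Finset.exists_ne_zero_of_sum_ne_zero
    (s := Finset.range (w.length + 1)) (f := fun k => tens f g (w.take k, w.drop k)) h
  exact ⟨_, _, (List.take_append_drop k w).symm, left_ne_zero_of_mul hk, right_ne_zero_of_mul hk⟩

theorem IsPure.nmul {δ : X → ℤ} {p q : ℤ} {n m : ℕ} {f g : Series K X} (hf : IsPure δ p n f)
    (hg : IsPure δ q m g) : IsPure δ (p + q) (n + m) (nmul f g) := by
  intro w hw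
  obtain ⟨u, v, rfl, hu, hv⟩ := nmul_ne_zero hw
  rw [wdeg_append, List.length_append, (hf u hu).1, (hf u hu).2, (hg v hv).1, (hg v hv).2]
  exact ⟨rfl, rfl⟩

theorem IsPure.sub {δ : X → ℤ} {p : ℤ} {n : ℕ} {f g : Series K X} (hf : IsPure δ p n f)
    (hg : IsPure δ p n g) : IsPure δ p n (f - g) := by
  intro w hw
  by_cases h : f w = 0
  · exact hg w fun h' => hw (by simp [h, h'])
  · exact hf w h

theorem IsPure.units_smul {δ : X → ℤ} {p : ℤ} {n : ℕ} {f : Series K X} (c : ℤˣ)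
    (hf : IsPure δ p n f) : IsPure δ p n (c • f) := fun w hw =>
  hf w fun h => hw (by simp [h])

theorem IsPure.scale {δ : X → ℤ} {p : ℤ} {n : ℕ} {f : Series K X} (hf : IsPure δ p n f)
    (c : ℕ → K) : scale c f = c n • f := by
  funext w
  by_cases h : f w = 0
  · simp [h]
  · simp [(hf w h).2]

theorem tens_smul_left (c : K) (f g : Series K X) : tens (c • f) g = c • tens f g := by
  funext p; simp [tens, mul_assoc]

theorem tens_smul_right (c : K) (f g : Series K X) : tens f (c • g) = c • tens f g := by
  funext p; simp [tens, mul_left_comm]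

theorem IsPure.tswap_tens {δ : X → ℤ} {p q : ℤ} {n m : ℕ} {f g : Series K X}
    (hf : IsPure δ p n f) (hg : IsPure δ q m g) :
    tswap δ (tens f g) = (p * q).negOnePow • tens g f := by
  funext ⟨u, v⟩
  change (wdeg δ u * wdeg δ v).negOnePow • (f v * g u) = (p * q).negOnePow • (g u * f v)
  by_cases h : f v = 0
  · simp [h]
  by_cases h' : g u = 0
  · simp [h']
  rw [(hf v h).1, (hg u h').1, mul_comm p q, mul_comm (g u)]

theorem concat_units_smul (c : ℤˣ) (F : Series2 K X) : concat (c • F) = c • concat F := by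
  rcases Int.units_eq_one_or c with rfl | rfl <;> simp

theorem IsPure.bracket_eq {δ : X → ℤ} {p q : ℤ} {n m : ℕ} {f g : Series K X}
    (hf : IsPure δ p n f) (hg : IsPure δ q m g) :
    bracket δ f g = FormalGeom.nmul f g - (p * q).negOnePow • FormalGeom.nmul g f := by
  rw [bracket, hf.tswap_tens hg, map_sub, concat_units_smul]; rfl

theorem IsPure.bracket {δ : X → ℤ} {p q : ℤ} {n m : ℕ} {f g : Series K X}
    (hf : IsPure δ p n f) (hg : IsPure δ q m g) :
    IsPure δ (p + q) (n + m) (bracket δ f g) := by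
  rw [hf.bracket_eq hg]
  refine (hf.nmul hg).sub (.units_smul _ ?_)
  rw [add_comm p, add_comm n]
  exact hg.nmul hf

/-- The commutator as a bilinear map. -/
def bracketL (δ : X → ℤ) : Series K X →ₗ[K] Series K X →ₗ[K] Series K X :=
  LinearMap.mk₂ K (bracket δ)
    (fun f f' g => bracket_add_left δ f f' g)
    (fun c f g => by
      rw [bracket, bracket, tens_smul_left, map_smul, ← smul_sub, map_smul])
    (fun f g g' => by
      rw [bracket, tens_add_right, map_add, add_sub_add_comm, map_add]; rfl)
    (fun c f g => by
      rw [bracket, bracket, tens_smul_right, map_smul, ← smul_sub, map_smul])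

theorem bracketL_apply (δ : X → ℤ) (f g : Series K X) : bracketL δ f g = bracket δ f g := rfl

variable [TopologicalSpace K] [DiscreteTopology K]

theorem continuous_lead (a : X) : Continuous (lead a : Series K X →ₗ[K] Series K X) :=
  continuous_pi fun _ => continuous_apply _

theorem continuous_const_mul' {Y : Type*} [TopologicalSpace Y] (c : K) {f : Y → K}
    (hf : Continuous f) : Continuous fun y => c * f y :=
  (continuous_of_discreteTopology (f := fun a : K => c * a)).comp hf

theorem continuous_scale (c : ℕ → K) : Continuous (scale c : Series K X →ₗ[K] Series K X) :=
  continuous_pi fun _ => continuous_const_mul' _ (continuous_apply _)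

theorem continuous_concat : Continuous (concat : Series2 K X →ₗ[K] Series K X) :=
  continuous_pi fun w => continuous_finsetSum (Finset.range (w.length + 1))
    fun k _ => continuous_apply (w.take k, w.drop k)

theorem continuous_tswap (δ : X → ℤ) : Continuous (tswap δ : Series2 K X →ₗ[K] Series2 K X) :=
  continuous_pi fun _ => continuous_units_smul _ (continuous_apply _)

theorem continuous_tens_left (g : Series K X) : Continuous fun f : Series K X => tens f g :=
  continuous_pi fun p => by
    simp only [tens, mul_comm _ (g p.2)]
    exact continuous_const_mul' _ (continuous_apply _)

theorem continuous_tens_right (f : Series K X) : Continuous fun g : Series K X => tens f g :=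
  continuous_pi fun _ => continuous_const_mul' _ (continuous_apply _)

theorem continuous_nmul_left (g : Series K X) : Continuous fun f : Series K X => nmul f g :=
  continuous_concat.comp (continuous_tens_left g)

theorem continuous_nmul_right (f : Series K X) : Continuous fun g : Series K X => nmul f g :=
  continuous_concat.comp (continuous_tens_right f)

theorem continuous_bracket_left (δ : X → ℤ) (g : Series K X) :
    Continuous fun f : Series K X => bracket δ f g :=
  continuous_concat.comp
    ((continuous_tens_left g).sub ((continuous_tswap δ).comp (continuous_tens_left g)))

theorem continuous_bracket_right (δ : X → ℤ) (f : Series K X) :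
    Continuous fun g : Series K X => bracket δ f g :=
  continuous_concat.comp
    ((continuous_tens_right f).sub ((continuous_tswap δ).comp (continuous_tens_right f)))

theorem continuous_gen : Continuous (gen : (X → K) →ₗ[K] Series K X) := by
  refine continuous_pi fun w => ?_
  rcases w with _ | ⟨a, _ | ⟨b, w⟩⟩
  · exact continuous_const
  · exact continuous_apply a
  · exact continuous_const

theorem map_mem_of_mono {M : Type*} [AddCommGroup M] [Module K M] [TopologicalSpace M]
    (L : Series K X →ₗ[K] M) (hL : Continuous L) (P : Submodule K M) (hP : IsClosed (P : Set M))
    (h : ∀ w, L (mono w) ∈ P) (f : Series K X) : L f ∈ P :=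
  map_mem_of_single L hL P hP (fun y => by have := h y; unfold mono at this; convert this) f

theorem eq_of_mono {M : Type*} [AddCommGroup M] [Module K M] [TopologicalSpace M] [T2Space M]
    {L L' : Series K X →ₗ[K] M} (hL : Continuous L) (hL' : Continuous L')
    (h : ∀ w, L (mono w) = L' (mono w)) (f : Series K X) : L f = L' f :=
  eq_of_single hL hL' (fun y => by have := h y; unfold mono at this; convert this) f

/-- A closed submodule that contains `L (x · g_x)` for every letter `x`, where `g_x = ∂_x f`,
contains `L f` for every series `f` without constant term. -/
theorem map_mem_of_lead {M : Type*} [AddCommGroup M] [Module K M] [TopologicalSpace M]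
    (L : Series K X →ₗ[K] M) (hL : Continuous L) (P : Submodule K M) (hP : IsClosed (P : Set M))
    {f : Series K X} (h0 : f [] = 0) (h : ∀ x, L (nmul (mono [x]) (lead x f)) ∈ P) : L f ∈ P := by
  classical
  have ht : Filter.Tendsto (fun J : Finset X => ∑ x ∈ J, nmul (mono [x]) (lead x f)) Filter.atTop
      (nhds f) := by
    refine tendsto_pi_nhds.mpr fun w => tendsto_const_nhds.congr' ?_
    cases w with
    | nil =>
      refine Filter.Eventually.of_forall fun J => ?_
      simp [Finset.sum_apply, ← gen_single, gen_nmul_nil, h0]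
    | cons a w =>
      filter_upwards [Filter.eventually_ge_atTop {a}] with J hJ
      have ha : a ∈ J := hJ (Finset.mem_singleton_self a)
      rw [Finset.sum_apply, Finset.sum_eq_single a]
      · simp [← gen_single, gen_nmul_cons]
      · intro b _ hb
        simp [← gen_single, gen_nmul_cons, hb.symm]
      · exact fun h => absurd ha h
  refine hP.mem_of_tendsto ((hL.tendsto f).comp ht) ?_
  refine Filter.Eventually.of_forall fun J => ?_
  change L _ ∈ P
  rw [map_sum]
  exact P.sum_mem fun x _ => h x

end Words

/-! ### Cyclic rotation, the norm, and commutators -/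

section Rotation

variable {K : Type*} [CommRing K] {X : Type*}

theorem negOnePow_smul_congr {M : Type*} [SMul ℤˣ M] {a b : ℤ} (h : Even (a - b)) (x : M) :
    a.negOnePow • x = b.negOnePow • x := by
  rw [(Int.negOnePow_eq_iff a b).mpr h]

/-- The generator of the cyclic group action on words, with Koszul sign. -/
def rot (δ : X → ℤ) : Module.End K (Series K X) where
  toFun f w := match w with
    | [] => f []
    | a :: w => (δ a * wdeg δ w).negOnePow • f (w ++ [a])
  map_add' f g := by funext w; cases w <;> simp
  map_smul' c f := by funext w; cases w <;> simp [mul_smul_comm]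

variable (δ : X → ℤ)

theorem rot_cons (f : Series K X) (a : X) (w : List X) :
    rot δ f (a :: w) = (δ a * wdeg δ w).negOnePow • f (w ++ [a]) := rfl

theorem rot_pow_succ (f : Series K X) (k : ℕ) : (rot δ ^ (k + 1)) f = rot δ ((rot δ ^ k) f) := by
  rw [pow_succ']; rfl

theorem rot_pow_succ' (f : Series K X) (k : ℕ) : (rot δ ^ (k + 1)) f = (rot δ ^ k) (rot δ f) := by
  rw [pow_succ]; rfl

/-- Rotating by the length of a prefix exchanges it with the rest of the word. -/
theorem rot_pow_append (f : Series K X) (u v : List X) :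
    (rot δ ^ u.length) f (u ++ v) = (wdeg δ u * wdeg δ v).negOnePow • f (v ++ u) := by
  induction u generalizing v with
  | nil => simp [wdeg_nil]
  | cons a u ih =>
    rw [List.length_cons, rot_pow_succ, List.cons_append, rot_cons, List.append_assoc, ih,
      smul_smul, ← Int.negOnePow_add, List.append_assoc]
    refine negOnePow_smul_congr ?_ _
    simp only [wdeg_append, wdeg_cons, wdeg_nil]
    exact ⟨wdeg δ u * δ a, by ring⟩

theorem rot_pow_length (f : Series K X) (w : List X) : (rot δ ^ w.length) f w = f w := by
  simpa [wdeg_nil] using rot_pow_append δ f w []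

theorem rot_pow_congr {f g : Series K X} (k : ℕ) {w : List X}
    (h : ∀ v : List X, v.length = w.length → f v = g v) :
    (rot δ ^ k) f w = (rot δ ^ k) g w := by
  induction k generalizing w with
  | zero => exact h w rfl
  | succ k ih =>
    rw [rot_pow_succ, rot_pow_succ]
    cases w with
    | nil => exact ih h
    | cons a w =>
      rw [rot_cons, rot_cons, ih]
      intro v hv
      exact h v (by simpa using hv)

theorem rot_pow_scale (c : ℕ → K) (k : ℕ) (f : Series K X) :
    (rot δ ^ k) (scale c f) = scale c ((rot δ ^ k) f) := by
  funext w
  have : (rot δ ^ k) (scale c f) w = (rot δ ^ k) (c w.length • f) w :=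
    rot_pow_congr δ k fun v hv => by simp [hv]
  rw [this, map_smul]; rfl

/-- The sum over all cyclic rotations; zero on the empty word. -/
def norm : Series K X →ₗ[K] Series K X where
  toFun f w := ∑ k ∈ Finset.range w.length, (rot δ ^ k) f w
  map_add' f g := by funext w; simp [Finset.sum_add_distrib]
  map_smul' c f := by funext w; simp [Finset.mul_sum]

theorem norm_apply (f : Series K X) (w : List X) :
    norm δ f w = ∑ k ∈ Finset.range w.length, (rot δ ^ k) f w := rfl

theorem norm_nil (f : Series K X) : norm δ f [] = 0 := by simp [norm_apply]

theorem norm_scale (c : ℕ → K) (f : Series K X) : norm δ (scale c f) = scale c (norm δ f) := by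
  funext w
  simp [norm_apply, rot_pow_scale, Finset.mul_sum]

theorem sum_rot_pow_succ (f : Series K X) (w : List X) :
    ∑ k ∈ Finset.range w.length, (rot δ ^ (k + 1)) f w = norm δ f w := by
  have h := Finset.sum_range_succ' (fun k => (rot δ ^ k) f w) w.length
  rw [Finset.sum_range_succ, rot_pow_length] at h
  exact (add_right_cancel h).symm

theorem norm_rot (f : Series K X) : norm δ (rot δ f) = norm δ f := by
  funext w
  rw [← sum_rot_pow_succ δ f, norm_apply]
  simp only [rot_pow_succ']

theorem norm_rot_pow (f : Series K X) (k : ℕ) : norm δ ((rot δ ^ k) f) = norm δ f := by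
  induction k with
  | zero => rfl
  | succ k ih => rw [rot_pow_succ, norm_rot, ih]

theorem rot_norm (f : Series K X) : rot δ (norm δ f) = norm δ f := by
  funext w
  cases w with
  | nil => rfl
  | cons a w =>
    rw [← sum_rot_pow_succ, rot_cons, norm_apply, Finset.smul_sum]
    simp [rot_pow_succ, rot_cons]

theorem rot_pow_of_rot {f : Series K X} (h : rot δ f = f) (k : ℕ) : (rot δ ^ k) f = f := by
  induction k with
  | zero => rfl
  | succ k ih => rw [rot_pow_succ, ih, h]

/-- On cyclic invariants the norm is multiplication by the word length. -/
theorem norm_of_rot {f : Series K X} (h : rot δ f = f) : norm δ f = scale (fun n => (n : K)) f := by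
  funext w
  simp [norm_apply, rot_pow_of_rot δ h]

theorem rot_pow_mono (u v : List X) :
    (rot δ ^ u.length) (mono (v ++ u) : Series K X) =
      (wdeg δ u * wdeg δ v).negOnePow • mono (u ++ v) := by
  classical
  funext w
  by_cases hw : w.length = (u ++ v).length
  · obtain ⟨u', v', rfl, hu, hv⟩ : ∃ u' v', w = u' ++ v' ∧ u'.length = u.length ∧
        v'.length = v.length :=
      ⟨w.take u.length, w.drop u.length, (List.take_append_drop _ _).symm, by simp [hw],
        by simp [hw]⟩
    rw [← hu, rot_pow_append]
    by_cases h : u' ++ v' = u ++ v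
    · obtain ⟨rfl, rfl⟩ := List.append_inj h hu
      simp [mono_apply]
    · have h' : v' ++ u' ≠ v ++ u := fun h' => h (by
        obtain ⟨rfl, rfl⟩ := List.append_inj h' hv
        rfl)
      simp [mono_apply, h, h']
  · have h1 : (rot δ ^ u.length) (mono (v ++ u) : Series K X) w = 0 := by
      rw [rot_pow_congr δ (g := 0), map_zero]
      · rfl
      · intro x hx
        have : x ≠ v ++ u := fun h => hw (by rw [← hx, h]; simp [add_comm])
        simp [mono_apply, this]
    have h2 : w ≠ u ++ v := fun h => hw (by rw [h])
    rw [h1]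
    simp [mono_apply, h2]

theorem bracket_mono (u v : List X) :
    bracket δ (mono u) (mono v) = (mono (u ++ v) : Series K X) -
      (rot δ ^ v.length) (mono (u ++ v)) := by
  rw [(isPure_mono δ u).bracket_eq (isPure_mono δ v), mono_nmul_mono, mono_nmul_mono, rot_pow_mono,
    mul_comm]

theorem bracket_nil (f g : Series K X) : bracket δ f g [] = 0 := by
  rw [bracket, concat_nil]
  simp [tens, tswap, wdeg_nil]

section Rational

variable [Algebra ℚ K]

/-- The coefficient `1 / n` of `K`, zero for `n = 0`. -/
noncomputable def rinv (K : Type*) [CommRing K] [Algebra ℚ K] (n : ℕ) : K :=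
  algebraMap ℚ K (1 / (n : ℚ))

theorem rinv_mul {n : ℕ} (h : n ≠ 0) : rinv K n * n = 1 := by
  have h1 : (n : K) = algebraMap ℚ K n := (map_natCast _ n).symm
  rw [rinv, h1, ← map_mul, one_div_mul_cancel (by exact_mod_cast h), map_one]

theorem mul_rinv {n : ℕ} (h : n ≠ 0) : (n : K) * rinv K n = 1 := by
  rw [mul_comm, rinv_mul h]

theorem eq_zero_of_natCast_mul {n : ℕ} (h : n ≠ 0) {x : K} (hx : (n : K) * x = 0) : x = 0 := by
  rw [← one_mul x, ← rinv_mul h, mul_assoc, hx, mul_zero]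

end Rational

section Topology

variable [TopologicalSpace K] [DiscreteTopology K]

theorem continuous_rot : Continuous (rot δ : Series K X →ₗ[K] Series K X) := by
  refine continuous_pi fun w => ?_
  cases w with
  | nil => exact continuous_apply []
  | cons a w => exact continuous_units_smul _ (continuous_apply (w ++ [a]))

theorem continuous_rot_pow (k : ℕ) : Continuous ((rot δ ^ k : Module.End K (Series K X))) := by
  induction k with
  | zero => exact continuous_id
  | succ k ih =>
    have : ⇑(rot δ ^ (k + 1) : Module.End K (Series K X)) = rot δ ∘ ⇑(rot δ ^ k) :=
      funext fun f => rot_pow_succ δ f k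
    rw [this]; exact (continuous_rot δ).comp ih

theorem continuous_norm : Continuous (norm δ : Series K X →ₗ[K] Series K X) :=
  continuous_pi fun w => continuous_finsetSum (Finset.range w.length)
    fun k _ => (continuous_apply w).comp (continuous_rot_pow δ k)

theorem norm_bracket (f g : Series K X) : norm δ (bracket δ f g) = 0 := by
  have h1 : ∀ u : List X, norm δ (bracket δ (mono u) g) = 0 := fun u =>
    eq_of_mono (L := norm δ ∘ₗ bracketL δ (mono u)) (L' := 0)
      ((continuous_norm δ).comp (continuous_bracket_right δ _)) continuous_const
      (fun v => by
        change norm δ (bracket δ (mono u) (mono v)) = 0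
        rw [bracket_mono, map_sub, norm_rot_pow, sub_self]) g
  exact eq_of_mono (L := norm δ ∘ₗ (bracketL δ).flip g) (L' := 0)
      ((continuous_norm δ).comp (continuous_bracket_left δ _)) continuous_const h1 f

theorem sub_rot_pow_mono_mem (w : List X) (k : ℕ) (hk : k ≤ w.length) :
    mono w - (rot δ ^ k) (mono w) ∈ commutators (K := K) δ Set.univ Set.univ := by
  have := bracket_mono (K := K) δ (w.take (w.length - k)) (w.drop (w.length - k))
  rw [List.take_append_drop, List.length_drop, Nat.sub_sub_self hk] at this
  exact subset_closedSpan ⟨_, trivial, _, trivial, this.symm⟩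

theorem norm_mono (w : List X) :
    norm δ (mono w : Series K X) = ∑ k ∈ Finset.range w.length, (rot δ ^ k) (mono w) := by
  funext v
  rw [Finset.sum_apply, norm_apply]
  by_cases h : v.length = w.length
  · rw [h]
  · have h0 : ∀ k, (rot δ ^ k) (mono w : Series K X) v = 0 := fun k => by
      rw [rot_pow_congr δ (g := 0), map_zero]
      · rfl
      · intro x hx
        have : x ≠ w := fun h' => h (by rw [← hx, h'])
        simp [mono_apply, this]
    simp [h0]

variable [Algebra ℚ K]

/-- The closed span of the commutators is the kernel of the norm: in each length, the kernel of
the norm of a finite cyclic group is the image of `1 - t`, as the group order is invertible. -/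
theorem mem_commutators_iff {f : Series K X} :
    f ∈ commutators (K := K) δ Set.univ Set.univ ↔ f [] = 0 ∧ norm δ f = 0 := by
  constructor
  · intro hf
    constructor
    · refine eq_on_closedSpan (L := LinearMap.proj []) (L' := 0) (continuous_apply _)
        continuous_const ?_ hf
      rintro _ ⟨a, -, b, -, rfl⟩
      exact bracket_nil δ a b
    · refine eq_on_closedSpan (L := norm δ) (L' := 0) (continuous_norm δ)
        continuous_const ?_ hf
      rintro _ ⟨a, -, b, -, rfl⟩
      exact norm_bracket δ a b
  · rintro ⟨h0, hN⟩
    -- `c` is `1` in positive length and `0` on the empty word.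
    let c : ℕ → K := fun n => rinv K n * n
    let E : Series K X →ₗ[K] Series K X := scale c - scale (rinv K) ∘ₗ norm δ
    have key := map_mem_of_mono (K := K) E
      ((continuous_scale c).sub ((continuous_scale _).comp (continuous_norm δ)))
      (commutators (K := K) δ Set.univ Set.univ) (isClosed_closedSpan _) (fun w => by
        have e : E (mono w) =
            rinv K w.length • ∑ k ∈ Finset.range w.length, (mono w - (rot δ ^ k) (mono w)) := by
          change scale c (mono w) - scale (rinv K) (norm δ (mono w)) = _
          rw [← norm_scale, (isPure_mono δ w).scale, (isPure_mono δ w).scale, map_smul, norm_mono,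
            Finset.sum_sub_distrib, smul_sub, Finset.sum_const, Finset.card_range]
          congr 1
          simp only [c, mul_smul, Nat.cast_smul_eq_nsmul]
        rw [e]
        exact Submodule.smul_mem _ _ (Submodule.sum_mem _ fun k hk =>
          sub_rot_pow_mono_mem δ w k (Finset.mem_range.mp hk).le)) f
    have e : E f = f := by
      change scale c f - scale (rinv K) (norm δ f) = f
      rw [hN, map_zero, sub_zero]
      funext w
      cases w with
      | nil => simp [h0]
      | cons a w =>
        have : c (a :: w).length = 1 := rinv_mul (by simp)
        rw [scale_apply, this, one_mul]
    rwa [e] at key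

end Topology

end Rotation

/-! ### Derivations that substitute letters -/

section Der

variable {K : Type*} [CommRing K] {X : Type*} (Δ : X → ℤ) (s : ℤ) (e : X → Option X)

theorem units_smul_mem {A : AddSubgroup K} (c : ℤˣ) {x : K} (h : x ∈ A) : c • x ∈ A := by
  rcases Int.units_eq_one_or c with rfl | rfl
  · simpa using h
  · simpa using h

theorem map_units_smul {M N : Type*} [AddCommGroup M] [Module K M] [AddCommGroup N] [Module K N]
    (L : M →ₗ[K] N) (c : ℤˣ) (f : M) : L (c • f) = c • L f := by
  rcases Int.units_eq_one_or c with rfl | rfl <;> simp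

/-- The coefficient of a word in `der Δ s e f`. -/
def derAux : List X → Series K X → K
  | [], _ => 0
  | a :: w, f => (e a).elim 0 (fun b => f (b :: w)) + (s * Δ a).negOnePow • derAux w (lead a f)

/-- The continuous derivation of degree `s` of `T̂V`, for letters of degree `Δ`, that sends a letter
`b` to the sum of the letters `a` with `e a = some b`. -/
def der : Series K X →ₗ[K] Series K X where
  toFun f w := derAux Δ s e w f
  map_add' f g := by
    funext w
    induction w generalizing f g with
    | nil => simp [derAux]
    | cons a w ih =>
      have := ih (lead a f) (lead a g)
      simp only [Pi.add_apply] at this ⊢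
      rw [derAux, derAux, derAux, map_add, this, smul_add]
      cases e a with
      | none => simp
      | some b => simp; abel
  map_smul' c f := by
    funext w
    induction w generalizing f with
    | nil => simp [derAux]
    | cons a w ih =>
      have := ih (lead a f)
      simp only [Pi.smul_apply, RingHom.id_apply] at this ⊢
      rw [derAux, derAux, map_smul, this, smul_add, smul_comm c]
      cases e a <;> simp

theorem der_nil (f : Series K X) : der Δ s e f [] = 0 := rfl

theorem der_cons (f : Series K X) (a : X) (w : List X) :
    der Δ s e f (a :: w) =
      (e a).elim 0 (fun b => f (b :: w)) + (s * Δ a).negOnePow • der Δ s e (lead a f) w := rfl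

theorem lead_der (f : Series K X) (a : X) :
    lead a (der Δ s e f) =
      (e a).elim 0 (fun b => lead b f) + (s * Δ a).negOnePow • der Δ s e (lead a f) := by
  funext w
  rw [lead_apply, der_cons]
  cases e a <;> rfl

theorem der_congr_length {f g : Series K X} {w : List X}
    (h : ∀ v : List X, v.length = w.length → f v = g v) : der Δ s e f w = der Δ s e g w := by
  induction w generalizing f g with
  | nil => rfl
  | cons a w ih =>
    rw [der_cons, der_cons, ih (f := lead a f) (g := lead a g) (fun v hv => h (a :: v) (by simp [hv]))]
    cases e a with
    | none => rfl
    | some b => simp [h (b :: w) (by simp)]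

theorem der_scale (c : ℕ → K) (f : Series K X) :
    der Δ s e (scale c f) = scale c (der Δ s e f) := by
  funext w
  have : der Δ s e (scale c f) w = der Δ s e (c w.length • f) w :=
    der_congr_length Δ s e fun v hv => by simp [hv]
  rw [this, map_smul]; rfl

theorem der_append (f : Series K X) (u v : List X) :
    der Δ s e f (u ++ v) = der Δ s e (fun u' => f (u' ++ v)) u +
      (s * wdeg Δ u).negOnePow • der Δ s e (fun v' => f (u ++ v')) v := by
  induction u generalizing f with
  | nil => simp [der_nil, wdeg_nil]
  | cons a u ih =>
    rw [List.cons_append, der_cons, der_cons, ih, smul_add, smul_smul, ← Int.negOnePow_add,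
      ← mul_add, ← wdeg_cons, add_assoc]
    rfl

variable {Δ s e}

/-- A derivation of degree `s` commutes with a sign that depends on the degree of the word, up to the
shift of that degree by `s`. -/
theorem der_twist (he : ∀ a b, e a = some b → Δ a = Δ b + s) {f g : Series K X} (c k : ℤ)
    (h : ∀ v, f v = (wdeg Δ v * c + k).negOnePow • g v) (w : List X) :
    der Δ s e f w = ((wdeg Δ w - s) * c + k).negOnePow • der Δ s e g w := by
  induction w generalizing f g k with
  | nil => simp [der_nil]
  | cons a w ih =>
    have h' : ∀ v, lead a f v = (wdeg Δ v * c + (Δ a * c + k)).negOnePow • lead a g v := by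
      intro v
      rw [lead_apply, h, wdeg_cons]
      congr 2; ring
    rw [der_cons, der_cons, ih _ h', smul_add, smul_comm (s * Δ a).negOnePow]
    congr 1
    · cases hb : e a with
      | none => simp
      | some b =>
        simp only [Option.elim]
        rw [h, wdeg_cons, wdeg_cons, he a b hb]
        congr 2; ring
    · rw [wdeg_cons]
      congr 2; ring

theorem rot_der (he : ∀ a b, e a = some b → Δ a = Δ b + s) (f : Series K X) :
    rot Δ (der Δ s e f) = der Δ s e (rot Δ f) := by
  funext w
  cases w with
  | nil => rfl
  | cons a w =>
    have h : ∀ v, lead a (rot Δ f) v =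
        (wdeg Δ v * Δ a + 0).negOnePow • (fun u' => f (u' ++ [a]) : Series K X) v := fun v => by
      rw [lead_apply, rot_cons, mul_comm, add_zero]
    rw [rot_cons, der_append, der_cons Δ s e (rot Δ f) a w, der_twist he _ _ h, smul_add, smul_smul, smul_smul,
      ← Int.negOnePow_add, ← Int.negOnePow_add, add_comm]
    congr 1
    · rw [der_cons]
      cases hb : e a with
      | none => simp [der_nil]
      | some b =>
        simp only [Option.elim, der_nil, smul_zero, add_zero, rot_cons]
        refine negOnePow_smul_congr ?_ _
        rw [he a b hb]
        exact ⟨s * wdeg Δ w, by ring⟩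
    · refine negOnePow_smul_congr ?_ _
      exact ⟨0, by ring⟩

theorem rot_pow_der (he : ∀ a b, e a = some b → Δ a = Δ b + s) (k : ℕ) (f : Series K X) :
    (rot Δ ^ k) (der Δ s e f) = der Δ s e ((rot Δ ^ k) f) := by
  induction k with
  | zero => rfl
  | succ k ih => rw [rot_pow_succ, rot_pow_succ, ih, rot_der he]

theorem norm_der (he : ∀ a b, e a = some b → Δ a = Δ b + s) (f : Series K X) :
    norm Δ (der Δ s e f) = der Δ s e (norm Δ f) := by
  funext w
  have h : der Δ s e (norm Δ f) w = der Δ s e (∑ k ∈ Finset.range w.length, (rot Δ ^ k) f) w :=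
    der_congr_length Δ s e fun v hv => by rw [norm_apply, hv, Finset.sum_apply]
  rw [h, map_sum, norm_apply, Finset.sum_apply]
  simp only [rot_pow_der he]

theorem der_nmul {f : Series K X} (g : Series K X)
    {p : ℤ} {n : ℕ} (hf : IsPure Δ p n f) :
    der Δ s e (nmul f g) = nmul (der Δ s e f) g + (s * p).negOnePow • nmul f (der Δ s e g) := by
  have key : ∀ (w : List X) (f : Series K X) (p : ℤ), (∀ v, f v ≠ 0 → wdeg Δ v = p) →
      der Δ s e (nmul f g) w =
        nmul (der Δ s e f) g w + (s * p).negOnePow • nmul f (der Δ s e g) w := by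
    intro w
    induction w with
    | nil => intro f p _; simp [der_nil, nmul_nil]
    | cons a w ih =>
      intro f p hf
      have h0 : (s * p).negOnePow • f [] = f [] := by
        by_cases h : f [] = 0
        · simp [h]
        · rw [← hf _ h, wdeg_nil]; simp
      have h0' : ∀ x : K, (s * p).negOnePow • (f [] * x) = f [] * x := fun x => by
        rw [← smul_mul_assoc, h0]
      have ih' := ih (lead a f) (p - Δ a) fun v hv => by
        have := hf (a :: v) hv
        rw [wdeg_cons] at this; omega
      rw [der_cons, lead_nmul, map_add, map_smul, Pi.add_apply, ih', nmul_cons, nmul_cons, lead_der,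
        nmul_add_left, units_smul_nmul, der_nil, zero_mul, zero_add, der_cons, smul_add,
        smul_add, smul_add, h0', smul_smul, ← Int.negOnePow_add]
      have hs : ∀ x : K, (s * Δ a + s * (p - Δ a)).negOnePow • x = (s * p).negOnePow • x :=
        fun x => negOnePow_smul_congr ⟨0, by ring⟩ x
      rw [hs]
      cases e a with
      | none =>
        simp only [Option.elim, zero_nmul, Pi.add_apply, Pi.smul_apply, Pi.zero_apply, smul_eq_mul,
          mul_smul_comm, zero_add]
        ring
      | some b =>
        simp only [Option.elim, nmul_cons, Pi.add_apply, Pi.smul_apply, smul_eq_mul, mul_add,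
          mul_smul_comm]
        ring
  funext w
  exact key w f p fun v hv => (hf v hv).1

section Topology
variable [TopologicalSpace K] [DiscreteTopology K]

theorem continuous_der : Continuous (der Δ s e : Series K X →ₗ[K] Series K X) := by
  have key : ∀ w : List X, Continuous (fun f : Series K X => derAux Δ s e w f) := by
    intro w
    induction w with
    | nil => exact continuous_const
    | cons a w ih =>
      refine Continuous.add ?_ (continuous_units_smul _ (ih.comp (continuous_lead a)))
      cases e a with
      | none => exact continuous_const
      | some b => exact continuous_apply (b :: w)
  exact continuous_pi key

end Topology

end Der

/-! ### Gradings by weights of letters -/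

section Graded

variable {K : Type*} [CommRing K] {X : Type*}

/-- The coefficient of each word of weight `j` lies in `A j`.  This covers homogeneity
(`A j = 𝒦 (m - j)`) and conditions on supports (`A j ∈ {⊥, ⊤}`). -/
def Graded (ω : X → ℤ) (A : ℤ → AddSubgroup K) (f : Series K X) : Prop :=
  ∀ w, f w ∈ A (wdeg ω w)

variable {ω : X → ℤ} {A : ℤ → AddSubgroup K} {f g : Series K X}

theorem Graded.sub (hf : Graded ω A f) (hg : Graded ω A g) : Graded ω A (f - g) :=
  fun w => sub_mem (hf w) (hg w)

theorem Graded.lead (hf : Graded ω A f) (a : X) : Graded ω (fun j => A (ω a + j)) (lead a f) :=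
  fun w => hf (a :: w)

theorem Graded.rot (hf : Graded ω A f) (δ : X → ℤ) : Graded ω A (rot δ f) := by
  intro w
  cases w with
  | nil => exact hf []
  | cons a w =>
    refine units_smul_mem _ ?_
    have := hf (w ++ [a])
    rwa [wdeg_append, add_comm, wdeg_cons, wdeg_nil, add_zero] at this

theorem Graded.rot_pow (hf : Graded ω A f) (δ : X → ℤ) (k : ℕ) :
    Graded ω A ((FormalGeom.rot δ ^ k) f) := by
  induction k with
  | zero => exact hf
  | succ k ih => rw [rot_pow_succ]; exact ih.rot δ

theorem Graded.norm (hf : Graded ω A f) (δ : X → ℤ) : Graded ω A (norm δ f) :=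
  fun w => sum_mem (t := Finset.range w.length) fun k _ => hf.rot_pow δ k w

theorem Graded.der {Δ : X → ℤ} {s : ℤ} {e : X → Option X} {r : ℤ}
    (he : ∀ a b, e a = some b → ω a = ω b + r) (hf : Graded ω A f) :
    Graded ω (fun j => A (j - r)) (der Δ s e f) := by
  intro w
  induction w generalizing f A with
  | nil => exact zero_mem _
  | cons a w ih =>
    refine add_mem ?_ (units_smul_mem _ ?_)
    · cases hb : e a with
      | none => exact zero_mem _
      | some b =>
        have := hf (b :: w)
        rw [wdeg_cons, he a b hb]
        rw [wdeg_cons] at this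
        have h : ω b + r + wdeg ω w - r = ω b + wdeg ω w := by ring
        simpa [h] using this
    · have := ih (hf.lead a)
      have h : ω a + wdeg ω w - r = ω a + (wdeg ω w - r) := by ring
      simp only [wdeg_cons, h]
      exact this

/-- Closure under division by positive integers. -/
def DivClosed [Algebra ℚ K] (A : ℤ → AddSubgroup K) : Prop :=
  ∀ j (q : ℚ), ∀ x ∈ A j, algebraMap ℚ K q * x ∈ A j

theorem Graded.scale [Algebra ℚ K] (hA : DivClosed A) (c : ℕ → ℚ) (hf : Graded ω A f) :
    Graded ω A (scale (fun n => algebraMap ℚ K (c n)) f) :=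
  fun w => hA _ _ _ (hf w)

theorem Graded.concat {F : Series2 K X} (hF : ∀ p, F p ∈ A (wdeg ω p.1 + wdeg ω p.2)) :
    Graded ω A (concat F) := fun w => sum_mem (t := Finset.range (w.length + 1)) fun k _ => by
  have := hF (w.take k, w.drop k)
  rwa [wdeg_take_add_drop] at this

theorem divClosed_support [Algebra ℚ K] (S : ℤ → Prop) [DecidablePred S] :
    DivClosed (fun j => if S j then (⊤ : AddSubgroup K) else ⊥) := by
  intro j q x hx
  by_cases h : S j
  · simp [h]
  · simp only [h, if_false, AddSubgroup.mem_bot] at hx ⊢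
    rw [hx, mul_zero]

/-- As `K` contains `ℚ`, the homogeneous parts of a grading are `ℚ`-subspaces. -/
theorem divClosed_grading [Algebra ℚ K] (𝒦 : ℤ → AddSubgroup K) [GradedRing 𝒦] (m : ℤ) :
    DivClosed (fun j => 𝒦 (m - j)) := by
  have key : ∀ (i : ℤ) (n : ℕ), n ≠ 0 → ∀ x ∈ 𝒦 i, algebraMap ℚ K (1 / n) * x ∈ 𝒦 i := by
    intro i n hn x hx
    have hx' : (n : K) * (algebraMap ℚ K (1 / n) * x) = x := by
      rw [← mul_assoc]
      exact (congrArg (· * x) (mul_rinv (K := K) hn)).trans (one_mul x)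
    set y := algebraMap ℚ K (1 / n) * x
    have h2 : ∀ j, j ≠ i → (GradedRing.proj 𝒦 j y) = 0 := by
      intro j hj
      refine eq_zero_of_natCast_mul hn ?_
      rw [← nsmul_eq_mul, ← map_nsmul, nsmul_eq_mul, hx', GradedRing.proj_apply]
      exact DirectSum.decompose_of_mem_ne 𝒦 hx hj.symm
    have h3 : y = GradedRing.proj 𝒦 i y := by
      classical
      conv_lhs => rw [← DirectSum.sum_support_decompose 𝒦 y]
      rw [Finset.sum_eq_single i]
      · rfl
      · intro j _ hj; exact h2 j hj
      · intro h
        simpa using h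
    rw [h3]
    exact SetLike.coe_mem _
  intro j q x hx
  have h1 : algebraMap ℚ K q * x = q.num • (algebraMap ℚ K (1 / q.den) * x) := by
    conv_lhs => rw [← Rat.num_div_den q, div_eq_mul_one_div, map_mul]
    rw [zsmul_eq_mul, mul_assoc, map_intCast]
  rw [h1]
  exact zsmul_mem (key _ _ q.den_nz x hx) _

end Graded

/-! ### One-forms and the bracket with a letter -/

section OneForms

variable {K : Type*} [CommRing K] {I : Type*}

/-- The substitution table of the derivation `x_i ↦ dx_i`, `dx_i ↦ 0`. -/
def eD : I ⊕ I → Option (I ⊕ I) := Sum.elim (fun _ => none) (fun i => some (Sum.inl i))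

/-- The substitution table of the derivation `dx_i ↦ x_i`, `x_i ↦ 0`. -/
def eI : I ⊕ I → Option (I ⊕ I) := Sum.elim (fun i => some (Sum.inr i)) (fun _ => none)

@[simp] theorem eD_inl (i : I) : eD (Sum.inl i) = none := rfl
@[simp] theorem eD_inr (i : I) : eD (Sum.inr i) = some (Sum.inl i) := rfl
@[simp] theorem eI_inl (i : I) : eI (Sum.inl i) = some (Sum.inr i) := rfl
@[simp] theorem eI_inr (i : I) : eI (Sum.inr i : I ⊕ I) = none := rfl

theorem units_smul_eq_mul (c : ℤˣ) (x : K) : c • x = ((c : ℤ) : K) * x := by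
  rw [Units.smul_def, zsmul_eq_mul]

/-- The contraction with the Euler vector field: the derivation of degree `-1` with `dx_i ↦ x_i`
and `x_i ↦ 0`. -/
def iota (deg : I → ℤ) : Series K (I ⊕ I) →ₗ[K] Series K (I ⊕ I) := der (tdeg deg) (-1) eI

theorem eD_weight {ω : I ⊕ I → ℤ} {s : ℤ} (h : ∀ i, ω (Sum.inr i) = ω (Sum.inl i) + s) :
    ∀ a b, eD a = some b → ω a = ω b + s := by
  rintro (i | i) b hb
  · simp [eD] at hb
  · simp only [eD, Sum.elim_inr, Option.some.injEq] at hb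
    rw [← hb, h]

theorem eI_weight {ω : I ⊕ I → ℤ} {s : ℤ} (h : ∀ i, ω (Sum.inl i) = ω (Sum.inr i) + s) :
    ∀ a b, eI a = some b → ω a = ω b + s := by
  rintro (i | i) b hb
  · simp only [eI, Sum.elim_inl, Option.some.injEq] at hb
    rw [← hb, h]
  · simp [eI] at hb

theorem eD_tdeg (deg : I → ℤ) : ∀ a b, eD a = some b → tdeg deg a = tdeg deg b + 1 :=
  eD_weight fun _ => rfl

theorem eI_tdeg (deg : I → ℤ) : ∀ a b, eI a = some b → tdeg deg a = tdeg deg b + -1 :=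
  eI_weight fun i => by simp [tdeg]

theorem diff_eq_der (deg : I → ℤ) :
    (diff deg : Series K (I ⊕ I) →ₗ[K] Series K (I ⊕ I)) = der (tdeg deg) 1 eD := by
  refine LinearMap.ext fun f => funext fun w => ?_
  induction w generalizing f with
  | nil => rw [diff_apply]; simp [der_nil]
  | cons a w ih =>
    rw [der_cons, ← ih, diff_apply, diff_apply, List.length_cons, Finset.sum_range_succ', add_comm,
      Finset.smul_sum]
    congr 1
    · rcases a with i | i <;> simp [eD, wdeg_nil]
    · refine Finset.sum_congr rfl fun k _ => ?_
      simp only [List.getElem?_cons_succ, List.take_succ_cons, wdeg_cons, Int.negOnePow_add, one_mul,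
        List.set_cons_succ, lead_apply]
      split
      · rw [mul_smul]
      · simp

/-- Cartan's formula: `dι + ιd` is multiplication by the word length. -/
theorem diff_iota_add_iota_diff (deg : I → ℤ) (f : Series K (I ⊕ I)) :
    diff deg (iota deg f) + iota deg (diff deg f) = scale (fun n => (n : K)) f := by
  rw [diff_eq_der, iota]
  funext w
  induction w generalizing f with
  | nil => simp [der_nil]
  | cons a w ih =>
    have ih' := ih (lead a f)
    rw [Pi.add_apply] at ih' ⊢
    rw [der_cons, der_cons, lead_der, lead_der]
    have hu : ∀ i : I, ((tdeg deg (Sum.inl i)).negOnePow : ℤ) * (tdeg deg (Sum.inl i)).negOnePow =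
      1 := fun i => by rw [← Units.val_mul, Int.units_mul_self]; rfl
    have hv : ∀ i : I, ((tdeg deg (Sum.inr i)).negOnePow : ℤ) =
      - (tdeg deg (Sum.inl i)).negOnePow := fun i => by simp [tdeg, Int.negOnePow_add]
    rw [scale_apply, List.length_cons]
    rw [scale_apply, lead_apply] at ih'
    push_cast
    rw [add_mul, ← ih', one_mul]
    have hK : ∀ i : I, (((tdeg deg (Sum.inl i)).negOnePow : ℤ) : K) *
        ((tdeg deg (Sum.inl i)).negOnePow : ℤ) = 1 := fun i => by
      rw [← Int.cast_mul, hu, Int.cast_one]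
    rcases a with i | i
    · simp only [eD_inl, eI_inl, Option.elim, zero_add, map_add, Pi.add_apply, map_units_smul,
        Pi.smul_apply, der_cons, eD_inr, one_mul, neg_one_mul, Int.negOnePow_neg]
      simp only [units_smul_eq_mul, hv, Int.cast_neg]
      linear_combination (der (tdeg deg) 1 eD (der (tdeg deg) (-1) eI (lead (Sum.inl i) f)) w +
        der (tdeg deg) (-1) eI (der (tdeg deg) 1 eD (lead (Sum.inl i) f)) w) * hK i
    · simp only [eI_inl, Option.elim, zero_add, map_add, Pi.add_apply, map_units_smul,
        Pi.smul_apply, der_cons, eD_inr, eI_inr, one_mul, neg_one_mul, Int.negOnePow_neg]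
      simp only [units_smul_eq_mul, hv, Int.cast_neg]
      linear_combination (der (tdeg deg) 1 eD (der (tdeg deg) (-1) eI (lead (Sum.inr i) f)) w +
        der (tdeg deg) (-1) eI (der (tdeg deg) 1 eD (lead (Sum.inr i) f)) w) * hK i

theorem diff_diff (deg : I → ℤ) (f : Series K (I ⊕ I)) : diff deg (diff deg f) = 0 := by
  rw [diff_eq_der]
  funext w
  induction w generalizing f with
  | nil => rfl
  | cons a w ih =>
    have ih' := ih (lead a f)
    rw [Pi.zero_apply] at ih' ⊢
    rw [der_cons, lead_der]
    rcases a with i | i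
    · simp [ih']
    · have hv : ((tdeg deg (Sum.inr i)).negOnePow : ℤ) =
        - (tdeg deg (Sum.inl i)).negOnePow := by simp [tdeg, Int.negOnePow_add]
      simp only [Option.elim, zero_add, map_add, Pi.add_apply, map_units_smul, eD_inl,
        Pi.smul_apply, der_cons, eD_inr, one_mul, ih']
      simp only [units_smul_eq_mul, hv, Int.cast_neg]
      ring

/-- The restriction of `T̂(W ⊕ Σ⁻¹W) → T̂W`, `x_i ↦ x_i`, `dx_i ↦ 0`. -/
def res : Series K (I ⊕ I) →ₗ[K] Series K I where
  toFun f w := f (w.map Sum.inl)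
  map_add' _ _ := rfl
  map_smul' _ _ := rfl

theorem res_apply (f : Series K (I ⊕ I)) (w : List I) : res f w = f (w.map Sum.inl) := rfl

/-- `incl` as a linear map. -/
def inclL : Series K I →ₗ[K] Series K (I ⊕ I) where
  toFun := incl
  map_add' f g := by
    funext w; simp only [incl, Pi.add_apply]; cases List.mapM Sum.getLeft? w <;> simp
  map_smul' c f := by
    funext w; simp only [incl, Pi.smul_apply]; cases List.mapM Sum.getLeft? w <;> simp

theorem inclL_apply (f : Series K I) : inclL f = incl f := rfl

theorem incl_nil (y : Series K I) : incl y [] = y [] := rfl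

theorem lead_inl_incl (i : I) (y : Series K I) : lead (Sum.inl i) (incl y) = incl (lead i y) := by
  funext w
  simp only [lead_apply, incl, List.mapM_cons, Sum.getLeft?_inl]
  cases List.mapM Sum.getLeft? w <;> rfl

theorem lead_inr_incl (i : I) (y : Series K I) : lead (Sum.inr i) (incl y) = 0 := by
  funext w
  simp only [lead_apply, incl, List.mapM_cons, Sum.getLeft?_inr]
  rfl

theorem res_incl (y : Series K I) : res (incl y) = y := by
  funext w
  rw [res_apply]
  induction w generalizing y with
  | nil => rfl
  | cons a w ih =>
    rw [List.map_cons, ← lead_apply (Sum.inl a) (incl y), lead_inl_incl, ih]; rfl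

theorem incl_nmul (f g : Series K I) : incl (nmul f g) = nmul (incl f) (incl g) := by
  funext w
  induction w generalizing f with
  | nil => simp [incl_nil, nmul_nil]
  | cons a w ih =>
    rw [nmul_cons, ← lead_apply a (incl (nmul f g)), ← lead_apply a (incl g)]
    rcases a with i | i
    · rw [lead_inl_incl, lead_inl_incl, lead_inl_incl, lead_nmul, ← inclL_apply, map_add, map_smul]
      simp only [inclL_apply, Pi.add_apply, ih, incl_nil, Pi.smul_apply, smul_eq_mul]
    · rw [lead_inr_incl, lead_inr_incl, lead_inr_incl, zero_nmul]
      simp only [Pi.zero_apply, mul_zero, add_zero]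

theorem res_gen (v : I ⊕ I → K) : res (gen v) = gen (fun i => v (Sum.inl i)) := by
  funext w
  rcases w with _ | ⟨a, _ | ⟨b, w⟩⟩ <;> rfl

theorem wdeg_map_inl {Δ : I ⊕ I → ℤ} {δ : I → ℤ} (h : ∀ i, Δ (Sum.inl i) = δ i) (w : List I) :
    wdeg Δ (w.map Sum.inl) = wdeg δ w := by
  simp [wdeg, Function.comp_def, h]

theorem res_bracket {Δ : I ⊕ I → ℤ} {δ : I → ℤ} (h : ∀ i, Δ (Sum.inl i) = δ i)
    (f g : Series K (I ⊕ I)) : res (bracket Δ f g) = bracket δ (res f) (res g) := by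
  funext w
  change ∑ k ∈ Finset.range ((w.map Sum.inl).length + 1),
      (tens f g - tswap Δ (tens f g)) ((w.map Sum.inl).take k, (w.map Sum.inl).drop k) =
    ∑ k ∈ Finset.range (w.length + 1),
      (tens (res f) (res g) - tswap δ (tens (res f) (res g))) (w.take k, w.drop k)
  rw [List.length_map]
  refine Finset.sum_congr rfl fun k _ => ?_
  rw [← List.map_take, ← List.map_drop]
  simp only [Pi.sub_apply, tswap, LinearMap.coe_mk, AddHom.coe_mk, wdeg_map_inl h]
  rfl

theorem res_rot {Δ : I ⊕ I → ℤ} {δ : I → ℤ} (h : ∀ i, Δ (Sum.inl i) = δ i)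
    (f : Series K (I ⊕ I)) : res (rot Δ f) = rot δ (res f) := by
  funext w
  cases w with
  | nil => rfl
  | cons a w =>
    rw [res_apply, List.map_cons, rot_cons, rot_cons, h, wdeg_map_inl h, res_apply, List.map_append]
    rfl

theorem res_rot_pow {Δ : I ⊕ I → ℤ} {δ : I → ℤ} (h : ∀ i, Δ (Sum.inl i) = δ i) (k : ℕ)
    (f : Series K (I ⊕ I)) : res ((rot Δ ^ k) f) = (rot δ ^ k) (res f) := by
  induction k with
  | zero => rfl
  | succ k ih => rw [rot_pow_succ, rot_pow_succ, res_rot h, ih]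

theorem res_norm {Δ : I ⊕ I → ℤ} {δ : I → ℤ} (h : ∀ i, Δ (Sum.inl i) = δ i)
    (f : Series K (I ⊕ I)) : res (norm Δ f) = norm δ (res f) := by
  funext w
  rw [res_apply, norm_apply, norm_apply, List.length_map]
  exact Finset.sum_congr rfl fun k _ => congrFun (res_rot_pow h k f) w

/-- The 1-form `Σ_x dx · y_x` representing `g` in `Ω/[Ω, Ω]`, as the series `Σ_x x · y_x`.  The
coefficient `y_x` is read off from the cyclic symmetrisation of `g`. -/
def headD (Δ : I ⊕ I → ℤ) : Series K (I ⊕ I) →ₗ[K] Series K I where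
  toFun g w := match w with
    | [] => 0
    | x :: w => norm Δ g (Sum.inr x :: w.map Sum.inl)
  map_add' f g := by funext w; cases w <;> simp
  map_smul' c f := by funext w; cases w <;> simp

theorem headD_nil (Δ : I ⊕ I → ℤ) (g : Series K (I ⊕ I)) : headD Δ g [] = 0 := rfl

theorem headD_cons (Δ : I ⊕ I → ℤ) (g : Series K (I ⊕ I)) (x : I) (w : List I) :
    headD Δ g (x :: w) = norm Δ g (Sum.inr x :: w.map Sum.inl) := rfl

theorem headD_scale (Δ : I ⊕ I → ℤ) (c : ℕ → K) (g : Series K (I ⊕ I)) :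
    headD Δ (scale c g) = scale c (headD Δ g) := by
  funext w
  cases w with
  | nil => simp [headD_nil]
  | cons x w => simp [headD_cons, norm_scale]

/-- The 1-form `Σ_x dx · y_x` for `s = Σ_x x · y_x`. -/
def liftD : Series K I →ₗ[K] Series K (I ⊕ I) where
  toFun s w := match w with
    | Sum.inr x :: w => incl (lead x s) w
    | _ => 0
  map_add' f g := by
    funext w
    rcases w with _ | ⟨i | i, w⟩
    · simp
    · simp
    · simp [← inclL_apply]
  map_smul' c f := by
    funext w
    rcases w with _ | ⟨i | i, w⟩
    · simp
    · simp
    · simp [← inclL_apply]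

theorem lead_inl_liftD (s : Series K I) (x : I) : lead (Sum.inl x) (liftD s) = 0 := rfl

theorem lead_inr_liftD (s : Series K I) (x : I) :
    lead (Sum.inr x) (liftD s) = incl (lead x s) := rfl

theorem dgen_nmul_incl (x : I → K) (y : Series K I) :
    nmul (dgen x) (incl y) = liftD (nmul (gen x) y) := by
  refine series_ext (gen_nmul_nil _ _) fun a => ?_
  rw [dgen, lead_gen_nmul]
  rcases a with i | i
  · rw [lead_inl_liftD]; simp
  · rw [lead_inr_liftD, lead_gen_nmul, ← inclL_apply, ← inclL_apply, map_smul]; rfl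

/-- If no word of `g` begins with a letter `x_i`, the cyclic symmetrisation does not change the
coefficients of words with a single letter `dx_i`, in first position. -/
theorem headD_of_lead {Δ : I ⊕ I → ℤ} {g : Series K (I ⊕ I)} (h : ∀ i, lead (Sum.inl i) g = 0)
    (x : I) : lead x (headD Δ g) = res (lead (Sum.inr x) g) := by
  funext w
  rw [lead_apply, headD_cons, norm_apply, List.length_cons, Finset.sum_range_succ',
    Finset.sum_eq_zero, zero_add]
  · rfl
  · intro k hk
    rw [Finset.mem_range, List.length_map] at hk
    obtain ⟨a, u, v, rfl, hv⟩ : ∃ a u v, w = u ++ a :: v ∧ u.length = k :=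
      ⟨w[k], w.take k, w.drop (k + 1), by simp, by simp [hk.le]⟩
    have e : (Sum.inr x :: (u ++ a :: v).map Sum.inl : List (I ⊕ I)) =
        (Sum.inr x :: u.map Sum.inl) ++ (Sum.inl a :: v.map Sum.inl) := by simp
    have hl : k + 1 = (Sum.inr x :: u.map Sum.inl : List (I ⊕ I)).length := by simp [hv]
    rw [e, hl, rot_pow_append, List.cons_append, ← lead_apply (Sum.inl a) g, h]
    simp

theorem headD_liftD (Δ : I ⊕ I → ℤ) {s : Series K I} (h : s [] = 0) : headD Δ (liftD s) = s := by
  refine series_ext h.symm fun x => ?_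
  rw [headD_of_lead (lead_inl_liftD s), lead_inr_liftD, res_incl]

/-- `headD` of a derivation that sends `x_i` to `dx_i`. -/
theorem headD_der {Δ : I ⊕ I → ℤ} {δ : I → ℤ} (h : ∀ i, Δ (Sum.inl i) = δ i) {s : ℤ}
    (hs : ∀ i, Δ (Sum.inr i) = Δ (Sum.inl i) + s) (g : Series K (I ⊕ I)) :
    headD Δ (der Δ s eD g) = norm δ (res g) := by
  have h0 : ∀ (w : List I) (f : Series K (I ⊕ I)), der Δ s eD f (w.map Sum.inl) = 0 := by
    intro w
    induction w with
    | nil => exact fun _ => rfl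
    | cons a w ih =>
      intro f
      rw [List.map_cons, der_cons, ih]; simp
  funext w
  cases w with
  | nil => simp [norm_nil, headD_nil]
  | cons x w =>
    rw [headD_cons, norm_der (eD_weight hs), der_cons, h0, ← res_norm h, res_apply]
    simp

/-- The map `x · y ↦ [x, y]` for `x ∈ W`, that is `1 - t⁻¹` for the cyclic rotation `t`. -/
def headBracket (δ : I → ℤ) : Series K I →ₗ[K] Series K I where
  toFun h w := h w - (rot δ ^ (w.length - 1)) h w
  map_add' f g := by funext w; simp; ring
  map_smul' c f := by funext w; simp; ring

theorem headBracket_apply (δ : I → ℤ) (h : Series K I) (w : List I) :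
    headBracket δ h w = h w - (rot δ ^ (w.length - 1)) h w := rfl

theorem headBracket_scale (δ : I → ℤ) (c : ℕ → K) (h : Series K I) :
    headBracket δ (scale c h) = scale c (headBracket δ h) := by
  funext w
  simp [headBracket_apply, rot_pow_scale, mul_sub]

theorem headBracket_of_rot {δ : I → ℤ} {h : Series K I} (hh : rot δ h = h) :
    headBracket δ h = 0 := by
  funext w
  simp [headBracket_apply, rot_pow_of_rot δ hh]

theorem rot_of_headBracket {δ : I → ℤ} {h : Series K I} (hh : headBracket δ h = 0) :
    rot δ h = h := by
  funext w
  have h1 : ∀ v, h v = (rot δ ^ (v.length - 1)) h v := fun v => sub_eq_zero.mp (congrFun hh v)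
  cases w with
  | nil => rfl
  | cons a w =>
    rw [rot_cons, h1, ← rot_cons]
    have : (w ++ [a]).length - 1 + 1 = (a :: w).length := by simp
    rw [← rot_pow_succ, this, rot_pow_length]

/-- A series `s` with `headBracket s = h`, for `h` in the kernel of the norm: in word length `n`,
`(1 - t⁻¹) ∑ k tᵏ⁺¹ = n - ∑ tᵏ⁺¹` by Abel summation (the sums over `0 ≤ k < n`). -/
noncomputable def unbracket [Algebra ℚ K] (δ : I → ℤ) : Series K I →ₗ[K] Series K I where
  toFun h w := rinv K w.length * ∑ k ∈ Finset.range w.length, (k : K) * (rot δ ^ (k + 1)) h w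
  map_add' f g := by funext w; simp [mul_add, Finset.sum_add_distrib]
  map_smul' c f := by
    funext w
    simp only [map_smul, Pi.smul_apply, smul_eq_mul, RingHom.id_apply, Finset.mul_sum]
    exact Finset.sum_congr rfl fun _ _ => by ring

theorem unbracket_apply [Algebra ℚ K] (δ : I → ℤ) (h : Series K I) (w : List I) :
    unbracket δ h w =
      rinv K w.length * ∑ k ∈ Finset.range w.length, (k : K) * (rot δ ^ (k + 1)) h w := rfl

theorem unbracket_nil [Algebra ℚ K] (δ : I → ℤ) (h : Series K I) : unbracket δ h [] = 0 := by
  simp [unbracket_apply]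

theorem headBracket_unbracket [Algebra ℚ K] (δ : I → ℤ) {h : Series K I} (h0 : h [] = 0)
    (hN : norm δ h = 0) : headBracket δ (unbracket δ h) = h := by
  funext w
  rcases eq_or_ne w [] with rfl | hw
  · simp [headBracket_apply, h0]
  have hn : w.length ≠ 0 := by simpa using hw
  set n := w.length with hn'
  have h1 : (rot δ ^ (n - 1)) (unbracket δ h) w =
      rinv K n * ∑ k ∈ Finset.range n, (k : K) * (rot δ ^ k) h w := by
    have e : (rot δ ^ (n - 1)) (unbracket δ h) w =
        (rot δ ^ (n - 1)) (rinv K n • ∑ k ∈ Finset.range n, (k : K) • (rot δ ^ (k + 1)) h) w :=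
      rot_pow_congr δ _ fun v hv => by
        simp [unbracket_apply, hv, ← hn', Finset.sum_apply]
    rw [e, map_smul, map_sum, Pi.smul_apply, Finset.sum_apply, smul_eq_mul]
    congr 1
    refine Finset.sum_congr rfl fun k _ => ?_
    rw [map_smul, Pi.smul_apply, smul_eq_mul]
    congr 1
    have e1 : (rot δ ^ (n - 1)) ((rot δ ^ (k + 1)) h) = (rot δ ^ k) ((rot δ ^ n) h) := by
      rw [← Module.End.mul_apply, ← Module.End.mul_apply, ← pow_add, ← pow_add]
      congr 2; omega
    rw [e1]
    refine rot_pow_congr δ k fun v hv => ?_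
    rw [hn', ← hv, rot_pow_length]
  have habel : ∀ (g : ℕ → K) (m : ℕ), ∑ k ∈ Finset.range m, ((k : K) * g (k + 1) - k * g k) =
      m * g m - ∑ k ∈ Finset.range m, g (k + 1) := by
    intro g m
    induction m with
    | zero => simp
    | succ m ih =>
      rw [Finset.sum_range_succ, ih, Finset.sum_range_succ]
      push_cast; ring
  have h2 := habel (fun k => (rot δ ^ k) h w) n
  rw [sum_rot_pow_succ, hN, Pi.zero_apply, sub_zero, rot_pow_length] at h2
  rw [headBracket_apply, ← hn', h1, unbracket_apply, ← hn', ← mul_sub, ← Finset.sum_sub_distrib, h2,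
    ← mul_assoc, rinv_mul hn, one_mul]

end OneForms

/-! ### The associative case -/

section Ass

variable {K : Type*} [CommRing K] {I : Type*}

/-- The weight that counts the letters `dx_i`. -/
def formWt : I ⊕ I → ℤ := Sum.elim (fun _ => 0) (fun _ => 1)

theorem wdeg_formWt (w : List (I ⊕ I)) : wdeg formWt w = formDeg w := by
  induction w with
  | nil => rfl
  | cons a w ih =>
    rw [wdeg_cons, ih, formDeg, formDeg, List.countP_cons]
    rcases a with i | i <;> simp [formWt, add_comm]

/-- All coefficients, in weight `n` only. -/
def only (K : Type*) [CommRing K] (n j : ℤ) : AddSubgroup K := if j = n then ⊤ else ⊥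

theorem mem_only {n j : ℤ} {x : K} : x ∈ only K n j ↔ (x ≠ 0 → j = n) := by
  unfold only
  split_ifs with h
  · simp [h]
  · simp [h]

theorem mem_formsT_iff {n : ℕ} {f : Series K (I ⊕ I)} :
    f ∈ formsT K I n ↔ Graded formWt (only K n) f := by
  refine forall_congr' fun w => ?_
  rw [mem_only, wdeg_formWt, Nat.cast_inj]

theorem only_shift (n r : ℤ) : (fun j => only K n (j - r)) = only K (n + r) := by
  funext j
  simp only [only, sub_eq_iff_eq_add]

theorem divClosed_only [Algebra ℚ K] (n : ℤ) : DivClosed (only K n) :=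
  divClosed_support (fun j => j = n)

theorem Graded.diff {n : ℤ} {f : Series K (I ⊕ I)} (hf : Graded formWt (only K n) f)
    (deg : I → ℤ) : Graded formWt (only K (n + 1)) (diff deg f) := by
  rw [diff_eq_der, ← only_shift]
  exact hf.der (eD_weight fun _ => rfl)

theorem Graded.iota {n : ℤ} {f : Series K (I ⊕ I)} (hf : Graded formWt (only K n) f)
    (deg : I → ℤ) : Graded formWt (only K (n - 1)) (iota deg f) := by
  rw [sub_eq_add_neg, ← only_shift]
  exact hf.der (eI_weight fun _ => rfl)

theorem Graded.diff_ideg {A : ℤ → AddSubgroup K} {f : Series K (I ⊕ I)} {deg : I → ℤ}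
    (hf : Graded (ideg deg) A f) : Graded (ideg deg) A (FormalGeom.diff deg f) := by
  rw [diff_eq_der]
  simpa using hf.der (r := 0) (eD_weight fun _ => by simp [ideg])

theorem Graded.iota_ideg {A : ℤ → AddSubgroup K} {f : Series K (I ⊕ I)} {deg : I → ℤ}
    (hf : Graded (ideg deg) A f) : Graded (ideg deg) A (FormalGeom.iota deg f) := by
  have := hf.der (Δ := tdeg deg) (s := -1) (r := 0) (eI_weight fun _ => by simp [ideg])
  simp only [sub_zero] at this
  exact this

theorem Graded.headD {A : ℤ → AddSubgroup K} {f : Series K (I ⊕ I)} {deg : I → ℤ}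
    (hf : Graded (ideg deg) A f) (Δ : I ⊕ I → ℤ) : Graded deg A (headD Δ f) := by
  intro w
  cases w with
  | nil => exact zero_mem _
  | cons x w =>
    have := hf.norm Δ (Sum.inr x :: w.map Sum.inl)
    rw [wdeg_cons, wdeg_map_inl (δ := deg) fun _ => rfl] at this
    exact this

theorem Graded.headBracket {A : ℤ → AddSubgroup K} {f : Series K I} {ω δ : I → ℤ}
    (hf : Graded ω A f) : Graded ω A (headBracket δ f) :=
  fun w => sub_mem (hf w) (hf.rot_pow δ _ w)

theorem Graded.unbracket [Algebra ℚ K] {A : ℤ → AddSubgroup K} (hA : DivClosed A)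
    {f : Series K I} {δ : I → ℤ} (hf : Graded δ A f) : Graded δ A (unbracket δ f) :=
  fun w => hA _ _ _ (sum_mem fun k _ => by
    have := hA _ (k : ℚ) _ (hf.rot_pow δ (k + 1) w)
    rwa [map_natCast] at this)

theorem Graded.incl {A : ℤ → AddSubgroup K} {f : Series K I} {deg : I → ℤ} {Δ : I ⊕ I → ℤ}
    (h : ∀ i, Δ (Sum.inl i) = deg i) (hf : Graded deg A f) : Graded Δ A (incl f) := by
  intro w
  induction w generalizing f A with
  | nil => exact hf []
  | cons a w ih =>
    rw [← lead_apply a (FormalGeom.incl f)]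
    rcases a with i | i
    · rw [lead_inl_incl, wdeg_cons, h]
      exact ih (hf.lead i)
    · rw [lead_inr_incl]; exact zero_mem _

theorem Graded.liftD {A : ℤ → AddSubgroup K} {f : Series K I} {deg : I → ℤ}
    (hf : Graded deg A f) : Graded (ideg deg) A (liftD f) := by
  intro w
  rcases w with _ | ⟨i | i, w⟩
  · exact zero_mem _
  · exact zero_mem _
  · exact (hf.lead i).incl (Δ := ideg deg) (fun _ => rfl) w

theorem graded_incl_form (f : Series K I) : Graded formWt (only K 0) (incl f) := by
  intro w
  induction w generalizing f with
  | nil => exact mem_only.mpr fun _ => rfl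
  | cons a w ih =>
    rw [← lead_apply a (incl f)]
    rcases a with i | i
    · rw [lead_inl_incl, wdeg_cons]
      simpa [formWt] using ih (lead i f)
    · rw [lead_inr_incl]; exact zero_mem _

theorem graded_liftD_form (f : Series K I) : Graded formWt (only K 1) (liftD f) := by
  intro w
  rcases w with _ | ⟨i | i, w⟩
  · exact zero_mem _
  · exact zero_mem _
  · have := graded_incl_form (lead i f) w
    rw [mem_only] at this
    rw [mem_only, wdeg_cons]
    intro h
    rw [this h]; rfl

theorem eq_map_inl_of_formDeg {w : List (I ⊕ I)} (h : formDeg w = 0) :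
    ∃ u : List I, w = u.map Sum.inl := by
  induction w with
  | nil => exact ⟨[], rfl⟩
  | cons a w ih =>
    rw [formDeg, List.countP_cons] at h
    rcases a with i | i
    · obtain ⟨u, rfl⟩ := ih (by simpa [formDeg] using h)
      exact ⟨i :: u, rfl⟩
    · simp at h

theorem eq_append_of_formDeg {w : List (I ⊕ I)} (h : formDeg w = 1) :
    ∃ (u v : List I) (x : I), w = u.map Sum.inl ++ Sum.inr x :: v.map Sum.inl := by
  induction w with
  | nil => simp [formDeg] at h
  | cons a w ih =>
    rw [formDeg, List.countP_cons] at h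
    rcases a with i | i
    · obtain ⟨u, v, x, rfl⟩ := ih (by simpa [formDeg] using h)
      exact ⟨i :: u, v, x, rfl⟩
    · obtain ⟨u, rfl⟩ := eq_map_inl_of_formDeg (w := w) (by simpa [formDeg] using h)
      exact ⟨[], u, i, rfl⟩

/-- A cyclically invariant 1-form is determined by its coefficients on the words that begin with
their letter `dx_i`. -/
theorem eq_zero_of_rot_of_head {Δ : I ⊕ I → ℤ} {f : Series K (I ⊕ I)} (hr : rot Δ f = f)
    (hf : Graded formWt (only K 1) f)
    (h : ∀ (x : I) (w : List I), f (Sum.inr x :: w.map Sum.inl) = 0) : f = 0 := by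
  funext w
  by_contra hw
  have h1 := mem_only.mp (hf w) hw
  rw [wdeg_formWt] at h1
  obtain ⟨u, v, x, rfl⟩ := eq_append_of_formDeg (w := w) (by exact_mod_cast h1)
  refine hw ?_
  rw [← rot_pow_of_rot Δ hr (u.map Sum.inl : List (I ⊕ I)).length, rot_pow_append,
    List.cons_append, ← List.map_append, h, smul_zero]
  rfl

theorem tdeg_inl (deg : I → ℤ) (i : I) : tdeg deg (Sum.inl i) = deg i := rfl

theorem headD_diff (deg : I → ℤ) (g : Series K (I ⊕ I)) :
    headD (tdeg deg) (diff deg g) = norm deg (res g) := by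
  rw [diff_eq_der]
  exact headD_der (tdeg_inl deg) (fun _ => rfl) g

theorem norm_diff (deg : I → ℤ) (f : Series K (I ⊕ I)) :
    norm (tdeg deg) (diff deg f) = diff deg (norm (tdeg deg) f) := by
  rw [diff_eq_der]
  exact norm_der (eD_tdeg deg) f

theorem norm_iota (deg : I → ℤ) (f : Series K (I ⊕ I)) :
    norm (tdeg deg) (iota deg f) = iota deg (norm (tdeg deg) f) :=
  norm_der (eI_tdeg deg) f

theorem diff_scale (deg : I → ℤ) (c : ℕ → K) (f : Series K (I ⊕ I)) :
    diff deg (scale c f) = scale c (diff deg f) := by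
  rw [diff_eq_der, der_scale]

theorem iota_scale (deg : I → ℤ) (c : ℕ → K) (f : Series K (I ⊕ I)) :
    iota deg (scale c f) = scale c (iota deg f) := der_scale _ _ _ c f

theorem headBracket_nil (δ : I → ℤ) (f : Series K I) : headBracket δ f [] = 0 := by
  simp [headBracket_apply]

section Continuity

variable [TopologicalSpace K] [DiscreteTopology K]

theorem continuous_headD (Δ : I ⊕ I → ℤ) :
    Continuous (headD Δ : Series K (I ⊕ I) →ₗ[K] Series K I) := by
  refine continuous_pi fun w => ?_
  cases w with
  | nil => exact continuous_const
  | cons x w => exact (continuous_apply (Sum.inr x :: w.map Sum.inl)).comp (continuous_norm Δ)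

theorem continuous_headBracket (δ : I → ℤ) :
    Continuous (headBracket δ : Series K I →ₗ[K] Series K I) :=
  continuous_pi fun w => (continuous_apply w).sub ((continuous_apply w).comp (continuous_rot_pow δ _))

theorem continuous_incl : Continuous (incl : Series K I → Series K (I ⊕ I)) := by
  refine continuous_pi fun w => ?_
  simp only [incl]
  cases List.mapM Sum.getLeft? w with
  | none => exact continuous_const
  | some v => exact continuous_apply v

theorem continuous_liftD : Continuous (liftD : Series K I →ₗ[K] Series K (I ⊕ I)) := by
  refine continuous_pi fun w => ?_
  rcases w with _ | ⟨i | i, w⟩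
  · exact continuous_const
  · exact continuous_const
  · exact ((continuous_apply w).comp continuous_incl).comp (continuous_lead i)

theorem bracket_gen (δ : I → ℤ) (x : I → K) (y : Series K I) :
    bracket δ (gen x) y = headBracket δ (nmul (gen x) y) := by
  classical
  have h1 : ∀ (a : I) (v : List I), bracket δ (mono [a]) (mono v) =
      headBracket δ (nmul (mono [a]) (mono v) : Series K I) := by
    intro a v
    rw [bracket_mono, mono_nmul_mono]
    funext w
    rw [headBracket_apply, Pi.sub_apply]
    by_cases hw : w.length = ([a] ++ v).length
    · rw [hw]; simp
    · have h0 : ∀ k, (rot δ ^ k) (mono ([a] ++ v) : Series K I) w = 0 := fun k => by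
        rw [rot_pow_congr δ (g := 0), map_zero]
        · rfl
        · intro x hx
          have : x ≠ [a] ++ v := fun h' => hw (by rw [← hx, h'])
          simp only [mono_apply, this, if_false, Pi.zero_apply]
      rw [h0, h0]
  have h2 : ∀ (a : I), bracket δ (mono [a]) y = headBracket δ (nmul (mono [a]) y) := fun a =>
    eq_of_mono (L := bracketL δ (mono [a])) (L' := headBracket δ ∘ₗ mulL (mono [a]))
      (continuous_bracket_right δ _) ((continuous_headBracket δ).comp (continuous_nmul_right _))
      (h1 a) y
  exact eq_of_single (L := (bracketL δ).flip y ∘ₗ gen) (L' := headBracket δ ∘ₗ mulL.flip y ∘ₗ gen)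
    ((continuous_bracket_left δ y).comp continuous_gen)
    ((continuous_headBracket δ).comp ((continuous_nmul_left y).comp continuous_gen))
    (fun a => by
      have := h2 a
      rw [← gen_single] at this
      change bracket δ (gen _) y = headBracket δ (nmul (gen _) y)
      convert this) x

/-- `headBracket f` is the sum of the `[x, ∂_x f]` over all letters `x`. -/
theorem headBracket_mem {δ : I → ℤ} {P : Submodule K (Series K I)}
    (hP : IsClosed (P : Set (Series K I))) {f : Series K I}
    (h : ∀ (x : I → K) (i : I), bracket δ (gen x) (lead i f) ∈ P) : headBracket δ f ∈ P := by
  classical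
  have e : headBracket δ f = headBracket δ (f - f [] • mono []) := by
    rw [map_sub, map_smul, headBracket_of_rot (h := (mono [] : Series K I)), smul_zero, sub_zero]
    funext w
    cases w with
    | nil => rfl
    | cons a w => simp [rot_cons, mono_apply]
  rw [e]
  refine map_mem_of_lead (headBracket δ) (continuous_headBracket δ) P hP
    (f := f - f [] • mono []) (by simp [mono_apply])
    fun i => ?_
  rw [← gen_single, ← bracket_gen, map_sub, map_smul, lead_mono_nil, smul_zero, sub_zero]
  exact h _ i

end Continuity

variable [Algebra ℚ K]

theorem eq_zero_of_scale_natCast {X : Type*} {f : Series K X}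
    (h : scale (fun n => (n : K)) f = 0) (h0 : f [] = 0) : f = 0 := by
  funext w
  cases w with
  | nil => exact h0
  | cons a w => exact eq_zero_of_natCast_mul (by simp) (congrFun h (a :: w))

theorem eq_zero_of_scale_rinv {X : Type*} {f : Series K X}
    (h : scale (rinv K) f = 0) (h0 : f [] = 0) : f = 0 := by
  funext w
  cases w with
  | nil => exact h0
  | cons a w =>
    have h1 : rinv K (w.length + 1) * f (a :: w) = 0 := congrFun h (a :: w)
    rw [← one_mul (f (a :: w)), ← mul_rinv (n := w.length + 1) (by simp), mul_assoc, h1, mul_zero]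
    rfl

/-- The map `Z` on `T̂(W ⊕ Σ⁻¹W)` that induces `ζ`: by Cartan's formula a closed 2-form `ω` of word
length `n` is `d(n⁻¹ ι ω)`, so `dx · y ↦ [x, y]` is applied to the 1-form `n⁻¹ ι ω`. -/
noncomputable def zetaMap (deg : I → ℤ) : Series K (I ⊕ I) →ₗ[K] Series K I :=
  scale (rinv K) ∘ₗ headBracket deg ∘ₗ headD (tdeg deg) ∘ₗ iota deg

/-- The map on `T̂W` that induces the inverse of `ζ`: `[x, y] ↦ d(dx · y)`. -/
noncomputable def etaMap (deg : I → ℤ) : Series K I →ₗ[K] Series K (I ⊕ I) :=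
  diff deg ∘ₗ liftD ∘ₗ unbracket deg

theorem zetaMap_apply (deg : I → ℤ) (f : Series K (I ⊕ I)) :
    zetaMap deg f = scale (rinv K) (headBracket deg (headD (tdeg deg) (iota deg f))) := rfl

theorem etaMap_apply (deg : I → ℤ) (h : Series K I) :
    etaMap deg h = diff deg (liftD (unbracket deg h)) := rfl

theorem zetaMap_diff (deg : I → ℤ) (g : Series K (I ⊕ I)) :
    zetaMap deg (diff deg g) = headBracket deg (headD (tdeg deg) g) := by
  have h1 : iota deg (diff deg g) = scale (fun n => (n : K)) g - diff deg (iota deg g) := by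
    rw [← diff_iota_add_iota_diff deg]; abel
  rw [zetaMap_apply, h1, map_sub, map_sub, headD_diff, headBracket_of_rot (rot_norm _ _), sub_zero,
    headD_scale, headBracket_scale]
  funext w
  rw [scale_apply, scale_apply, ← mul_assoc]
  rcases eq_or_ne w [] with rfl | hw
  · simp [headBracket_nil]
  · rw [rinv_mul (by simpa using hw), one_mul]

theorem zetaMap_of_norm {deg : I → ℤ} {f : Series K (I ⊕ I)} (h : norm (tdeg deg) f = 0) :
    zetaMap deg f = 0 := by
  have h1 : headD (tdeg deg) (iota deg f) = 0 := by
    funext w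
    cases w with
    | nil => rfl
    | cons x w => rw [headD_cons, norm_iota, h, map_zero]; rfl
  rw [zetaMap_apply, h1, map_zero, map_zero]

theorem zetaMap_congr {deg : I → ℤ} {f g : Series K (I ⊕ I)}
    (h : norm (tdeg deg) f = norm (tdeg deg) g) : zetaMap deg f = zetaMap deg g := by
  rw [← sub_eq_zero, ← map_sub]
  exact zetaMap_of_norm (by rw [map_sub, h, sub_self])

theorem zetaMap_etaMap {deg : I → ℤ} {h : Series K I} (h0 : h [] = 0) (hN : norm deg h = 0) :
    zetaMap deg (etaMap deg h) = h := by
  rw [etaMap_apply, zetaMap_diff, headD_liftD _ (unbracket_nil _ _), headBracket_unbracket deg h0 hN]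

/-- A 2-form that is closed modulo commutators and is killed by `zetaMap` is a sum of commutators:
its contraction is a 1-form whose head is cyclically invariant, hence exact. -/
theorem norm_eq_zero_of_zetaMap {deg : I → ℤ} {f : Series K (I ⊕ I)}
    (hf : Graded formWt (only K 2) f) (hd : norm (tdeg deg) (diff deg f) = 0)
    (hZ : zetaMap deg f = 0) : norm (tdeg deg) f = 0 := by
  set h := headD (tdeg deg) (iota deg f) with hh
  have hrot : rot deg h = h :=
    rot_of_headBracket (eq_zero_of_scale_rinv hZ (headBracket_nil _ _))
  set q := scale (rinv K) h with hq
  have hNq : norm deg q = h := by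
    rw [hq, norm_scale, norm_of_rot deg hrot]
    funext w
    rw [scale_apply, scale_apply, ← mul_assoc]
    rcases eq_or_ne w [] with rfl | hw
    · simp [hh, headD_nil]
    · rw [rinv_mul (by simpa using hw), one_mul]
  have h1 : norm (tdeg deg) (iota deg f - diff deg (incl q)) = 0 := by
    refine eq_zero_of_rot_of_head (rot_norm _ _) (Graded.norm ?_ _) fun x w => ?_
    · exact Graded.sub (by simpa using hf.iota deg) (by simpa using (graded_incl_form q).diff deg)
    · rw [← headD_cons, map_sub, headD_diff, res_incl, hNq, sub_self]; rfl
  have h2 : norm (tdeg deg) (diff deg (iota deg f)) = 0 := by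
    have := norm_diff deg (iota deg f - diff deg (incl q))
    rwa [h1, map_zero, map_sub, diff_diff, sub_zero] at this
  refine eq_zero_of_scale_natCast ?_ (norm_nil _ _)
  rw [← norm_scale, ← diff_iota_add_iota_diff deg, map_add, h2, norm_iota, hd, map_zero, add_zero]

theorem Graded.zetaMap {A : ℤ → AddSubgroup K} (hA : DivClosed A) {f : Series K (I ⊕ I)}
    {deg : I → ℤ} (hf : Graded (ideg deg) A f) : Graded deg A (zetaMap deg f) :=
  (hf.iota_ideg.headD (tdeg deg)).headBracket.scale hA fun n => 1 / (n : ℚ)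

theorem Graded.etaMap {A : ℤ → AddSubgroup K} (hA : DivClosed A) {f : Series K I}
    {deg : I → ℤ} (hf : Graded deg A f) : Graded (ideg deg) A (etaMap deg f) :=
  (hf.unbracket hA).liftD.diff_ideg

theorem graded_etaMap_form (deg : I → ℤ) (h : Series K I) :
    Graded formWt (only K 2) (etaMap deg h) :=
  (graded_liftD_form _).diff deg

variable [TopologicalSpace K] [DiscreteTopology K]

theorem continuous_unbracket (δ : I → ℤ) :
    Continuous (unbracket δ : Series K I →ₗ[K] Series K I) :=
  continuous_pi fun w => continuous_const_mul' _ (continuous_finsetSum _ fun _ _ =>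
    continuous_const_mul' _ ((continuous_apply w).comp (continuous_rot_pow δ _)))

theorem continuous_zetaMap (deg : I → ℤ) :
    Continuous (zetaMap deg : Series K (I ⊕ I) →ₗ[K] Series K I) :=
  (continuous_scale _).comp ((continuous_headBracket deg).comp
    ((continuous_headD _).comp continuous_der))

theorem continuous_etaMap (deg : I → ℤ) :
    Continuous (etaMap deg : Series K I →ₗ[K] Series K (I ⊕ I)) :=
  (continuous_diff deg).comp (continuous_liftD.comp (continuous_unbracket deg))

/-- The formula `ζ(d(dx · y)) = [x, y]`. -/
theorem zetaMap_diff_dgen (deg : I → ℤ) (x : I → K) (y : Series K I) :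
    zetaMap deg (diff deg (nmul (dgen x) (incl y))) = bracket deg (gen x) y := by
  rw [zetaMap_diff, dgen_nmul_incl, headD_liftD _ (gen_nmul_nil _ _), bracket_gen]

/-- Modulo commutators `etaMap` sends `[x, y]` to `d(dx · y)`: both are exact 2-forms with the same
image under `zetaMap`. -/
theorem etaMap_bracket_norm (deg : I → ℤ) (x : I → K) (y : Series K I) :
    norm (tdeg deg) (etaMap deg (bracket deg (gen x) y)) =
      norm (tdeg deg) (diff deg (nmul (dgen x) (incl y))) := by
  rw [← sub_eq_zero, ← map_sub]
  refine norm_eq_zero_of_zetaMap (deg := deg) ?_ ?_ ?_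
  · refine (graded_etaMap_form _ _).sub ?_
    rw [dgen_nmul_incl]
    exact (graded_liftD_form _).diff deg
  · rw [map_sub, etaMap_apply, diff_diff, diff_diff, sub_zero, map_zero]
  · rw [map_sub, zetaMap_diff_dgen, zetaMap_etaMap (bracket_nil _ _ _) (norm_bracket _ _ _), sub_self]

theorem mem_closedAss_iff {deg : I → ℤ} {f : Series K (I ⊕ I)} :
    (Submodule.Quotient.mk f : DRAss K deg) ∈ closedAss K deg ↔
      (∃ g, Graded formWt (only K 2) g ∧
        f - g ∈ commutators (K := K) (tdeg deg) Set.univ Set.univ) ∧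
      diff deg f ∈ commutators (K := K) (tdeg deg) Set.univ Set.univ := by
  unfold closedAss
  rw [Submodule.mem_inf]
  refine and_congr ⟨?_, ?_⟩ ?_
  · rintro ⟨g, hg, h⟩
    exact ⟨g, mem_formsT_iff.mp hg, (Submodule.Quotient.eq _).mp h.symm⟩
  · rintro ⟨g, hg, h⟩
    exact ⟨g, mem_formsT_iff.mpr hg, ((Submodule.Quotient.eq _).mpr h).symm⟩
  · rw [LinearMap.mem_ker]
    exact Submodule.Quotient.mk_eq_zero _

theorem exists_zeta_ass (𝒦 : ℤ → AddSubgroup K) [GradedRing 𝒦] (deg : I → ℤ) :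
    ∃ ζ : closedAss K deg ≃L[K] commutators (K := K) deg Set.univ Set.univ,
      (∀ (m : ℤ) (ω : closedAss K deg),
        HomogAss 𝒦 deg m ω ↔ IsHomog 𝒦 (wdeg deg) m (ζ ω : Series K I)) ∧
      ∀ (x : I → K) (y : Series K I) (ω : closedAss K deg),
        (ω : DRAss K deg) = dAss K deg (Submodule.Quotient.mk (nmul (dgen x) (incl y))) →
        (ζ ω : Series K I) = bracket deg (gen x) y := by
  obtain ⟨ζ, hζ, hη⟩ := exists_equiv_of_maps (C := closedAss K deg)
    (T := commutators (K := K) deg Set.univ Set.univ)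
    (zetaMap deg) (continuous_zetaMap deg) (etaMap deg) (continuous_etaMap deg)
    (fun f hf => zetaMap_of_norm ((mem_commutators_iff _).mp hf).2)
    (fun f _ => by
      rw [zetaMap_apply, ← headBracket_scale]
      exact headBracket_mem (isClosed_closedSpan _) fun x i =>
        subset_closedSpan ⟨_, trivial, _, trivial, rfl⟩)
    (fun h _ => mem_closedAss_iff.mpr ⟨⟨_, graded_etaMap_form deg h, by simp⟩, by
      rw [etaMap_apply, diff_diff]; exact zero_mem _⟩)
    (fun h hh => by
      rw [mem_commutators_iff] at hh
      exact zetaMap_etaMap hh.1 hh.2)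
    (fun f hf hZ => by
      obtain ⟨⟨g, hg, hfg⟩, hd⟩ := mem_closedAss_iff.mp hf
      have h1 := (mem_commutators_iff _).mp hfg
      have h2 := (mem_commutators_iff _).mp (diff_mem_commutators deg hfg)
      rw [mem_commutators_iff] at hd
      rw [map_sub, map_sub, hd.2, zero_sub, neg_eq_zero] at h2
      have h3 := norm_eq_zero_of_zetaMap hg h2.2 (by
        rw [← hZ]; exact zetaMap_congr
          (sub_eq_zero.mp ((map_sub _ _ _).symm.trans h1.2)).symm)
      have h4 : g ∈ commutators (K := K) (tdeg deg) Set.univ Set.univ := by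
        refine (mem_commutators_iff _).mpr ⟨?_, h3⟩
        by_contra h0
        have := mem_only.mp (hg []) h0
        simp [wdeg_nil] at this
      simpa using add_mem hfg h4)
  refine ⟨ζ, fun m ω => ⟨?_, fun h => ?_⟩, ?_⟩
  · rintro ⟨f, hf, hω⟩
    rw [hζ ω f hω]
    exact Graded.zetaMap (divClosed_grading 𝒦 m) hf
  · exact ⟨_, Graded.etaMap (divClosed_grading 𝒦 m) h, hη ω⟩
  · intro x y ω hω
    rw [hζ ω _ hω, zetaMap_diff_dgen]

end Ass

/-! ### Symmetrisation -/

section Sym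

variable {K : Type*} [CommRing K] {X : Type*} (δ : X → ℤ)

/-- A product over unordered pairs can be reindexed by a permutation. -/
theorem prod_lt_reindex {n : ℕ} (τ : Equiv.Perm (Fin n)) (g : Fin n × Fin n → ℤˣ)
    (hg : ∀ i j, g (i, j) = g (j, i)) :
    ∏ p : Fin n × Fin n with p.1 < p.2, g (τ p.1, τ p.2) =
      ∏ p : Fin n × Fin n with p.1 < p.2, g p := by
  have hne : ∀ (τ : Equiv.Perm (Fin n)) {i j : Fin n}, i < j → ¬ τ i < τ j → τ j < τ i :=
    fun τ i j h h' => lt_of_le_of_ne (not_lt.mp h') fun h0 => h.ne (τ.injective h0).symm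
  refine Finset.prod_nbij' (fun p => if τ p.1 < τ p.2 then (τ p.1, τ p.2) else (τ p.2, τ p.1))
    (fun p => if τ.symm p.1 < τ.symm p.2 then (τ.symm p.1, τ.symm p.2)
      else (τ.symm p.2, τ.symm p.1)) ?_ ?_ ?_ ?_ ?_
  · rintro ⟨i, j⟩ h
    simp only [Finset.mem_filter, Finset.mem_univ, true_and] at h ⊢
    split_ifs with h'
    · exact h'
    · exact hne τ h h'
  · rintro ⟨i, j⟩ h
    simp only [Finset.mem_filter, Finset.mem_univ, true_and] at h ⊢
    split_ifs with h'
    · exact h'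
    · exact hne τ.symm h h'
  · rintro ⟨i, j⟩ h
    simp only [Finset.mem_filter, Finset.mem_univ, true_and] at h ⊢
    by_cases h' : τ i < τ j <;> simp [h', h, h.not_gt]
  · rintro ⟨i, j⟩ h
    simp only [Finset.mem_filter, Finset.mem_univ, true_and] at h ⊢
    by_cases h' : τ.symm i < τ.symm j <;> simp [h', h, h.not_gt]
  · rintro ⟨i, j⟩ h
    dsimp only
    split_ifs with h'
    · rfl
    · exact hg _ _

/-- The Koszul sign of the action on tensors is a cocycle. -/
theorem koszulSign_mul {n : ℕ} (σ τ : Equiv.Perm (Fin n)) (a : Fin n → ℤ) :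
    koszulSign (σ * τ) (fun k => a ((σ * τ) k)) =
      koszulSign σ (fun k => a (σ k)) * koszulSign τ (fun k => a (σ (τ k))) := by
  -- `g` is the factor that the unordered pair `{i, j}` contributes to the sign of `σ`.
  let g : Fin n × Fin n → ℤˣ := fun p =>
    if (p.1 < p.2 ∧ σ p.2 < σ p.1) ∨ (p.2 < p.1 ∧ σ p.1 < σ p.2) then
      (a (σ p.1) * a (σ p.2)).negOnePow else 1
  have hg : ∀ i j, g (i, j) = g (j, i) := by
    intro i j
    simp only [g, or_comm, mul_comm]
  have h1 : koszulSign σ (fun k => a (σ k)) =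
      ∏ p : Fin n × Fin n with p.1 < p.2, g (τ p.1, τ p.2) := by
    rw [prod_lt_reindex τ g hg, koszulSign, ← Finset.filter_filter, Finset.prod_filter]
    refine Finset.prod_congr rfl fun p hp => ?_
    have hp' : p.1 < p.2 := (Finset.mem_filter.mp hp).2
    simp [g, hp', hp'.not_gt]
  rw [h1, koszulSign, koszulSign, ← Finset.filter_filter, ← Finset.filter_filter,
    Finset.prod_filter, Finset.prod_filter (p := fun p : Fin n × Fin n => τ p.2 < τ p.1),
    ← Finset.prod_mul_distrib]
  refine Finset.prod_congr rfl fun p hp => ?_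
  have hp' : p.1 < p.2 := (Finset.mem_filter.mp hp).2
  simp only [g, Equiv.Perm.mul_apply]
  rcases lt_trichotomy (τ p.1) (τ p.2) with h | h | h
  · simp only [h, h.not_gt, true_and, false_and, or_false, if_false, mul_one]
    congr
  · exact absurd (τ.injective h) hp'.ne
  · rcases lt_trichotomy (σ (τ p.1)) (σ (τ p.2)) with h' | h' | h'
    · simp [h, h', h.not_gt, h'.not_gt, Int.units_mul_self]
    · exact absurd (τ.injective (σ.injective h')) hp'.ne
    · simp [h, h', h.not_gt, h'.not_gt]

theorem koszulSign_swap {n : ℕ} (i : ℕ) (hi : i + 1 < n) (a : Fin n → ℤ) :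
    koszulSign (Equiv.swap ⟨i, by omega⟩ ⟨i + 1, hi⟩) a =
      (a ⟨i, by omega⟩ * a ⟨i + 1, hi⟩).negOnePow := by
  rw [koszulSign, Finset.prod_eq_single_of_mem (⟨i, by omega⟩, ⟨i + 1, hi⟩)]
  · simp
  · rintro ⟨p, q⟩ hpq hne
    exfalso
    obtain ⟨-, h1, h2⟩ := Finset.mem_filter.mp hpq
    simp only [Equiv.swap_apply_def] at h2
    refine hne ?_
    rw [Prod.mk.injEq]
    split_ifs at h2 <;> simp only [Fin.ext_iff, Fin.lt_def] at * <;> omega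

theorem koszulSign_one {n : ℕ} (a : Fin n → ℤ) : koszulSign 1 a = 1 := by
  rw [koszulSign, Finset.prod_eq_one]
  rintro ⟨p, q⟩ h
  have h' := (Finset.mem_filter.mp h).2
  exact absurd h'.1 (lt_asymm h'.2)

/-- The value at the word `a` of `σ · f`. -/
def permVal {n : ℕ} (σ : Equiv.Perm (Fin n)) (f : Series K X) (a : Fin n → X) : K :=
  koszulSign σ (fun k => δ (a (σ k))) • f (List.ofFn fun k => a (σ k))

theorem permCoeff_ofFn {n : ℕ} (f : Series K X) (l : List X) (a : Fin n → X)
    (h : l = List.ofFn a) :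
    ∃ e : Equiv.Perm (Fin l.length) ≃ Equiv.Perm (Fin n),
      ∀ σ, permCoeff δ f l σ = permVal δ (e σ) f a := by
  have hn : l.length = n := by rw [h, List.length_ofFn]
  subst hn
  have ha : l.get = a := by
    refine List.ofFn_injective ?_
    rw [List.ofFn_get, ← h]
  subst ha
  exact ⟨Equiv.refl _, fun σ => rfl⟩

theorem symmetrise_ofFn {n : ℕ} (f : Series K X) (a : Fin n → X) :
    symmetrise δ f (List.ofFn a) = ∑ σ : Equiv.Perm (Fin n), permVal δ σ f a := by
  obtain ⟨e, he⟩ := permCoeff_ofFn δ f _ a rfl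
  exact Fintype.sum_equiv e _ _ he

/-- The action of the transposition of the letters in positions `i` and `i + 1`, with Koszul sign;
the identity on shorter words. -/
def swp : ℕ → Module.End K (Series K X)
  | 0 =>
    { toFun := fun f w => match w with
        | a :: b :: w => (δ a * δ b).negOnePow • f (b :: a :: w)
        | w => f w
      map_add' := fun f g => by
        funext w
        rcases w with _ | ⟨a, _ | ⟨b, w⟩⟩ <;> simp
      map_smul' := fun c f => by
        funext w
        rcases w with _ | ⟨a, _ | ⟨b, w⟩⟩ <;> simp [mul_smul_comm] }
  | i + 1 =>
    { toFun := fun f w => match w with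
        | a :: w => swp i (lead a f) w
        | [] => f []
      map_add' := fun f g => by
        funext w
        rcases w with _ | ⟨a, w⟩ <;> simp
      map_smul' := fun c f => by
        funext w
        rcases w with _ | ⟨a, w⟩ <;> simp }

theorem swp_zero_cons (f : Series K X) (a b : X) (w : List X) :
    swp δ 0 f (a :: b :: w) = (δ a * δ b).negOnePow • f (b :: a :: w) := rfl

theorem swp_succ_cons (i : ℕ) (f : Series K X) (a : X) (w : List X) :
    swp δ (i + 1) f (a :: w) = swp δ i (lead a f) w := rfl

theorem lead_swp_succ (i : ℕ) (f : Series K X) (a : X) :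
    lead a (swp δ (i + 1) f) = swp δ i (lead a f) := rfl

theorem swp_append (f : Series K X) (u : List X) (x y : X) (v : List X) :
    swp δ u.length f (u ++ x :: y :: v) = (δ x * δ y).negOnePow • f (u ++ y :: x :: v) := by
  induction u generalizing f with
  | nil => rfl
  | cons a u ih => exact ih (lead a f)

theorem swp_of_length_le (i : ℕ) (f : Series K X) {w : List X} (h : w.length ≤ i + 1) :
    swp δ i f w = f w := by
  induction i generalizing f w with
  | zero =>
    rcases w with _ | ⟨a, _ | ⟨b, w⟩⟩
    · rfl
    · rfl
    · simp at h
  | succ i ih =>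
    cases w with
    | nil => rfl
    | cons a w => exact ih (lead a f) (by simpa using h)

theorem swp_congr_length (i : ℕ) {f g : Series K X} {w : List X}
    (h : ∀ v : List X, v.length = w.length → f v = g v) : swp δ i f w = swp δ i g w := by
  induction i generalizing f g w with
  | zero =>
    rcases w with _ | ⟨a, _ | ⟨b, w⟩⟩
    · exact h _ rfl
    · exact h _ rfl
    · rw [swp_zero_cons, swp_zero_cons, h _ (by simp)]
  | succ i ih =>
    cases w with
    | nil => exact h _ rfl
    | cons a w => exact ih fun v hv => h (a :: v) (by simp [hv])

theorem swp_mono (u : List X) (x y : X) (v : List X) :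
    swp δ u.length (mono (u ++ x :: y :: v) : Series K X) =
      (δ x * δ y).negOnePow • mono (u ++ y :: x :: v) := by
  classical
  funext w
  by_cases hw : w.length ≤ u.length + 1
  · rw [swp_of_length_le _ _ _ hw]
    have h1 : w ≠ u ++ x :: y :: v := fun h => by rw [h] at hw; simp at hw
    have h2 : w ≠ u ++ y :: x :: v := fun h => by rw [h] at hw; simp at hw
    simp [mono_apply, h1, h2]
  · obtain ⟨u', a, b, v', rfl, hu⟩ : ∃ u' a b v', w = u' ++ a :: b :: v' ∧
        u'.length = u.length := by
      have h1 : u.length < w.length := by omega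
      have h2 : u.length + 1 < w.length := by omega
      refine ⟨w.take u.length, w[u.length], w[u.length + 1], w.drop (u.length + 2), ?_,
        by simp; omega⟩
      rw [← List.drop_eq_getElem_cons h2, ← List.drop_eq_getElem_cons h1, List.take_append_drop]
    rw [← hu, swp_append, Pi.smul_apply, mono_apply, mono_apply]
    have hiff : u' ++ b :: a :: v' = u ++ x :: y :: v ↔ u' ++ a :: b :: v' = u ++ y :: x :: v := by
      constructor
      · intro h
        obtain ⟨rfl, h'⟩ := List.append_inj h hu
        simp only [List.cons.injEq] at h'
        obtain ⟨rfl, rfl, rfl⟩ := h'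
        rfl
      · intro h
        obtain ⟨rfl, h'⟩ := List.append_inj h hu
        simp only [List.cons.injEq] at h'
        obtain ⟨rfl, rfl, rfl⟩ := h'
        rfl
    by_cases h : u' ++ a :: b :: v' = u ++ y :: x :: v
    · obtain ⟨rfl, h'⟩ := List.append_inj h hu
      simp only [List.cons.injEq] at h'
      obtain ⟨rfl, rfl, rfl⟩ := h'
      simp [mul_comm]
    · rw [if_neg h, if_neg (hiff.not.mpr h), smul_zero, smul_zero]

theorem swp_ofFn {n : ℕ} (i : ℕ) (hi : i + 1 < n) (f : Series K X) (a : Fin n → X) :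
    swp δ i f (List.ofFn a) = permVal δ (Equiv.swap ⟨i, by omega⟩ ⟨i + 1, hi⟩) f a := by
  have h1 : List.ofFn a = (List.ofFn a).take i ++
      a ⟨i, by omega⟩ :: a ⟨i + 1, hi⟩ :: (List.ofFn a).drop (i + 2) := by
    have e1 : a ⟨i, by omega⟩ = (List.ofFn a)[i]'(by simp; omega) := by simp
    have e2 : a ⟨i + 1, hi⟩ = (List.ofFn a)[i + 1]'(by simp; omega) := by simp
    rw [e1, e2, ← List.drop_eq_getElem_cons, ← List.drop_eq_getElem_cons, List.take_append_drop]
  have h2 : (List.ofFn fun k => a (Equiv.swap ⟨i, by omega⟩ ⟨i + 1, hi⟩ k)) =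
      (List.ofFn a).take i ++
      a ⟨i + 1, hi⟩ :: a ⟨i, by omega⟩ :: (List.ofFn a).drop (i + 2) := by
    refine List.ext_getElem (by simp; omega) fun j hj hj' => ?_
    rw [List.getElem_ofFn, List.getElem_append]
    simp only [List.getElem_cons, List.length_take, List.length_ofFn, List.getElem_take,
      List.getElem_drop, List.getElem_ofFn, Equiv.swap_apply_def, Fin.mk.injEq]
    have hm : min i n = i := by omega
    simp only [hm]
    split_ifs with h1 h2 h3 h4 h5 <;> first | rfl | omega | skip
    all_goals (congr 1; ext; simp; omega)
  have hl : ((List.ofFn a).take i).length = i := by simp; omega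
  conv_lhs => rw [h1]
  have h3 := swp_append δ f ((List.ofFn a).take i) (a ⟨i, by omega⟩) (a ⟨i + 1, hi⟩)
    ((List.ofFn a).drop (i + 2))
  rw [hl] at h3
  rw [h3, permVal, koszulSign_swap, h2]
  simp [mul_comm]

theorem permVal_mul {n : ℕ} (σ τ : Equiv.Perm (Fin n)) (f : Series K X) (a : Fin n → X) :
    permVal δ (σ * τ) f a =
      koszulSign σ (fun k => δ (a (σ k))) • permVal δ τ f (fun k => a (σ k)) := by
  rw [permVal, permVal, koszulSign_mul σ τ (fun k => δ (a k)), mul_smul]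
  rfl

/-- Every permutation acts as a product of adjacent transpositions. -/
theorem exists_swp_prod {n : ℕ} (σ : Equiv.Perm (Fin n)) :
    ∃ L : List ℕ, ∀ (f : Series K X) (a : Fin n → X),
      permVal δ σ f a = (L.map (swp δ)).prod f (List.ofFn a) := by
  cases n with
  | zero =>
    refine ⟨[], fun f a => ?_⟩
    rw [Subsingleton.elim σ 1, permVal, koszulSign_one]
    simp
  | succ n =>
    have hσ : σ ∈ Submonoid.closure
        (Set.range fun i : Fin n => Equiv.swap i.castSucc i.succ) := by
      rw [Equiv.Perm.mclosure_swap_castSucc_succ]; trivial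
    induction hσ using Submonoid.closure_induction with
    | mem x hx =>
      obtain ⟨i, rfl⟩ := hx
      refine ⟨[i], fun f a => ?_⟩
      rw [List.map_singleton, List.prod_singleton, swp_ofFn δ i (by omega)]
      rfl
    | one =>
      refine ⟨[], fun f a => ?_⟩
      rw [permVal, koszulSign_one]
      simp
    | mul σ τ _ _ h1 h2 =>
      obtain ⟨L1, h1⟩ := h1
      obtain ⟨L2, h2⟩ := h2
      refine ⟨L1 ++ L2, fun f a => ?_⟩
      rw [permVal_mul, h2, List.map_append, List.prod_append, Module.End.mul_apply, ← h1]
      rfl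

end Sym

section Sym

variable {K : Type*} [CommRing K] {X : Type*} (δ : X → ℤ)

/-- The symmetrisation as a linear map. -/
def symL : Series K X →ₗ[K] Series K X where
  toFun := symmetrise δ
  map_add' f g := by
    funext w
    simp [symmetrise, permCoeff, Finset.sum_add_distrib]
  map_smul' c f := by
    funext w
    simp [symmetrise, permCoeff, Finset.mul_sum, mul_smul_comm]

theorem symL_apply (f : Series K X) : symL δ f = symmetrise δ f := rfl

theorem symL_ofFn {n : ℕ} (f : Series K X) (a : Fin n → X) :
    symL δ f (List.ofFn a) = ∑ σ : Equiv.Perm (Fin n), permVal δ σ f a := symmetrise_ofFn δ f a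

theorem exists_ofFn (w : List X) : ∃ a : Fin w.length → X, w = List.ofFn a :=
  ⟨w.get, (List.ofFn_get w).symm⟩

/-- In each word length the symmetrisation is a sum of products of adjacent transpositions. -/
theorem exists_symL_eq_sum (n : ℕ) : ∃ L : Equiv.Perm (Fin n) → List ℕ,
    ∀ (f : Series K X) (w : List X), w.length = n →
      symL δ f w = ∑ σ, ((L σ).map (swp δ)).prod f w := by
  choose L hL using fun σ : Equiv.Perm (Fin n) => exists_swp_prod (K := K) δ σ
  refine ⟨L, fun f w hw => ?_⟩
  subst hw
  obtain ⟨a, ha⟩ := exists_ofFn w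
  conv_lhs => rw [ha]
  rw [symL_ofFn]
  refine Finset.sum_congr rfl fun σ _ => ?_
  rw [hL, ← ha]

theorem swp_symL (i : ℕ) (f : Series K X) : swp δ i (symL δ f) = symL δ f := by
  funext w
  by_cases h : w.length ≤ i + 1
  · exact swp_of_length_le δ i _ h
  obtain ⟨a, ha⟩ := exists_ofFn w
  rw [ha, swp_ofFn δ i (by omega), permVal, symL_ofFn, symL_ofFn, Finset.smul_sum]
  refine Fintype.sum_equiv (Equiv.mulLeft (Equiv.swap ⟨i, by omega⟩ ⟨i + 1, by omega⟩)) _ _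
    fun σ => ?_
  rw [Equiv.coe_mulLeft, permVal_mul]

theorem symL_swp (i : ℕ) (f : Series K X) : symL δ (swp δ i f) = symL δ f := by
  funext w
  obtain ⟨a, ha⟩ := exists_ofFn w
  rw [ha, symL_ofFn, symL_ofFn]
  by_cases h : w.length ≤ i + 1
  · refine Finset.sum_congr rfl fun σ _ => ?_
    rw [permVal, permVal, swp_of_length_le]
    simpa using h
  · refine Fintype.sum_equiv (Equiv.mulRight (Equiv.swap ⟨i, by omega⟩ ⟨i + 1, by omega⟩)) _ _
      fun σ => ?_
    rw [Equiv.coe_mulRight, permVal_mul, permVal, swp_ofFn δ i (by omega)]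

theorem swp_prod_of_swp {f : Series K X} (h : ∀ i, swp δ i f = f) (L : List ℕ) :
    (L.map (swp δ)).prod f = f := by
  induction L with
  | nil => rfl
  | cons i L ih => rw [List.map_cons, List.prod_cons, Module.End.mul_apply, ih, h]

theorem mem_symInvariants_of_swp {f : Series K X} (h : ∀ i, swp δ i f = f) :
    f ∈ symInvariants K δ := by
  intro l σ
  obtain ⟨e, he⟩ := permCoeff_ofFn δ f l l.get (List.ofFn_get l).symm
  obtain ⟨L, hL⟩ := exists_swp_prod (K := K) δ (e σ)
  rw [he, hL, swp_prod_of_swp δ h, List.ofFn_get]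

theorem symL_of_mem {f : Series K X} (h : f ∈ symInvariants K δ) :
    symL δ f = scale (fun n => (n.factorial : K)) f := by
  funext w
  rw [symL_apply, symmetrise, Finset.sum_congr rfl fun σ _ => h w σ]
  simp [Fintype.card_perm]

theorem symL_symL (f : Series K X) :
    symL δ (symL δ f) = scale (fun n => (n.factorial : K)) (symL δ f) :=
  symL_of_mem δ (mem_symInvariants_of_swp δ fun i => swp_symL δ i f)

/-- The cyclic rotation is a product of adjacent transpositions. -/
theorem rot_of_swp {f : Series K X} (h : ∀ i, swp δ i f = f) : rot δ f = f := by
  have key : ∀ (w : List X) (f : Series K X), (∀ i, swp δ i f = f) → ∀ a,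
      (δ a * wdeg δ w).negOnePow • f (w ++ [a]) = f (a :: w) := by
    intro w
    induction w with
    | nil => intro f _ a; simp [wdeg_nil]
    | cons b w ih =>
      intro f h a
      have h1 : f (a :: b :: w) = (δ a * δ b).negOnePow • f (b :: a :: w) := by
        conv_lhs => rw [← h 0]
        rfl
      have h2 := ih (lead b f) (fun i => by rw [← lead_swp_succ, h]) a
      rw [lead_apply, lead_apply] at h2
      rw [h1, ← h2, wdeg_cons, mul_add, Int.negOnePow_add, mul_smul]
      rfl
  funext w
  cases w with
  | nil => rfl
  | cons a w => exact key w f h a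

theorem norm_symL (f : Series K X) :
    norm δ (symL δ f) = scale (fun n => (n : K)) (symL δ f) :=
  norm_of_rot δ (rot_of_swp δ fun i => swp_symL δ i f)

theorem swp_scale (i : ℕ) (c : ℕ → K) (f : Series K X) :
    swp δ i (scale c f) = scale c (swp δ i f) := by
  funext w
  have : swp δ i (scale c f) w = swp δ i (c w.length • f) w :=
    swp_congr_length δ i fun v hv => by simp [hv]
  rw [this, map_smul]; rfl

theorem symL_scale (c : ℕ → K) (f : Series K X) :
    symL δ (scale c f) = scale c (symL δ f) := by
  funext w
  simp [symL_apply, symmetrise, permCoeff, Finset.mul_sum, mul_smul_comm]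

section Der

variable {δ} {s : ℤ} {e : X → Option X}

theorem der_swp (he : ∀ a b, e a = some b → δ a = δ b + s) (i : ℕ) (f : Series K X) :
    der δ s e (swp δ i f) = swp δ i (der δ s e f) := by
  funext w
  by_cases hw : w.length ≤ i + 1
  · rw [swp_of_length_le δ i _ hw]
    exact der_congr_length δ s e fun v hv => swp_of_length_le δ i f (by omega)
  induction i generalizing f w with
  | zero =>
    rcases w with _ | ⟨a, _ | ⟨b, w⟩⟩
    · simp at hw
    · simp at hw
    · have hl : lead b (lead a (swp δ 0 f)) = (δ a * δ b).negOnePow • lead a (lead b f) := rfl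
      rw [der_cons, der_cons, hl, map_units_smul, swp_zero_cons, der_cons, der_cons, smul_add,
        smul_add, smul_add, smul_add, Pi.smul_apply]
      have e1 : (e a).elim 0 (fun a' => swp δ 0 f (a' :: b :: w)) = (δ a * δ b).negOnePow •
          (s * δ b).negOnePow • (e a).elim 0 (fun a' => lead b f (a' :: w)) := by
        cases ha : e a with
        | none => simp
        | some a' =>
          simp only [Option.elim, swp_zero_cons, smul_smul, ← Int.negOnePow_add, lead_apply]
          refine negOnePow_smul_congr ?_ _
          rw [he a a' ha]
          exact ⟨-(s * δ b), by ring⟩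
      have e2 : (s * δ a).negOnePow • (e b).elim 0 (fun b' => lead a (swp δ 0 f) (b' :: w)) =
          (δ a * δ b).negOnePow • (e b).elim 0 (fun b' => f (b' :: a :: w)) := by
        cases hb : e b with
        | none => simp
        | some b' =>
          simp only [Option.elim, lead_apply, swp_zero_cons, smul_smul, ← Int.negOnePow_add]
          refine negOnePow_smul_congr ?_ _
          rw [he b b' hb]
          exact ⟨0, by ring⟩
      rw [e1, e2, smul_comm (s * δ b).negOnePow (δ a * δ b).negOnePow,
        smul_comm (s * δ a).negOnePow (δ a * δ b).negOnePow,
        smul_comm (s * δ a).negOnePow (s * δ b).negOnePow]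
      abel
  | succ i ih =>
    cases w with
    | nil => simp at hw
    | cons a w =>
      rw [der_cons, lead_swp_succ, swp_succ_cons, lead_der, map_add, map_units_smul, Pi.add_apply,
        Pi.smul_apply, ih _ _ (by simpa using hw)]
      congr 1
      cases e a with
      | none => simp
      | some b => rfl

theorem der_symL (he : ∀ a b, e a = some b → δ a = δ b + s) (f : Series K X) :
    der δ s e (symL δ f) = symL δ (der δ s e f) := by
  have hL : ∀ (L : List ℕ) (f : Series K X),
      der δ s e ((L.map (swp δ)).prod f) = (L.map (swp δ)).prod (der δ s e f) := by
    intro L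
    induction L with
    | nil => exact fun _ => rfl
    | cons i L ih =>
      intro f
      rw [List.map_cons, List.prod_cons, Module.End.mul_apply, Module.End.mul_apply, der_swp he, ih]
  funext w
  obtain ⟨L, h⟩ := exists_symL_eq_sum (K := K) δ w.length
  rw [h _ w rfl, der_congr_length (g := ∑ σ, ((L σ).map (swp δ)).prod f), map_sum,
    Finset.sum_apply]
  · simp only [hL]
  · intro v hv
    rw [h f v hv, Finset.sum_apply]

end Der

variable {δ}

theorem Graded.swp {ω : X → ℤ} {A : ℤ → AddSubgroup K} {f : Series K X} (hf : Graded ω A f)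
    (i : ℕ) : Graded ω A (swp δ i f) := by
  intro w
  induction i generalizing f A w with
  | zero =>
    rcases w with _ | ⟨a, _ | ⟨b, w⟩⟩
    · exact hf _
    · exact hf _
    · refine units_smul_mem _ ?_
      have := hf (b :: a :: w)
      rw [wdeg_cons, wdeg_cons] at this ⊢
      rwa [add_left_comm] at this
  | succ i ih =>
    cases w with
    | nil => exact hf _
    | cons a w => exact ih (hf.lead a) w

theorem Graded.symL {ω : X → ℤ} {A : ℤ → AddSubgroup K} {f : Series K X} (hf : Graded ω A f) :
    Graded ω A (symL δ f) := by
  have hL : ∀ (L : List ℕ), Graded ω A ((L.map (FormalGeom.swp δ)).prod f) := by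
    intro L
    induction L with
    | nil => exact hf
    | cons i L ih => exact ih.swp i
  intro w
  obtain ⟨L, h⟩ := exists_symL_eq_sum (K := K) δ w.length
  rw [h _ w rfl]
  exact sum_mem fun σ _ => hL _ w

section Closed

variable [TopologicalSpace K] [DiscreteTopology K]

theorem continuous_symL : Continuous (symL δ : Series K X →ₗ[K] Series K X) :=
  continuous_pi fun l => continuous_finsetSum (Finset.univ : Finset (Equiv.Perm (Fin l.length)))
    fun σ _ => continuous_units_smul _ (continuous_apply (List.ofFn fun k => l.get (σ k)))

theorem continuous_swp (i : ℕ) : Continuous (swp δ i : Series K X →ₗ[K] Series K X) := by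
  have key : ∀ (i : ℕ) (w : List X), Continuous fun f : Series K X => swp δ i f w := by
    intro i
    induction i with
    | zero =>
      intro w
      rcases w with _ | ⟨a, _ | ⟨b, w⟩⟩
      · exact continuous_apply []
      · exact continuous_apply [a]
      · exact continuous_units_smul _ (continuous_apply (b :: a :: w))
    | succ i ih =>
      intro w
      cases w with
      | nil => exact continuous_apply []
      | cons a w => exact (ih w).comp (continuous_lead a)
  exact continuous_pi (key i)

theorem swp_mono_sub_mem (i : ℕ) (w : List X) :
    swp δ i (mono w) - mono w ∈ symIdeal K δ := by
  classical
  by_cases hw : w.length ≤ i + 1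
  · have : swp δ i (mono w : Series K X) = mono w := by
      funext v
      by_cases hv : v.length ≤ i + 1
      · exact swp_of_length_le δ i _ hv
      · rw [swp_congr_length δ i (g := 0), map_zero]
        · have : v ≠ w := fun h => hv (h ▸ hw)
          simp [mono_apply, this]
        · intro x hx
          have : x ≠ w := fun h => hv (by rw [← hx, h]; exact hw)
          simp [mono_apply, this]
    rw [this, sub_self]
    exact zero_mem _
  · have h1 : i < w.length := by omega
    have h2 : i + 1 < w.length := by omega
    obtain ⟨u, x, y, v, rfl, rfl⟩ : ∃ u x y v, w = u ++ x :: y :: v ∧ u.length = i := by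
      refine ⟨w.take i, w[i], w[i + 1], w.drop (i + 2), ?_, by simp; omega⟩
      rw [← List.drop_eq_getElem_cons h2, ← List.drop_eq_getElem_cons h1, List.take_append_drop]
    rw [swp_mono, ← neg_mem_iff]
    refine subset_closedSpan ⟨mono u, mono v, Pi.single x 1, Pi.single y 1, ?_⟩
    rw [gen_single, gen_single, (isPure_mono δ [x]).bracket_eq (isPure_mono δ [y]), nmul_sub_right,
      nmul_units_smul, nmul_sub_left, units_smul_nmul]
    simp [mono_nmul_mono, wdeg_cons, wdeg_nil]

theorem swp_sub_mem (i : ℕ) (f : Series K X) : swp δ i f - f ∈ symIdeal K δ := by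
  let E : Series K X →ₗ[K] Series K X := swp δ i - LinearMap.id
  exact map_mem_of_mono E ((continuous_swp i).sub continuous_id) _ (isClosed_closedSpan _)
    (fun w => swp_mono_sub_mem i w) f

theorem swp_prod_sub_mem (L : List ℕ) (f : Series K X) :
    (L.map (swp δ)).prod f - f ∈ symIdeal K δ := by
  induction L with
  | nil => simp
  | cons i L ih =>
    rw [List.map_cons, List.prod_cons, Module.End.mul_apply]
    have := add_mem (swp_sub_mem (δ := δ) i ((L.map (swp δ)).prod f)) ih
    simpa using this

theorem symL_mono (w : List X) : ∃ L : Equiv.Perm (Fin w.length) → List ℕ,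
    symL δ (mono w : Series K X) = ∑ σ, ((L σ).map (swp δ)).prod (mono w) := by
  classical
  obtain ⟨L, h⟩ := exists_symL_eq_sum (K := K) δ w.length
  refine ⟨L, funext fun v => ?_⟩
  rw [Finset.sum_apply]
  by_cases hv : v.length = w.length
  · exact h _ v hv
  · have hL : ∀ L : List ℕ, ∀ v : List X, v.length ≠ w.length →
        (L.map (swp δ)).prod (mono w : Series K X) v = 0 := by
      intro L
      induction L with
      | nil =>
        intro v hv
        have : v ≠ w := fun h => hv (by rw [h])
        simp [mono_apply, this]
      | cons i L ih =>
        intro v hv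
        rw [List.map_cons, List.prod_cons, Module.End.mul_apply,
          swp_congr_length δ i (g := 0), map_zero]
        · rfl
        · intro x hx
          exact ih x (by rw [hx]; exact hv)
    rw [Finset.sum_eq_zero fun σ _ => hL _ v hv]
    obtain ⟨a, ha⟩ := exists_ofFn v
    rw [ha, symL_ofFn]
    refine Finset.sum_eq_zero fun σ _ => ?_
    have : List.ofFn (fun k => a (σ k)) ≠ w := fun h' => hv (by
      rw [← h', List.length_ofFn])
    simp [permVal, mono_apply, this]

theorem symL_of_mem_symIdeal {f : Series K X} (hf : f ∈ symIdeal K δ) : symL δ f = 0 := by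
  classical
  refine eq_on_closedSpan (L := symL δ) (L' := 0) continuous_symL continuous_const ?_ hf
  rintro _ ⟨a, b, x, y, rfl⟩
  have h1 : ∀ (u v : List X) (i j : X), symL δ (nmul (nmul (mono u)
      (bracket δ (mono [i]) (mono [j]))) (mono v) : Series K X) = 0 := by
    intro u v i j
    have h := swp_mono (K := K) δ u i j v
    rw [(isPure_mono δ [i]).bracket_eq (isPure_mono δ [j]), nmul_sub_right,
      nmul_units_smul, nmul_sub_left, units_smul_nmul]
    simp only [mono_nmul_mono, wdeg_cons, wdeg_nil, add_zero, List.append_assoc,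
      List.cons_append, List.nil_append]
    rw [← h, map_sub, symL_swp, sub_self]
  have h2 : ∀ (v : List X) (i j : X), symL δ (nmul (nmul a
      (bracket δ (mono [i]) (mono [j]))) (mono v) : Series K X) = 0 := fun v i j =>
    eq_of_mono (L := symL δ ∘ₗ mulL.flip (mono v) ∘ₗ mulL.flip (bracket δ (mono [i]) (mono [j])))
      (L' := 0) (continuous_symL.comp ((continuous_nmul_left _).comp (continuous_nmul_left _)))
      continuous_const (fun u => h1 u v i j) a
  have h3 : ∀ (i j : X), symL δ (nmul (nmul a
      (bracket δ (mono [i]) (mono [j]))) b : Series K X) = 0 := fun i j =>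
    eq_of_mono (L := symL δ ∘ₗ mulL (nmul a (bracket δ (mono [i]) (mono [j]))))
      (L' := 0) (continuous_symL.comp (continuous_nmul_right _))
      continuous_const (fun v => h2 v i j) b
  have h4 : ∀ (i : X), symL δ (nmul (nmul a
      (bracket δ (mono [i]) (gen y))) b : Series K X) = 0 := fun i =>
    eq_of_single (L := symL δ ∘ₗ mulL.flip b ∘ₗ mulL a ∘ₗ bracketL δ (mono [i]) ∘ₗ gen)
      (L' := 0) (continuous_symL.comp ((continuous_nmul_left _).comp ((continuous_nmul_right _).comp
        ((continuous_bracket_right δ _).comp continuous_gen))))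
      continuous_const (fun j => by
        have := h3 i j
        rw [← gen_single j] at this
        change symL δ (nmul (nmul a (bracket δ (mono [i]) (gen _))) b : Series K X) = 0
        convert this) y
  exact eq_of_single (L := symL δ ∘ₗ mulL.flip b ∘ₗ mulL a ∘ₗ (bracketL δ).flip (gen y) ∘ₗ gen)
      (L' := 0) (continuous_symL.comp ((continuous_nmul_left _).comp ((continuous_nmul_right _).comp
        ((continuous_bracket_left δ _).comp continuous_gen))))
      continuous_const (fun i => by
        have := h4 i
        rw [← gen_single i] at this
        change symL δ (nmul (nmul a (bracket δ (gen _) (gen y))) b : Series K X) = 0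
        convert this) x

variable [Algebra ℚ K]

/-- The coefficient `1 / n!` of `K`. -/
noncomputable def rfact (K : Type*) [CommRing K] [Algebra ℚ K] (n : ℕ) : K :=
  algebraMap ℚ K (1 / (n.factorial : ℚ))

theorem rfact_mul (n : ℕ) : rfact K n * n.factorial = 1 :=
  rinv_mul (K := K) n.factorial_ne_zero

theorem scale_rfact_scale (f : Series K X) :
    scale (rfact K) (scale (fun n => (n.factorial : K)) f) = f := by
  funext w
  simp [← mul_assoc, rfact_mul]

/-- The closed ideal of `ŜV` is the kernel of the symmetrisation, as `n!` is invertible. -/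
theorem mem_symIdeal_iff {f : Series K X} : f ∈ symIdeal K δ ↔ symL δ f = 0 := by
  refine ⟨symL_of_mem_symIdeal, fun hf => ?_⟩
  let E : Series K X →ₗ[K] Series K X := scale (rfact K) ∘ₗ symL δ - LinearMap.id
  have key := map_mem_of_mono E
    (((continuous_scale _).comp continuous_symL).sub continuous_id) (symIdeal K δ)
    (isClosed_closedSpan _) (fun w => by
      obtain ⟨L, hL⟩ := symL_mono (K := K) (δ := δ) w
      have e : E (mono w) = rfact K w.length •
          ∑ σ, (((L σ).map (swp δ)).prod (mono w) - mono w) := by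
        change scale (rfact K) (symL δ (mono w)) - mono w = _
        rw [← symL_scale, (isPure_mono δ w).scale, map_smul, hL, Finset.sum_sub_distrib, smul_sub,
          Finset.sum_const, Finset.card_univ, Fintype.card_perm, Fintype.card_fin,
          ← Nat.cast_smul_eq_nsmul K, smul_smul, rfact_mul, one_smul]
      rw [e]
      exact Submodule.smul_mem _ _ (Submodule.sum_mem _ fun σ _ => swp_prod_sub_mem _ _)) f
  have e : E f = -f := by
    change scale (rfact K) (symL δ f) - f = -f
    rw [hf, map_zero, zero_sub]
  rw [e] at key
  exact (neg_mem_iff).mp key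

end Closed

end Sym

section SymForms

variable {K : Type*} [CommRing K] {I : Type*} {Δ : I ⊕ I → ℤ} {δ : I → ℤ}

theorem res_symL (h : ∀ i, Δ (Sum.inl i) = δ i) (f : Series K (I ⊕ I)) :
    res (symL Δ f) = symL δ (res f) := by
  funext w
  obtain ⟨a, ha⟩ := exists_ofFn w
  rw [ha, res_apply, List.map_ofFn, symL_ofFn, symL_ofFn]
  refine Finset.sum_congr rfl fun σ _ => ?_
  rw [permVal, permVal, res_apply, List.map_ofFn]
  simp only [Function.comp_apply, h]
  rfl

theorem res_swp (h : ∀ i, Δ (Sum.inl i) = δ i) (i : ℕ) (f : Series K (I ⊕ I)) :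
    res (swp Δ i f) = swp δ i (res f) := by
  funext w
  induction i generalizing f w with
  | zero =>
    rcases w with _ | ⟨a, _ | ⟨b, w⟩⟩
    · rfl
    · rfl
    · rw [swp_zero_cons, res_apply, List.map_cons, List.map_cons, swp_zero_cons, h, h]
      rfl
  | succ i ih =>
    cases w with
    | nil => rfl
    | cons a w => exact ih (lead (Sum.inl a) f) w

theorem koszulSign_decomposeFin {n : ℕ} (τ : Equiv.Perm (Fin n)) (b : Fin (n + 1) → ℤ) :
    koszulSign (Equiv.Perm.decomposeFin.symm (0, τ)) b = koszulSign τ (fun k => b k.succ) := by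
  simp only [koszulSign, Finset.prod_filter, Fintype.prod_prod_type, Fin.prod_univ_succ]
  simp [Fin.succ_lt_succ_iff, Equiv.Perm.decomposeFin_symm_apply_succ,
    Equiv.Perm.decomposeFin_symm_apply_zero]

/-- Only the permutations that fix the first position contribute to the coefficient of a word
`dx · w` in the symmetrisation of `Σ_x dx · f_x`. -/
theorem lead_symL_of_lead {f : Series K (I ⊕ I)} (hf : ∀ i, lead (Sum.inl i) f = 0) (x : I) :
    res (lead (Sum.inr x) (symL Δ f)) = res (symL Δ (lead (Sum.inr x) f)) := by
  funext w
  obtain ⟨a, ha⟩ := exists_ofFn w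
  rw [res_apply, res_apply, ha, List.map_ofFn, lead_apply, symL_ofFn,
    ← List.ofFn_cons (Sum.inr x : I ⊕ I) (Sum.inl ∘ a), symL_ofFn,
    ← Equiv.sum_comp Equiv.Perm.decomposeFin.symm, Fintype.sum_prod_type,
    Fintype.sum_eq_single 0]
  · refine Finset.sum_congr rfl fun τ _ => ?_
    rw [permVal, permVal, koszulSign_decomposeFin, List.ofFn_succ]
    simp [Equiv.Perm.decomposeFin_symm_apply_succ, Equiv.Perm.decomposeFin_symm_apply_zero]
  · intro p hp
    obtain ⟨q, rfl⟩ := Fin.exists_succ_eq_of_ne_zero hp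
    refine Finset.sum_eq_zero fun τ _ => ?_
    rw [permVal, List.ofFn_succ, Equiv.Perm.decomposeFin_symm_apply_zero, Fin.cons_succ,
      Function.comp_apply, ← lead_apply (Sum.inl (a q)) f, hf, Pi.zero_apply, smul_zero]

end SymForms

/-! ### The commutative case -/

section Com

variable {K : Type*} [CommRing K] {I : Type*}

theorem diff_symL (deg : I → ℤ) (f : Series K (I ⊕ I)) :
    diff deg (symL (tdeg deg) f) = symL (tdeg deg) (diff deg f) := by
  rw [diff_eq_der, der_symL (eD_tdeg deg)]

theorem iota_symL (deg : I → ℤ) (f : Series K (I ⊕ I)) :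
    iota deg (symL (tdeg deg) f) = symL (tdeg deg) (iota deg f) :=
  der_symL (eI_tdeg deg) f

theorem lead_scale {X : Type*} (a : X) (c : ℕ → K) (f : Series K X) :
    lead a (scale c f) = scale (fun n => c (n + 1)) (lead a f) := rfl

/-- The symmetrisation of `dx · y` is the cyclic symmetrisation of `dx · i(y)`. -/
theorem symL_liftD (deg : I → ℤ) (x : I → K) (y : Series K I) :
    symL (tdeg deg) (liftD (nmul (gen x) y)) =
      norm (tdeg deg) (liftD (nmul (gen x) (symL deg y))) := by
  rw [← sub_eq_zero]
  refine eq_zero_of_rot_of_head (Δ := tdeg deg) ?_ ?_ fun i w => ?_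
  · rw [map_sub, rot_norm, rot_of_swp _ fun i => swp_symL _ i _]
  · exact (graded_liftD_form _).symL.sub ((graded_liftD_form _).norm _)
  · have h1 := congrFun (lead_symL_of_lead (Δ := tdeg deg)
      (lead_inl_liftD (nmul (gen x) y)) i) w
    rw [res_symL (tdeg_inl deg), lead_inr_liftD, res_incl, lead_gen_nmul, map_smul] at h1
    have h2 : norm (tdeg deg) (liftD (nmul (gen x) (symL deg y))) (Sum.inr i :: w.map Sum.inl) =
        nmul (gen x) (symL deg y) (i :: w) := by
      rw [← headD_cons, headD_liftD _ (gen_nmul_nil _ _)]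
    rw [Pi.sub_apply, h2, gen_nmul_cons, sub_eq_zero]
    exact h1

variable [Algebra ℚ K]

theorem scale_rinv_scale {X : Type*} {f : Series K X} (h : f [] = 0) :
    scale (rinv K) (scale (fun n => (n : K)) f) = f := by
  funext w
  rw [scale_apply, scale_apply, ← mul_assoc]
  rcases eq_or_ne w [] with rfl | hw
  · simp [h]
  · rw [rinv_mul (by simpa using hw), one_mul]

/-- The map that induces `ζ` in the commutative case: `DR(ŜW)` is embedded in `DR(T̂W)` by
`ω ↦ n⁻¹ · ∑_{σ ∈ Sₙ} σ · ω` in word length `n`. -/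
noncomputable def zetaCom (deg : I → ℤ) : Series K (I ⊕ I) →ₗ[K] Series K I :=
  zetaMap deg ∘ₗ scale (rinv K) ∘ₗ symL (tdeg deg)

/-- The map that induces the inverse of `ζ` in the commutative case. -/
noncomputable def etaCom (deg : I → ℤ) : Series K I →ₗ[K] Series K (I ⊕ I) :=
  scale (rfact K) ∘ₗ norm (tdeg deg) ∘ₗ etaMap deg

theorem zetaCom_apply (deg : I → ℤ) (f : Series K (I ⊕ I)) :
    zetaCom deg f = zetaMap deg (scale (rinv K) (symL (tdeg deg) f)) := rfl

theorem etaCom_apply (deg : I → ℤ) (h : Series K I) :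
    etaCom deg h = scale (rfact K) (norm (tdeg deg) (etaMap deg h)) := rfl

theorem zetaMap_scale_norm (deg : I → ℤ) (f : Series K (I ⊕ I)) :
    zetaMap deg (scale (rinv K) (norm (tdeg deg) f)) = zetaMap deg f := by
  refine zetaMap_congr ?_
  rw [norm_scale, norm_of_rot _ (rot_norm _ _), scale_rinv_scale (norm_nil _ _)]

variable [TopologicalSpace K] [DiscreteTopology K]

/-- The formula `ζ(d(dx · ȳ)) = [x, i(y)]`. -/
theorem zetaCom_diff (deg : I → ℤ) (x : I → K) (y : Series K I) :
    zetaCom deg (diff deg (liftD (nmul (gen x) y))) = bracket deg (gen x) (symL deg y) := by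
  rw [zetaCom_apply, ← diff_symL, symL_liftD, ← norm_diff, zetaMap_scale_norm, ← dgen_nmul_incl,
    zetaMap_diff_dgen]

theorem zetaCom_etaCom_bracket (deg : I → ℤ) (x : I → K) {g : Series K I}
    (hg : g ∈ symInvariants K deg) :
    zetaCom deg (etaCom deg (bracket deg (gen x) g)) = bracket deg (gen x) g := by
  have hg' : symL deg (scale (rfact K) g) = g := by
    rw [symL_scale, symL_of_mem deg hg, scale_rfact_scale]
  have h1 : norm (tdeg deg) (etaMap deg (bracket deg (gen x) g)) =
      symL (tdeg deg) (diff deg (liftD (nmul (gen x) (scale (rfact K) g)))) := by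
    rw [etaMap_bracket_norm, norm_diff, dgen_nmul_incl, ← diff_symL, symL_liftD, hg']
  have h2 : symL (tdeg deg) (etaCom deg (bracket deg (gen x) g)) =
      symL (tdeg deg) (diff deg (liftD (nmul (gen x) (scale (rfact K) g)))) := by
    rw [etaCom_apply, h1, symL_scale, symL_symL, scale_rfact_scale]
  rw [zetaCom_apply, h2, ← zetaCom_apply, zetaCom_diff, hg']

theorem continuous_zetaCom (deg : I → ℤ) :
    Continuous (zetaCom deg : Series K (I ⊕ I) →ₗ[K] Series K I) :=
  (continuous_zetaMap deg).comp ((continuous_scale _).comp continuous_symL)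

theorem continuous_etaCom (deg : I → ℤ) :
    Continuous (etaCom deg : Series K I →ₗ[K] Series K (I ⊕ I)) :=
  (continuous_scale _).comp ((continuous_norm _).comp (continuous_etaMap deg))

theorem zetaCom_mem (deg : I → ℤ) (f : Series K (I ⊕ I)) :
    zetaCom deg f ∈
      commutators deg (Set.range (gen : (I → K) →ₗ[K] Series K I)) (symInvariants K deg) := by
  rw [zetaCom_apply, zetaMap_apply, ← headBracket_scale]
  refine headBracket_mem (isClosed_closedSpan _) fun x i => subset_closedSpan
    ⟨_, ⟨x, rfl⟩, _, mem_symInvariants_of_swp deg fun j => ?_, rfl⟩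
  rw [iota_scale, headD_scale, iota_symL]
  set g := iota deg f
  have e : lead i (headD (tdeg deg) (symL (tdeg deg) g)) =
      res (lead (Sum.inr i) (scale (fun n => (n : K)) (symL (tdeg deg) g))) := by
    rw [← norm_symL]
    rfl
  have e2 : swp deg j (lead i (headD (tdeg deg) (symL (tdeg deg) g))) =
      lead i (headD (tdeg deg) (symL (tdeg deg) g)) := by
    rw [e, ← res_swp (tdeg_inl deg), ← lead_swp_succ, swp_scale, swp_symL]
  rw [lead_scale, lead_scale, swp_scale, swp_scale, e2]

theorem zetaCom_etaCom {deg : I → ℤ} {h : Series K I}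
    (hh : h ∈ commutators deg (Set.range (gen : (I → K) →ₗ[K] Series K I))
      (symInvariants K deg)) : zetaCom deg (etaCom deg h) = h := by
  let E : Series K I →ₗ[K] Series K I := zetaCom deg ∘ₗ etaCom deg
  have hE : Continuous E := (continuous_zetaCom deg).comp (continuous_etaCom deg)
  unfold commutators at hh
  refine eq_on_closedSpan (L := E) (L' := LinearMap.id) hE continuous_id ?_ hh
  rintro _ ⟨_, ⟨x, rfl⟩, g, hg, rfl⟩
  exact zetaCom_etaCom_bracket deg x hg

theorem mem_closedCom_iff {deg : I → ℤ} {f : Series K (I ⊕ I)} :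
    (Submodule.Quotient.mk f : DRCom K deg) ∈ closedCom K deg ↔
      (∃ g, Graded formWt (only K 2) g ∧ f - g ∈ symIdeal K (tdeg deg)) ∧
      diff deg f ∈ symIdeal K (tdeg deg) := by
  unfold closedCom
  rw [Submodule.mem_inf]
  refine and_congr ⟨?_, ?_⟩ ?_
  · rintro ⟨g, hg, h⟩
    exact ⟨g, mem_formsT_iff.mp hg, (Submodule.Quotient.eq _).mp h.symm⟩
  · rintro ⟨g, hg, h⟩
    exact ⟨g, mem_formsT_iff.mpr hg, ((Submodule.Quotient.eq _).mpr h).symm⟩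
  · rw [LinearMap.mem_ker]
    exact Submodule.Quotient.mk_eq_zero _

theorem exists_zeta_com (𝒦 : ℤ → AddSubgroup K) [GradedRing 𝒦] (deg : I → ℤ) :
    ∃ ζ : closedCom K deg ≃L[K]
        commutators deg (Set.range (gen : (I → K) →ₗ[K] Series K I)) (symInvariants K deg),
      (∀ (m : ℤ) (ω : closedCom K deg),
        HomogCom 𝒦 deg m ω ↔ IsHomog 𝒦 (wdeg deg) m (ζ ω : Series K I)) ∧
      ∀ (x : I → K) (y : Series K I) (ω : closedCom K deg),
        (ω : DRCom K deg) = dCom K deg (Submodule.Quotient.mk (nmul (dgen x) (incl y))) →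
        (ζ ω : Series K I) = bracket deg (gen x) (symmetrise deg y) := by
  obtain ⟨ζ, hζ, hη⟩ := exists_equiv_of_maps (C := closedCom K deg)
    (T := commutators deg (Set.range (gen : (I → K) →ₗ[K] Series K I)) (symInvariants K deg))
    (zetaCom deg) (continuous_zetaCom deg) (etaCom deg) (continuous_etaCom deg)
    (fun f hf => by
      rw [zetaCom_apply, symL_of_mem_symIdeal hf, map_zero, map_zero])
    (fun f _ => zetaCom_mem deg f)
    (fun h _ => mem_closedCom_iff.mpr ⟨⟨etaCom deg h,
        ((graded_etaMap_form deg h).norm _).scale (divClosed_only 2) fun n => 1 / (n.factorial : ℚ),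
        by simp⟩, by
      rw [etaCom_apply, diff_scale, ← norm_diff, etaMap_apply, diff_diff, map_zero, map_zero]
      exact zero_mem _⟩)
    (fun h hh => zetaCom_etaCom hh)
    (fun f hf hZ => by
      obtain ⟨⟨g, hg, hfg⟩, hd⟩ := mem_closedCom_iff.mp hf
      have h1 : symL (tdeg deg) f = symL (tdeg deg) g := by
        rw [← sub_eq_zero, ← map_sub, symL_of_mem_symIdeal hfg]
      have h0 : symL (tdeg deg) g [] = 0 := by
        by_contra h0
        have := mem_only.mp (hg.symL (δ := tdeg deg) []) h0
        simp [wdeg_nil] at this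
      rw [mem_symIdeal_iff, ← diff_symL, h1] at hd
      rw [zetaCom_apply, h1] at hZ
      have h2 := norm_eq_zero_of_zetaMap (deg := deg)
        (hg.symL.scale (divClosed_only 2) fun n => 1 / (n : ℚ))
        (by
          have := diff_scale deg (rinv K) (symL (tdeg deg) g)
          rw [hd, map_zero] at this
          exact (congrArg _ this).trans (map_zero _)) hZ
      rw [mem_symIdeal_iff, h1]
      have h3 := norm_scale (tdeg deg) (rinv K) (symL (tdeg deg) g)
      rw [norm_symL, scale_rinv_scale h0] at h3
      exact h3.symm.trans h2)
  refine ⟨ζ, fun m ω => ⟨?_, fun h => ?_⟩, ?_⟩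
  · rintro ⟨f, hf, hω⟩
    rw [hζ ω f hω]
    exact Graded.zetaMap (divClosed_grading 𝒦 m)
      (Graded.scale (divClosed_grading 𝒦 m) (fun n => 1 / (n : ℚ)) (Graded.symL hf))
  · exact ⟨_, ((Graded.etaMap (divClosed_grading 𝒦 m) h).norm _).scale (divClosed_grading 𝒦 m)
      (fun n => 1 / (n.factorial : ℚ)), hη ω⟩
  · intro x y ω hω
    rw [hζ ω _ hω, dgen_nmul_incl, zetaCom_diff]; rfl

end Com

/-! ### Lie series and the Dynkin operator -/

section LieWords

variable {K : Type*} [CommRing K] {X : Type*} (δ : X → ℤ)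

/-- Iterated brackets of letters, of degree `p` and length `n`. -/
inductive LieWord : ℤ → ℕ → Series K X → Prop
  | of (x : X) : LieWord (δ x) 1 (mono [x])
  | bracket {p q : ℤ} {n m : ℕ} {f g : Series K X} (hf : LieWord p n f) (hg : LieWord q m g) :
      LieWord (p + q) (n + m) (bracket δ f g)

variable {δ}

theorem LieWord.isPure {p : ℤ} {n : ℕ} {f : Series K X} (h : LieWord δ p n f) :
    IsPure δ p n f := by
  induction h with
  | of x => simpa [wdeg_cons, wdeg_nil] using isPure_mono (K := K) δ [x]
  | bracket _ _ h1 h2 => exact h1.bracket h2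

theorem LieWord.pos {p : ℤ} {n : ℕ} {f : Series K X} (h : LieWord δ p n f) : 0 < n := by
  induction h with
  | of x => exact one_pos
  | bracket _ _ h1 h2 => omega

theorem LieWord.nil {p : ℤ} {n : ℕ} {f : Series K X} (h : LieWord δ p n f) : f [] = 0 := by
  by_contra h0
  have := (h.isPure _ h0).2
  have := h.pos
  simp at *; omega

theorem LieWord.lieMonomial {p : ℤ} {n : ℕ} {f : Series K X} (h : LieWord δ p n f) :
    LieMonomial δ f := by
  classical
  induction h with
  | of x => rw [← gen_single]; exact .of _
  | bracket _ _ h1 h2 => exact .bracket h1 h2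

theorem IsPure.bracket_symm {p q : ℤ} {n m : ℕ} {f g : Series K X} (hf : IsPure δ p n f)
    (hg : IsPure δ q m g) :
    FormalGeom.bracket δ g f = -((p * q).negOnePow • FormalGeom.bracket δ f g) := by
  rw [hf.bracket_eq hg, hg.bracket_eq hf, mul_comm q p]
  rcases Int.units_eq_one_or (p * q).negOnePow with h | h <;> rw [h] <;> simp

theorem IsPure.jacobi_of_isPure {p q r : ℤ} {n m l : ℕ} {f g h : Series K X}
    (hf : IsPure δ p n f) (hg : IsPure δ q m g) (hh : IsPure δ r l h) :
    FormalGeom.bracket δ (FormalGeom.bracket δ f g) h =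
      FormalGeom.bracket δ f (FormalGeom.bracket δ g h) -
        (p * q).negOnePow • FormalGeom.bracket δ g (FormalGeom.bracket δ f h) := by
  rw [(hf.bracket hg).bracket_eq hh, hf.bracket_eq (hg.bracket hh), hg.bracket_eq (hf.bracket hh),
    hf.bracket_eq hg, hg.bracket_eq hh, hf.bracket_eq hh]
  simp only [nmul_sub_left, nmul_sub_right, nmul_units_smul, units_smul_nmul, nmul_assoc, mul_add,
    add_mul, Int.negOnePow_add, mul_comm q p]
  rcases Int.units_eq_one_or (p * q).negOnePow with h1 | h1 <;>
  rcases Int.units_eq_one_or (p * r).negOnePow with h2 | h2 <;>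
  rcases Int.units_eq_one_or (q * r).negOnePow with h3 | h3 <;>
  rw [h1, h2, h3] <;> simp <;> abel

variable [TopologicalSpace K] [DiscreteTopology K]

theorem IsPure.jacobi {p q : ℤ} {n m : ℕ} {f g : Series K X}
    (hf : IsPure δ p n f) (hg : IsPure δ q m g) (h : Series K X) :
    FormalGeom.bracket δ (FormalGeom.bracket δ f g) h =
      FormalGeom.bracket δ f (FormalGeom.bracket δ g h) -
        (p * q).negOnePow • FormalGeom.bracket δ g (FormalGeom.bracket δ f h) := by
  let E : Series K X →ₗ[K] Series K X := bracketL δ f ∘ₗ bracketL δ g -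
    ((((p * q).negOnePow : ℤˣ) : ℤ) : K) • (bracketL δ g ∘ₗ bracketL δ f)
  have hE : ∀ h, E h = FormalGeom.bracket δ f (FormalGeom.bracket δ g h) -
      (p * q).negOnePow • FormalGeom.bracket δ g (FormalGeom.bracket δ f h) := fun h => by
    funext w
    simp [E, bracketL_apply, units_smul_eq_mul]
  have hc : Continuous E := by
    have : ⇑E = fun h => FormalGeom.bracket δ f (FormalGeom.bracket δ g h) -
      (p * q).negOnePow • FormalGeom.bracket δ g (FormalGeom.bracket δ f h) := funext hE
    rw [this]
    refine ((continuous_bracket_right δ f).comp (continuous_bracket_right δ g)).sub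
      (continuous_pi fun w => continuous_units_smul _ ((continuous_apply w).comp
        ((continuous_bracket_right δ g).comp (continuous_bracket_right δ f))))
  rw [← hE]
  exact eq_of_mono (L := bracketL δ (FormalGeom.bracket δ f g)) (L' := E)
    (continuous_bracket_right δ _) hc
    (fun w => by rw [hE]; exact hf.jacobi_of_isPure hg (isPure_mono δ w)) h

theorem bracket_mem_of_words {P : Submodule K (Series K X)} {S T : Set (Series K X)}
    (hP : IsClosed (P : Set (Series K X))) (h : ∀ f ∈ S, ∀ g ∈ T, bracket δ f g ∈ P)
    {f g : Series K X} (hf : f ∈ closedSpan S) (hg : g ∈ closedSpan T) : bracket δ f g ∈ P :=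
  mem_of_closedSpan (L := (bracketL δ).flip g) (continuous_bracket_left δ g) P hP
    (fun f' hf' => mem_of_closedSpan (L := bracketL δ f') (continuous_bracket_right δ f') P hP
      (fun g' hg' => h f' hf' g' hg') hg) hf

theorem lieSeries_eq : lieSeries K δ = closedSpan {f | ∃ p n, LieWord δ p n f} := by
  classical
  refine le_antisymm ?_ ?_
  · refine closedSpan_le (isClosed_closedSpan _) ?_
    intro f hf
    induction hf with
    | of v =>
      exact map_mem_of_single (gen : (X → K) →ₗ[K] Series K X) continuous_gen
        (closedSpan {f | ∃ p n, LieWord δ p n f}) (isClosed_closedSpan _)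
        (fun x => subset_closedSpan ⟨_, _, by
          have := LieWord.of (K := K) (δ := δ) x
          rw [← gen_single] at this
          convert this⟩) v
    | bracket _ _ h1 h2 =>
      refine bracket_mem_of_words (isClosed_closedSpan _) ?_ h1 h2
      rintro f ⟨p, n, hf⟩ g ⟨q, m, hg⟩
      exact subset_closedSpan ⟨_, _, hf.bracket hg⟩
  · refine closedSpan_le (isClosed_closedSpan _) ?_
    rintro f ⟨p, n, hf⟩
    exact subset_closedSpan hf.lieMonomial

theorem LieWord.mem {p : ℤ} {n : ℕ} {f : Series K X} (h : LieWord δ p n f) :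
    f ∈ lieSeries K δ := subset_closedSpan h.lieMonomial

theorem bracket_mem_lieSeries {f g : Series K X} (hf : f ∈ lieSeries K δ)
    (hg : g ∈ lieSeries K δ) : bracket δ f g ∈ lieSeries K δ :=
  bracket_mem_of_words (isClosed_closedSpan _)
    (fun _ hf _ hg => subset_closedSpan (LieMonomial.bracket hf hg)) hf hg

theorem gen_mem_lieSeries (v : X → K) : gen v ∈ lieSeries K δ := subset_closedSpan (.of v)

/-- Continuous linear maps on Lie series are controlled by the values on brackets of letters. -/
theorem map_mem_of_lieWord {M : Type*} [AddCommGroup M] [Module K M] [TopologicalSpace M]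
    {L : Series K X →ₗ[K] M} (hL : Continuous L) (P : Submodule K M) (hP : IsClosed (P : Set M))
    (h : ∀ f p n, LieWord δ p n f → L f ∈ P) {f : Series K X} (hf : f ∈ lieSeries K δ) :
    L f ∈ P := by
  rw [lieSeries_eq] at hf
  refine mem_of_closedSpan hL P hP ?_ hf
  rintro f ⟨p, n, hf⟩
  exact h f p n hf

/-- By the Jacobi identity `[L̂V, L̂V]` is generated by the `[x, y]` with `x ∈ V`. -/
theorem commutators_lieSeries_le :
    commutators δ (lieSeries K δ) (lieSeries K δ) ≤
      closedSpan {h | ∃ (x : X → K), ∃ y ∈ lieSeries K δ, h = bracket δ (gen x) y} := by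
  classical
  set P := closedSpan {h | ∃ (x : X → K), ∃ y ∈ lieSeries K δ, h = bracket δ (gen x) y}
  have key : ∀ p n a, LieWord δ p n a → ∀ b ∈ lieSeries K δ, bracket δ a b ∈ P := by
    intro p n a ha
    induction ha with
    | of x =>
      intro b hb
      rw [← gen_single]
      exact subset_closedSpan ⟨_, b, hb, rfl⟩
    | bracket h1 h2 ih1 ih2 =>
      intro b hb
      rw [h1.isPure.jacobi h2.isPure]
      refine sub_mem (ih1 _ (bracket_mem_lieSeries h2.mem hb)) ?_
      have := ih2 _ (bracket_mem_lieSeries h1.mem hb)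
      rename_i p q n m f g
      rcases Int.units_eq_one_or (p * q).negOnePow with h | h <;> rw [h]
      · simpa using this
      · simpa using this
  refine closedSpan_le (isClosed_closedSpan _) ?_
  rintro _ ⟨a, ha, b, hb, rfl⟩
  exact map_mem_of_lieWord (L := (bracketL δ).flip b) (continuous_bracket_left δ b) P
    (isClosed_closedSpan _) (fun f p n hf => key p n f hf b hb) ha

end LieWords

section Dynkin

variable {K : Type*} [CommRing K] {X : Type*} (δ : X → ℤ)

/-- The map `Σ_x x · g_x ↦ Σ_x x · L(g_x)`. -/
def mapTail (L : Series K X →ₗ[K] Series K X) : Series K X →ₗ[K] Series K X where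
  toFun f w := match w with
    | [] => 0
    | a :: w => L (lead a f) w
  map_add' f g := by funext w; cases w <;> simp
  map_smul' c f := by funext w; cases w <;> simp

theorem mapTail_cons (L : Series K X →ₗ[K] Series K X) (f : Series K X) (a : X) (w : List X) :
    mapTail L f (a :: w) = L (lead a f) w := rfl

theorem lead_mapTail (L : Series K X →ₗ[K] Series K X) (f : Series K X) (a : X) :
    lead a (mapTail L f) = L (lead a f) := rfl

theorem headBracket_congr {f g : Series K X} {w : List X}
    (h : ∀ v : List X, v.length = w.length → f v = g v) :
    headBracket δ f w = headBracket δ g w := by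
  rw [headBracket_apply, headBracket_apply, h w rfl, rot_pow_congr δ _ h]

/-- The Dynkin operator on words of length `n`. -/
def dynkinAux : ℕ → Series K X →ₗ[K] Series K X
  | 0 => 0
  | 1 => LinearMap.id
  | n + 2 => headBracket δ ∘ₗ mapTail (dynkinAux (n + 1))

/-- The Dynkin operator `x₁ ⋯ xₙ ↦ [x₁, [x₂, … [xₙ₋₁, xₙ]]]`. -/
def dynkin : Series K X →ₗ[K] Series K X where
  toFun f w := dynkinAux δ w.length f w
  map_add' f g := by funext w; simp
  map_smul' c f := by funext w; simp

theorem dynkin_apply (f : Series K X) (w : List X) : dynkin δ f w = dynkinAux δ w.length f w := rfl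

theorem dynkin_nil (f : Series K X) : dynkin δ f [] = 0 := rfl

theorem dynkin_singleton (f : Series K X) {w : List X} (h : w.length = 1) : dynkin δ f w = f w := by
  rw [dynkin_apply, h]; rfl

theorem dynkinAux_congr (n : ℕ) {f g : Series K X} {w : List X} (hw : w.length = n)
    (h : ∀ v : List X, v.length = n → f v = g v) : dynkinAux δ n f w = dynkinAux δ n g w := by
  induction n using Nat.strong_induction_on generalizing f g w with
  | _ n ih =>
    match n with
    | 0 => rfl
    | 1 => exact h w hw
    | n + 2 =>
      refine headBracket_congr δ fun v hv => ?_
      rw [hw] at hv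
      cases v with
      | nil => rfl
      | cons a v =>
        exact ih (n + 1) (by omega) (by simpa using hv) fun u hu => h (a :: u) (by simp [hu])

theorem dynkin_scale (c : ℕ → K) (f : Series K X) :
    dynkin δ (scale c f) = scale c (dynkin δ f) := by
  funext w
  have : dynkinAux δ w.length (scale c f) w = dynkinAux δ w.length (c w.length • f) w :=
    dynkinAux_congr δ _ rfl fun v hv => by simp [hv]
  rw [dynkin_apply, this, map_smul]; rfl

theorem Graded.mapTail {ω : X → ℤ} {A : ℤ → AddSubgroup K} {f : Series K X}
    {L : Series K X →ₗ[K] Series K X}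
    (hL : ∀ (A : ℤ → AddSubgroup K) f, Graded ω A f → Graded ω A (L f)) (hf : Graded ω A f) :
    Graded ω A (FormalGeom.mapTail L f) := by
  intro w
  cases w with
  | nil => exact zero_mem _
  | cons a w => exact hL _ _ (hf.lead a) w

theorem Graded.dynkin {ω : X → ℤ} {A : ℤ → AddSubgroup K} {f : Series K X}
    (hf : Graded ω A f) : Graded ω A (FormalGeom.dynkin δ f) := by
  have key : ∀ (n : ℕ) (A : ℤ → AddSubgroup K) (f : Series K X), Graded ω A f →
      Graded ω A (dynkinAux δ n f) := by
    intro n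
    induction n using Nat.strong_induction_on with
    | _ n ih =>
      match n with
      | 0 => exact fun A f _ w => zero_mem _
      | 1 => exact fun A f hf => hf
      | n + 2 => exact fun A f hf => (hf.mapTail (ih (n + 1) (by omega))).headBracket
  exact fun w => key _ _ _ hf w

variable [TopologicalSpace K] [DiscreteTopology K]

theorem continuous_mapTail {L : Series K X →ₗ[K] Series K X} (hL : Continuous L) :
    Continuous (mapTail L) := by
  refine continuous_pi fun w => ?_
  cases w with
  | nil => exact continuous_const
  | cons a w => exact ((continuous_apply w).comp hL).comp (continuous_lead a)

theorem continuous_dynkin : Continuous (dynkin δ : Series K X →ₗ[K] Series K X) := by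
  have key : ∀ n : ℕ, Continuous (dynkinAux δ n : Series K X →ₗ[K] Series K X) := by
    intro n
    induction n using Nat.strong_induction_on with
    | _ n ih =>
      match n with
      | 0 => exact continuous_const
      | 1 => exact continuous_id
      | n + 2 => exact (continuous_headBracket δ).comp (continuous_mapTail (ih (n + 1) (by omega)))
  have h (w : List X) : Continuous fun f : Series K X => dynkinAux δ w.length f w :=
    (continuous_apply w).comp (key _)
  exact continuous_pi h

variable {δ}

theorem dynkin_gen_nmul (x : X → K) {g : Series K X} (hg : g [] = 0) :
    dynkin δ (nmul (gen x) g) = bracket δ (gen x) (dynkin δ g) := by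
  rw [bracket_gen]
  funext w
  rcases w with _ | ⟨a, _ | ⟨b, w⟩⟩
  · rw [dynkin_nil, headBracket_nil]
  · rw [dynkin_singleton _ _ rfl, gen_nmul_cons, hg]
    simp [headBracket_apply]
  · change headBracket δ (mapTail (dynkinAux δ (w.length + 1)) (nmul (gen x) g)) (a :: b :: w) = _
    refine headBracket_congr δ fun v hv => ?_
    cases v with
    | nil => simp at hv
    | cons c v =>
      have hv' : v.length = w.length + 1 := by simpa using hv
      rw [mapTail_cons, lead_gen_nmul, map_smul, gen_nmul_cons, dynkin_apply, hv']
      rfl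

/-- The Dynkin operator turns left multiplication by a Lie word into the adjoint action: this holds
for letters by definition, and both sides are compatible with brackets. -/
theorem dynkin_lieWord_nmul {p : ℤ} {n : ℕ} {u : Series K X} (hu : LieWord δ p n u)
    {g : Series K X} (hg : g [] = 0) :
    dynkin δ (nmul u g) = bracket δ u (dynkin δ g) := by
  classical
  induction hu generalizing g with
  | of x => rw [← gen_single]; exact dynkin_gen_nmul _ hg
  | bracket h1 h2 ih1 ih2 =>
    rename_i f' g'
    rw [h1.isPure.jacobi h2.isPure, h1.isPure.bracket_eq h2.isPure, nmul_sub_left, units_smul_nmul,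
      nmul_assoc, nmul_assoc, map_sub, map_units_smul,
      ih1 (g := nmul g' g) (by rw [nmul_nil, hg, mul_zero]), ih2 hg,
      ih2 (g := nmul f' g) (by rw [nmul_nil, hg, mul_zero]), ih1 hg]

theorem dynkin_lieWord {p : ℤ} {n : ℕ} {u : Series K X} (hu : LieWord δ p n u) :
    dynkin δ u = (n : K) • u := by
  classical
  induction hu with
  | of x =>
    have h1 : (mono [x] : Series K X) = scale (fun n => if n = 1 then 1 else 0) (mono [x]) := by
      rw [(isPure_mono δ [x]).scale]; simp
    funext w
    by_cases hw : w.length = 1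
    · rw [dynkin_singleton _ _ hw]; simp
    · have h2 : w ≠ [x] := fun h => hw (by rw [h]; rfl)
      rw [h1, dynkin_scale]; simp [hw]
  | bracket h1 h2 ih1 ih2 =>
    rename_i p q n m f g
    have e := h1.isPure.bracket_symm h2.isPure
    have e1 : ∀ (c : K) (f g : Series K X), bracket δ f (c • g) = c • bracket δ f g :=
      fun c f g => map_smul (bracketL δ f) c g
    conv_lhs => rw [h1.isPure.bracket_eq h2.isPure]
    rw [map_sub, map_units_smul,
      dynkin_lieWord_nmul h1 h2.nil, dynkin_lieWord_nmul h2 h1.nil, ih1, ih2, e1, e1, e,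
      smul_neg, smul_neg, smul_comm (n : K), smul_smul, Int.units_mul_self, one_smul,
      sub_neg_eq_add, ← add_smul]
    push_cast
    rw [add_comm]

/-- Dynkin's theorem: on Lie series the Dynkin operator is multiplication by the length. -/
theorem dynkin_of_mem {f : Series K X} (hf : f ∈ lieSeries K δ) :
    dynkin δ f = scale (fun n => (n : K)) f := by
  rw [lieSeries_eq] at hf
  refine eq_on_closedSpan (continuous_dynkin δ) (continuous_scale _) ?_ hf
  rintro u ⟨p, n, hu⟩
  rw [dynkin_lieWord hu, hu.isPure.scale]

theorem dynkin_mem (f : Series K X) : dynkin δ f ∈ lieSeries K δ := by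
  classical
  refine map_mem_of_mono (dynkin δ) (continuous_dynkin δ) _ (isClosed_closedSpan _) (fun w => ?_) f
  induction w with
  | nil =>
    have h1 : (mono [] : Series K X) = scale (fun n => if n = 0 then 1 else 0) (mono []) := by
      rw [(isPure_mono δ []).scale]; simp
    have : dynkin δ (mono [] : Series K X) = 0 := by
      funext w
      cases w with
      | nil => rfl
      | cons a w => rw [h1, dynkin_scale]; simp
    rw [this]
    exact zero_mem _
  | cons a w ih =>
    cases w with
    | nil => rw [dynkin_lieWord (.of a)]; exact Submodule.smul_mem _ _ (LieWord.of a).mem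
    | cons b w =>
      have : (mono (a :: b :: w) : Series K X) = nmul (mono [a]) (mono (b :: w)) := by
        rw [mono_nmul_mono]; rfl
      rw [this, dynkin_lieWord_nmul (.of a) (by simp [mono_apply])]
      exact bracket_mem_lieSeries (LieWord.of a).mem ih

end Dynkin

/-! ### Products of two Lie series modulo commutators -/

section LiePairs

variable {K : Type*} [CommRing K] {X : Type*} {δ : X → ℤ}

theorem IsPure.graded_only {p : ℤ} {n : ℕ} {f : Series K X} (hf : IsPure δ p n f) :
    Graded δ (only K p) f := fun w => mem_only.mpr fun h => (hf w h).1

theorem IsPure.graded_length {p : ℤ} {n : ℕ} {f : Series K X} (hf : IsPure δ p n f) :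
    Graded (fun _ => 1) (only K n) f := fun w => mem_only.mpr fun h => by
  simp [wdeg, (hf w h).2]

theorem isPure_of_graded {p : ℤ} {n : ℕ} {f : Series K X} (h1 : Graded δ (only K p) f)
    (h2 : Graded (fun _ => 1) (only K n) f) : IsPure δ p n f := fun w hw =>
  ⟨mem_only.mp (h1 w) hw, by simpa [wdeg] using mem_only.mp (h2 w) hw⟩

theorem IsPure.der {s : ℤ} {e : X → Option X} (he : ∀ a b, e a = some b → δ a = δ b + s)
    {p : ℤ} {n : ℕ} {f : Series K X} (hf : IsPure δ p n f) :
    IsPure δ (p + s) n (der δ s e f) := by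
  refine isPure_of_graded ?_ ?_
  · rw [← only_shift]
    exact hf.graded_only.der he
  · have := hf.graded_length.der (Δ := δ) (s := s) (e := e) (r := 0) (by simp)
    simpa using this

theorem IsPure.incl {Δ : X ⊕ X → ℤ} (h : ∀ i, Δ (Sum.inl i) = δ i) {p : ℤ} {n : ℕ}
    {f : Series K X} (hf : IsPure δ p n f) : IsPure Δ p n (incl f) :=
  isPure_of_graded (hf.graded_only.incl h) (hf.graded_length.incl fun _ => rfl)

/-- `x · g ↦ x ⊗ g` for letters `x`. -/
def toTens : Series K X →ₗ[K] Series2 K X where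
  toFun g p := match p.1 with
    | [x] => g (x :: p.2)
    | _ => 0
  map_add' f g := by
    funext ⟨u, v⟩
    rcases u with _ | ⟨a, _ | ⟨b, u⟩⟩ <;> simp
  map_smul' c f := by
    funext ⟨u, v⟩
    rcases u with _ | ⟨a, _ | ⟨b, u⟩⟩ <;> simp

theorem toTens_mono_nmul (x : X) (g : Series K X) :
    toTens (nmul (mono [x]) g) = tens (mono [x]) g := by
  classical
  rw [← gen_single]
  funext ⟨u, v⟩
  rcases u with _ | ⟨a, _ | ⟨b, u⟩⟩
  · simp [toTens, tens, gen_nil]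
  · exact gen_nmul_cons _ g a v
  · change 0 = gen _ _ * g v
    simp [gen]

theorem graded_toTens {ω : X → ℤ} {A : ℤ → AddSubgroup K} {g : Series K X} (hg : Graded ω A g)
    (p : List X × List X) : toTens g p ∈ A (wdeg ω p.1 + wdeg ω p.2) := by
  rcases p with ⟨_ | ⟨a, _ | ⟨b, u⟩⟩, v⟩
  · exact zero_mem _
  · have := hg (a :: v)
    rw [wdeg_cons] at this
    simpa [toTens, wdeg_cons, wdeg_nil] using this
  · exact zero_mem _

/-- `f ⊗ g` as a bilinear map. -/
def tensL : Series K X →ₗ[K] Series K X →ₗ[K] Series2 K X :=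
  LinearMap.mk₂ K tens tens_add_left tens_smul_left tens_add_right tens_smul_right

/-- Cyclic invariance of the norm. -/
theorem norm_nmul_comm [TopologicalSpace K] [DiscreteTopology K] {p q : ℤ} {n m : ℕ}
    {f g : Series K X} (hf : IsPure δ p n f) (hg : IsPure δ q m g) :
    norm δ (nmul f g) = (p * q).negOnePow • norm δ (nmul g f) := by
  have := norm_bracket δ f g
  rwa [hf.bracket_eq hg, map_sub, map_units_smul, sub_eq_zero] at this

theorem headD_congr {I : Type*} {Δ : I ⊕ I → ℤ} {f g : Series K (I ⊕ I)}
    (h : norm Δ f = norm Δ g) : headD Δ f = headD Δ g := by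
  funext w
  cases w with
  | nil => rfl
  | cons x w => rw [headD_cons, headD_cons, h]

theorem headD_units_smul {I : Type*} {Δ : I ⊕ I → ℤ} (c : ℤˣ) (f : Series K (I ⊕ I)) :
    headD Δ (c • f) = c • headD Δ f := map_units_smul _ _ _

/-- The derivation of degree zero that replaces one letter `x` of a word by its marked copy. -/
def mark (δ : X → ℤ) : Series K (X ⊕ X) →ₗ[K] Series K (X ⊕ X) := der (ideg δ) 0 eD

/-- The derivative of `u · v`, modulo commutators, with respect to the letters of `u`: the product
`u · v` is rotated so that each letter of `u` in turn comes first. -/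
def pairing (δ : X → ℤ) (u v : Series K X) : Series K X :=
  headD (ideg δ) (nmul (mark δ (incl u)) (incl v))

theorem mark_nmul {p : ℤ} {n : ℕ} {f : Series K (X ⊕ X)} (g : Series K (X ⊕ X))
    (hf : IsPure (ideg δ) p n f) :
    mark δ (nmul f g) = nmul (mark δ f) g + nmul f (mark δ g) := by
  rw [mark, der_nmul g hf, zero_mul, Int.negOnePow_zero, one_smul]

theorem IsPure.mark {p : ℤ} {n : ℕ} {f : Series K (X ⊕ X)} (hf : IsPure (ideg δ) p n f) :
    IsPure (ideg δ) p n (mark δ f) := by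
  have := hf.der (s := 0) (e := eD) (eD_weight fun _ => by simp [ideg])
  rwa [add_zero] at this

theorem incl_mono_nil : (incl (mono []) : Series K (X ⊕ X)) = mono [] := by
  refine series_ext ?_ fun a => ?_
  · classical simp [incl_nil, mono_apply]
  rcases a with i | i
  · rw [lead_inl_incl, lead_mono_nil, lead_mono_nil, ← inclL_apply, map_zero]
  · rw [lead_inr_incl, lead_mono_nil]

theorem incl_gen (v : X → K) : incl (gen v) = gen (Sum.elim v 0) := by
  refine series_ext rfl fun a => ?_
  rcases a with i | i
  · rw [lead_inl_incl, lead_gen, lead_gen, ← inclL_apply, map_smul, inclL_apply, incl_mono_nil]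
    rfl
  · rw [lead_inr_incl, lead_gen]
    simp

theorem der_mono_nil (Δ : X → ℤ) (s : ℤ) (e : X → Option X) :
    der Δ s e (mono [] : Series K X) = 0 := by
  have := der_scale Δ s e (fun n => if n = 0 then 1 else 0) (mono [] : Series K X)
  rw [(isPure_mono Δ ([] : List X)).scale] at this
  funext w
  cases w with
  | nil => rfl
  | cons a w => simpa using congrFun this (a :: w)

theorem der_gen (Δ : X → ℤ) (s : ℤ) (e : X → Option X) (v : X → K) :
    der Δ s e (gen v) = gen fun a => (e a).elim 0 v := by
  refine series_ext rfl fun a => ?_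
  rw [lead_der, lead_gen, lead_gen, map_smul, der_mono_nil, smul_zero, smul_zero, add_zero]
  cases h : e a with
  | none => simp
  | some b =>
    change lead b (gen v) = _
    rw [lead_gen]; rfl

theorem pairing_gen (x : X → K) (v : Series K X) : pairing δ (gen x) v = nmul (gen x) v := by
  have h : mark δ (incl (gen x)) = dgen x := by
    rw [incl_gen, mark, der_gen, dgen]
    congr 1
    funext a
    rcases a with i | i <;> rfl
  rw [pairing, h, dgen_nmul_incl, headD_liftD _ (gen_nmul_nil _ _)]

theorem pairing_mono (x : X) (v : Series K X) : pairing δ (mono [x]) v = nmul (mono [x]) v := by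
  classical
  rw [← gen_single, pairing_gen]

section

variable [TopologicalSpace K] [DiscreteTopology K]

/-- The recursion in the first argument: the Leibniz rule for `mark` gives four terms, and moving the
unmarked factor `b` or `c` cyclically to the end combines them into brackets with `v`. -/
theorem pairing_bracket {p q r : ℤ} {n m l : ℕ} {b c v : Series K X} (hb : IsPure δ p n b)
    (hc : IsPure δ q m c) (hv : IsPure δ r l v) :
    pairing δ (bracket δ b c) v =
      pairing δ b (bracket δ c v) - (p * q).negOnePow • pairing δ c (bracket δ b v) := by
  have hi : ∀ i, ideg δ (Sum.inl i) = δ i := fun _ => rfl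
  have Hb := hb.incl hi
  have Hc := hc.incl hi
  have Hv := hv.incl hi
  have e1 := headD_congr ((norm_nmul_comm Hb (Hc.mark.nmul Hv)).trans (map_units_smul _ _ _).symm)
  have e2 := headD_congr ((norm_nmul_comm Hc (Hb.mark.nmul Hv)).trans (map_units_smul _ _ _).symm)
  simp only [map_units_smul, ← nmul_assoc] at e1 e2
  have incl_sub : ∀ f g : Series K X, incl (f - g) = (incl f - incl g : Series K (X ⊕ X)) :=
    fun f g => map_sub inclL f g
  have incl_smul : ∀ (c : ℤˣ) (g : Series K X), incl (c • g) = (c • incl g : Series K (X ⊕ X)) :=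
    fun c g => map_units_smul inclL c g
  rw [pairing, pairing, pairing, hb.bracket_eq hc, hc.bracket_eq hv, hb.bracket_eq hv]
  simp only [incl_sub, incl_smul, incl_nmul, map_sub, map_units_smul, mark_nmul _ Hb,
    mark_nmul _ Hc, nmul_sub_left, nmul_sub_right, units_smul_nmul, nmul_units_smul, nmul_add_left,
    map_add, ← nmul_assoc, smul_add, smul_sub, e1, e2, mul_add, Int.negOnePow_add, mul_comm q p]
  rcases Int.units_eq_one_or (p * q).negOnePow with h1 | h1 <;>
  rcases Int.units_eq_one_or (p * r).negOnePow with h2 | h2 <;>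
  rcases Int.units_eq_one_or (q * r).negOnePow with h3 | h3 <;>
  rw [h1, h2, h3] <;> simp <;> abel

/-- The rotations of `u · v` that start with a letter of `u`, and those that start with a letter of
`v`. -/
theorem norm_nmul_eq_pairing {p q : ℤ} {n m : ℕ} {u v : Series K X} (hu : IsPure δ p n u)
    (hv : IsPure δ q m v) :
    norm δ (nmul u v) = pairing δ u v + (p * q).negOnePow • pairing δ v u := by
  have hi : ∀ i, ideg δ (Sum.inl i) = δ i := fun _ => rfl
  have Hu := hu.incl hi
  have Hv := hv.incl hi
  have e := headD_der hi (s := 0) (fun i => by simp [ideg]) (incl (nmul u v))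
  rw [res_incl, incl_nmul] at e
  change headD _ (mark δ _) = _ at e
  rw [← e, mark_nmul _ Hu, map_add, headD_congr (norm_nmul_comm Hu Hv.mark |>.trans
    (map_units_smul _ _ _).symm), headD_units_smul]
  rfl

theorem continuous_toTens : Continuous (toTens : Series K X →ₗ[K] Series2 K X) := by
  refine continuous_pi fun ⟨u, v⟩ => ?_
  rcases u with _ | ⟨a, _ | ⟨b, u⟩⟩
  · exact continuous_const
  · exact continuous_apply (a :: v)
  · exact continuous_const

theorem toTens_mem {g : Series K X} (h0 : g [] = 0) (h : ∀ x, lead x g ∈ lieSeries K δ) :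
    toTens g ∈ lieTens K δ :=
  map_mem_of_lead toTens continuous_toTens _ (isClosed_closedSpan _) h0 fun x => by
    rw [toTens_mono_nmul]
    exact subset_closedSpan ⟨_, (LieWord.of x).mem, _, h x, rfl⟩

theorem lead_units_smul (x : X) (c : ℤˣ) (f : Series K X) : lead x (c • f) = c • lead x f :=
  map_units_smul _ _ _

theorem units_smul_mem_submodule {M : Type*} [AddCommGroup M] [Module K M] {P : Submodule K M}
    (c : ℤˣ) {x : M} (h : x ∈ P) : c • x ∈ P := by
  rcases Int.units_eq_one_or c with rfl | rfl
  · simpa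
  · simpa using neg_mem h

theorem LieWord.lead_pairing_mem {p q : ℤ} {n m : ℕ} {u v : Series K X} (hu : LieWord δ p n u)
    (hv : LieWord δ q m v) (x : X) : lead x (pairing δ u v) ∈ lieSeries K δ := by
  induction hu generalizing q m v with
  | of y =>
    rw [pairing_mono]
    classical
    rw [← gen_single, lead_gen_nmul]
    exact Submodule.smul_mem _ _ hv.mem
  | bracket hb hc ihb ihc =>
    rw [pairing_bracket hb.isPure hc.isPure hv.isPure, map_sub, lead_units_smul]
    exact sub_mem (ihb (hc.bracket hv)) (units_smul_mem_submodule _ (ihc (hb.bracket hv)))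

theorem tens_units_smul_left (c : ℤˣ) (f g : Series K X) : tens (c • f) g = c • tens f g :=
  map_units_smul (tensL.flip g) c f

/-- Modulo the relations of `DR(L̂V)`, `pairing u v` represents `n · u ⊗ v` for `u` of length `n`:
all letters of `u` can be moved to the right but one, by `[b, c] ⊗ v ~ b ⊗ [c, v]`. -/
theorem LieWord.toTens_pairing {p q : ℤ} {n m : ℕ} {u v : Series K X} (hu : LieWord δ p n u)
    (hv : LieWord δ q m v) : toTens (pairing δ u v) - (n : K) • tens u v ∈ lieRel K δ := by
  induction hu generalizing q m v with
  | of y =>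
    rw [pairing_mono, toTens_mono_nmul]
    simp
  | bracket hb hc ihb ihc =>
    rename_i p₁ p₂ n₁ n₂ b c
    have h1 := ihb (hc.bracket hv)
    have h2 := ihc (hb.bracket hv)
    have h3 : tens b (FormalGeom.bracket δ c v) - tens (FormalGeom.bracket δ b c) v ∈ lieRel K δ :=
      subset_closedSpan (.inr ⟨b, hb.mem, c, hc.mem, v, hv.mem, rfl⟩)
    have h4 : tens c (FormalGeom.bracket δ b v) - tens (FormalGeom.bracket δ c b) v ∈ lieRel K δ :=
      subset_closedSpan (.inr ⟨c, hc.mem, b, hb.mem, v, hv.mem, rfl⟩)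
    rw [hb.isPure.bracket_symm hc.isPure] at h4
    rw [pairing_bracket hb.isPure hc.isPure hv.isPure, map_sub, map_units_smul]
    have h5 : tens (-((p₁ * p₂).negOnePow • FormalGeom.bracket δ b c)) v =
        -((p₁ * p₂).negOnePow • tens (FormalGeom.bracket δ b c) v) := by
      rw [← tens_units_smul_left]
      exact map_neg (tensL.flip v) _
    rw [h5] at h4
    have key := sub_mem (add_mem h1 (Submodule.smul_mem _ (n₁ : K) h3))
      (units_smul_mem_submodule (p₁ * p₂).negOnePow
        (add_mem h2 (Submodule.smul_mem _ (n₂ : K) h4)))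
    convert key using 1
    push_cast
    rcases Int.units_eq_one_or (p₁ * p₂).negOnePow with h | h <;> rw [h] <;> simp <;> module

theorem lead_norm_nmul_mem {u v : Series K X} (hu : u ∈ lieSeries K δ) (hv : v ∈ lieSeries K δ)
    (x : X) : lead x (norm δ (nmul u v)) ∈ lieSeries K δ := by
  have hc := (continuous_lead (K := K) x).comp (continuous_norm δ)
  refine map_mem_of_lieWord (L := lead x ∘ₗ norm δ ∘ₗ mulL.flip v)
    (hc.comp (continuous_nmul_left v)) _ (isClosed_closedSpan _) (fun a p n ha => ?_) hu
  refine map_mem_of_lieWord (L := lead x ∘ₗ norm δ ∘ₗ mulL a)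
    (hc.comp (continuous_nmul_right a)) _ (isClosed_closedSpan _) (fun b q m hb => ?_) hv
  change lead x (norm δ (nmul a b)) ∈ _
  rw [norm_nmul_eq_pairing ha.isPure hb.isPure, map_add, lead_units_smul]
  exact add_mem (ha.lead_pairing_mem hb x) (units_smul_mem_submodule _ (hb.lead_pairing_mem ha x))

end

variable [Algebra ℚ K]

/-- The constant `1 / (n (n - 1))`: the factor `n` counts the cyclic rotations of a word of length
`n`, the factor `n - 1` is the eigenvalue of the Dynkin operator on its tail. -/
def splitWeight (n : ℕ) : ℚ := 1 / n * (1 / (n - 1 : ℕ))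

/-- A linear map that sends a product `u · v` of two Lie series, given up to commutators, to the
class of `u ⊗ v` in `DR(L̂V)`. -/
noncomputable def splitLie (δ : X → ℤ) : Series K X →ₗ[K] Series2 K X :=
  toTens ∘ₗ scale (fun n => algebraMap ℚ K (splitWeight n)) ∘ₗ mapTail (dynkin δ) ∘ₗ
    norm δ

theorem splitLie_apply (δ : X → ℤ) (f : Series K X) :
    splitLie δ f = toTens (scale (fun n => algebraMap ℚ K (splitWeight n))
      (mapTail (dynkin δ) (norm δ f))) := rfl

theorem graded_splitLie {ω : X → ℤ} {A : ℤ → AddSubgroup K} (hA : DivClosed A) {f : Series K X}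
    (hf : Graded ω A f) (p : List X × List X) :
    splitLie δ f p ∈ A (wdeg ω p.1 + wdeg ω p.2) :=
  graded_toTens (Graded.scale hA splitWeight (Graded.mapTail (fun _ _ h => Graded.dynkin δ h) (hf.norm δ))) p

variable [TopologicalSpace K] [DiscreteTopology K]

theorem continuous_splitLie : Continuous (splitLie δ : Series K X →ₗ[K] Series2 K X) :=
  continuous_toTens.comp ((continuous_scale fun n => algebraMap ℚ K (splitWeight n)).comp
    ((continuous_mapTail (continuous_dynkin δ)).comp (continuous_norm δ)))

theorem splitLie_mem (f : Series K X) : splitLie δ f ∈ lieTens K δ := by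
  rw [splitLie_apply]
  refine toTens_mem ?_ fun x => ?_
  · rw [scale_apply]; exact mul_zero _
  · rw [lead_scale, lead_mapTail, ← dynkin_scale]
    exact dynkin_mem _

theorem splitLie_nmul_sub_mem {p q : ℤ} {n m : ℕ} {u v : Series K X} (hu : LieWord δ p n u)
    (hv : LieWord δ q m v) : splitLie δ (nmul u v) - tens u v ∈ lieRel K δ := by
  have hn := hu.pos
  have hm := hv.pos
  set g := norm δ (nmul u v) with hg
  have hgs : ∀ c : ℕ → K, scale c g = c (n + m) • g := fun c => by
    rw [hg, ← norm_scale, (hu.isPure.nmul hv.isPure).scale, map_smul]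
  have h1 : mapTail (dynkin δ) g = scale (fun k => ((k - 1 : ℕ) : K)) g := by
    refine series_ext ?_ fun x => ?_
    · simp [mapTail, hg, norm_nil]
    · rw [lead_mapTail, dynkin_of_mem (lead_norm_nmul_mem hu.mem hv.mem x)]
      rfl
  have h2 : splitLie δ (nmul u v) = rinv K (n + m) • toTens g := by
    rw [splitLie_apply, ← hg, h1, hgs, map_smul, hgs, smul_smul, map_smul]
    congr 1
    rw [splitWeight, map_mul, mul_left_comm]
    exact (congrArg _ (mul_rinv (by omega))).trans (mul_one _)
  have h3 := hu.toTens_pairing hv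
  have h4 := hv.toTens_pairing hu
  have h5 : tens u v - tswap δ (tens u v) ∈ lieRel K δ :=
    subset_closedSpan (.inl ⟨u, hu.mem, v, hv.mem, rfl⟩)
  rw [hu.isPure.tswap_tens hv.isPure] at h5
  have h6 : (rinv K (n + m)) * n + rinv K (n + m) * m = 1 := by
    rw [← mul_add, ← Nat.cast_add, rinv_mul (by omega)]
  have key := Submodule.smul_mem _ (rinv K (n + m)) (sub_mem (add_mem h3
    (units_smul_mem_submodule (p * q).negOnePow h4)) (Submodule.smul_mem _ (m : K) h5))
  rw [h2, hg, norm_nmul_eq_pairing hu.isPure hv.isPure, map_add, map_units_smul]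
  have h7 : tens u v = (rinv K (n + m) * n + rinv K (n + m) * m) • tens u v := by
    rw [h6, one_smul]
  rw [h7]
  convert key using 1
  rcases Int.units_eq_one_or (p * q).negOnePow with h | h <;> rw [h] <;> simp <;> module

theorem map_mem_of_lieTens {M : Type*} [AddCommGroup M] [Module K M] [TopologicalSpace M]
    {P : Submodule K M} {L : Series2 K X →ₗ[K] M} (hL : Continuous L) (hP : IsClosed (P : Set M))
    (h : ∀ u v p n q m, LieWord δ p n u → LieWord δ q m v → L (tens u v) ∈ P)
    {F : Series2 K X} (hF : F ∈ lieTens K δ) : L F ∈ P := by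
  refine mem_of_closedSpan hL P hP ?_ hF
  rintro _ ⟨x, hx, y, hy, rfl⟩
  refine map_mem_of_lieWord (L := L ∘ₗ tensL.flip y) (hL.comp (continuous_tens_left y)) P hP
    (fun u p n hu => ?_) hx
  exact map_mem_of_lieWord (L := L ∘ₗ tensL u) (hL.comp (continuous_tens_right u)) P hP
    (fun v q m hv => h u v p n q m hu hv) hy

/-- `splitLie` is a retraction of the map `DR(L̂V) → DR(T̂V)`. -/
theorem splitLie_concat_sub_mem {F : Series2 K X} (hF : F ∈ lieTens K δ) :
    splitLie δ (concat F) - F ∈ lieRel K δ :=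
  map_mem_of_lieTens (L := splitLie δ ∘ₗ concat - LinearMap.id)
    ((continuous_splitLie.comp continuous_concat).sub continuous_id) (isClosed_closedSpan _)
    (fun _ _ _ _ _ _ hu hv => splitLie_nmul_sub_mem hu hv) hF

end LiePairs

/-! ### The Lie case -/

section LieOperators

variable {K : Type*} [CommRing K] {X : Type*} {δ : X → ℤ}

theorem IsPure.der_bracket {s : ℤ} {e : X → Option X} (he : ∀ a b, e a = some b → δ a = δ b + s)
    {p q : ℤ} {n m : ℕ} {f g : Series K X} (hf : IsPure δ p n f) (hg : IsPure δ q m g) :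
    FormalGeom.der δ s e (FormalGeom.bracket δ f g) =
      FormalGeom.bracket δ (FormalGeom.der δ s e f) g +
        (s * p).negOnePow • FormalGeom.bracket δ f (FormalGeom.der δ s e g) := by
  rw [(hf.der he).bracket_eq hg, hf.bracket_eq (hg.der he), hf.bracket_eq hg, map_sub,
    map_units_smul, der_nmul g hf, der_nmul f hg]
  simp only [add_mul, mul_add, Int.negOnePow_add, mul_comm p s]
  rcases Int.units_eq_one_or (p * q).negOnePow with h1 | h1 <;>
  rcases Int.units_eq_one_or (s * p).negOnePow with h2 | h2 <;>
  rcases Int.units_eq_one_or (s * q).negOnePow with h3 | h3 <;>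
  rw [h1, h2, h3] <;> simp <;> abel

variable [TopologicalSpace K] [DiscreteTopology K]

theorem der_mem_lieSeries {s : ℤ} {e : X → Option X} (he : ∀ a b, e a = some b → δ a = δ b + s)
    {f : Series K X} (hf : f ∈ lieSeries K δ) : der δ s e f ∈ lieSeries K δ := by
  classical
  refine map_mem_of_lieWord (continuous_der) _ (isClosed_closedSpan _) (fun f p n hf => ?_) hf
  induction hf with
  | of x => rw [← gen_single, der_gen]; exact gen_mem_lieSeries _
  | bracket hf hg ihf ihg =>
    rw [hf.isPure.der_bracket he hg.isPure]
    exact add_mem (bracket_mem_lieSeries ihf hg.mem)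
      (units_smul_mem_submodule _ (bracket_mem_lieSeries hf.mem ihg))

theorem scale_mem_lieSeries (c : ℕ → K) {f : Series K X} (hf : f ∈ lieSeries K δ) :
    scale c f ∈ lieSeries K δ := by
  refine map_mem_of_lieWord (continuous_scale c) _ (isClosed_closedSpan _) (fun f p n hf => ?_) hf
  rw [hf.isPure.scale]
  exact Submodule.smul_mem _ _ hf.mem

theorem continuous_res {I : Type*} : Continuous (res : Series K (I ⊕ I) →ₗ[K] Series K I) :=
  continuous_pi fun w => continuous_apply (w.map Sum.inl)

theorem res_mem_lieSeries {I : Type*} {Δ : I ⊕ I → ℤ} {δ : I → ℤ} (h : ∀ i, Δ (Sum.inl i) = δ i)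
    {f : Series K (I ⊕ I)} (hf : f ∈ lieSeries K Δ) : res f ∈ lieSeries K δ := by
  classical
  refine map_mem_of_lieWord continuous_res _ (isClosed_closedSpan _) (fun f p n hf => ?_) hf
  induction hf with
  | of x => rw [← gen_single, res_gen]; exact gen_mem_lieSeries _
  | bracket hf hg ihf ihg => rw [res_bracket h]; exact bracket_mem_lieSeries ihf ihg

theorem incl_mem_lieSeries {I : Type*} {Δ : I ⊕ I → ℤ} {δ : I → ℤ} (h : ∀ i, Δ (Sum.inl i) = δ i)
    {f : Series K I} (hf : f ∈ lieSeries K δ) : incl f ∈ lieSeries K Δ := by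
  classical
  refine map_mem_of_lieWord (L := inclL) continuous_incl _ (isClosed_closedSpan _)
    (fun f p n hf => ?_) hf
  rw [inclL_apply]
  induction hf with
  | of x => rw [← gen_single, incl_gen]; exact gen_mem_lieSeries _
  | bracket hf hg ihf ihg =>
    have e := bracket_mem_lieSeries ihf ihg
    rw [(hf.isPure.incl h).bracket_eq (hg.isPure.incl h), ← incl_nmul, ← incl_nmul] at e
    rw [hf.isPure.bracket_eq hg.isPure, ← inclL_apply, map_sub, map_units_smul]
    exact e

/-- The bilinear form `x ⊗ y ↦ xy` is invariant modulo commutators. -/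
theorem norm_nmul_bracket (x y z : Series K X) :
    norm δ (nmul x (bracket δ y z)) = norm δ (nmul (bracket δ x y) z) := by
  have h1 : ∀ u v w : List X, norm δ (nmul (mono u) (bracket δ (mono v) (mono w))) =
      norm δ (nmul (bracket δ (mono u) (mono v)) (mono w) : Series K X) := by
    intro u v w
    have hu := isPure_mono (K := K) δ u
    have hv := isPure_mono (K := K) δ v
    have hw := isPure_mono (K := K) δ w
    have e := norm_nmul_comm hv (hu.nmul hw)
    rw [hv.bracket_eq hw, hu.bracket_eq hv, nmul_sub_right, nmul_sub_left, nmul_units_smul,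
      units_smul_nmul, map_sub, map_sub, map_units_smul, map_units_smul, nmul_assoc, nmul_assoc, e,
      nmul_assoc, smul_smul, ← Int.negOnePow_add]
    congr 1
    refine (negOnePow_smul_congr ?_ _).symm
    exact ⟨wdeg δ u * wdeg δ v, by ring⟩
  have hN := continuous_norm (K := K) δ
  have h2 : ∀ u v : List X, norm δ (nmul (mono u) (bracket δ (mono v) z)) =
      norm δ (nmul (bracket δ (mono u) (mono v)) z) := fun u v =>
    eq_of_mono (L := norm δ ∘ₗ mulL (mono u) ∘ₗ bracketL δ (mono v))
      (L' := norm δ ∘ₗ mulL (bracket δ (mono u) (mono v)))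
      (hN.comp ((continuous_nmul_right _).comp (continuous_bracket_right δ _)))
      (hN.comp (continuous_nmul_right _)) (h1 u v) z
  have h3 : ∀ u : List X, norm δ (nmul (mono u) (bracket δ y z)) =
      norm δ (nmul (bracket δ (mono u) y) z) := fun u =>
    eq_of_mono (L := norm δ ∘ₗ mulL (mono u) ∘ₗ (bracketL δ).flip z)
      (L' := norm δ ∘ₗ mulL.flip z ∘ₗ bracketL δ (mono u))
      (hN.comp ((continuous_nmul_right _).comp (continuous_bracket_left δ _)))
      (hN.comp ((continuous_nmul_left _).comp (continuous_bracket_right δ _))) (h2 u) y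
  exact eq_of_mono (L := norm δ ∘ₗ mulL.flip (bracket δ y z))
      (L' := norm δ ∘ₗ mulL.flip z ∘ₗ (bracketL δ).flip y)
      (hN.comp (continuous_nmul_left _))
      (hN.comp ((continuous_nmul_left _).comp (continuous_bracket_left δ _))) h3 x

theorem norm_concat_of_mem_lieRel {F : Series2 K X} (hF : F ∈ lieRel K δ) :
    norm δ (concat F) = 0 := by
  refine eq_on_closedSpan (L := norm δ ∘ₗ concat) (L' := 0)
    ((continuous_norm δ).comp continuous_concat) continuous_const ?_ hF
  rintro _ (⟨x, -, y, -, rfl⟩ | ⟨x, -, y, -, z, -, rfl⟩)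
  · exact norm_bracket δ x y
  · change norm δ (concat (_ - _)) = 0
    rw [map_sub, map_sub]
    exact sub_eq_zero.mpr (norm_nmul_bracket x y z)

variable [Algebra ℚ K]

theorem splitLie_congr {f g : Series K X} (h : norm δ f = norm δ g) :
    splitLie δ f = splitLie δ g := by
  rw [splitLie_apply, splitLie_apply, h]

/-- The map `DR(L̂V) → DR(T̂V)`, `x ⊗ y ↦ xy`, is injective. -/
theorem mem_lieRel_iff {F : Series2 K X} (hF : F ∈ lieTens K δ) :
    F ∈ lieRel K δ ↔ norm δ (concat F) = 0 := by
  refine ⟨norm_concat_of_mem_lieRel, fun h => ?_⟩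
  have h1 := splitLie_concat_sub_mem hF
  rw [splitLie_congr (g := 0) (by rw [h, map_zero]), map_zero, zero_sub] at h1
  simpa using neg_mem h1

theorem norm_concat_splitLie {F : Series2 K X} (hF : F ∈ lieTens K δ) :
    norm δ (concat (splitLie δ (concat F))) = norm δ (concat F) := by
  have := norm_concat_of_mem_lieRel (splitLie_concat_sub_mem hF)
  rwa [map_sub, map_sub, sub_eq_zero] at this

end LieOperators

section Lie

variable {K : Type*} [CommRing K] [Algebra ℚ K] [TopologicalSpace K] [DiscreteTopology K]
  {I : Type*}

/-- The map that induces `ζ` in the Lie case. -/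
noncomputable def zetaLie (deg : I → ℤ) : lieTens K (tdeg deg) →ₗ[K] Series K I :=
  zetaMap deg ∘ₗ concat ∘ₗ (lieTens K (tdeg deg)).subtype

/-- The map that induces the inverse of `ζ` in the Lie case. -/
noncomputable def etaLie (deg : I → ℤ) : Series K I →ₗ[K] lieTens K (tdeg deg) :=
  (splitLie (tdeg deg) ∘ₗ etaMap deg).codRestrict _ fun _ => splitLie_mem _

theorem zetaLie_apply (deg : I → ℤ) (F : lieTens K (tdeg deg)) :
    zetaLie deg F = zetaMap deg (concat F.1) := rfl

theorem continuous_zetaLie (deg : I → ℤ) :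
    Continuous (zetaLie deg : lieTens K (tdeg deg) →ₗ[K] Series K I) :=
  (continuous_zetaMap deg).comp (continuous_concat.comp continuous_subtype_val)

theorem continuous_etaLie (deg : I → ℤ) :
    Continuous (etaLie deg : Series K I →ₗ[K] lieTens K (tdeg deg)) :=
  (continuous_splitLie.comp (continuous_etaMap deg)).subtype_mk _

theorem lead_norm_iota_concat_mem {deg : I → ℤ} {F : Series2 K (I ⊕ I)}
    (hF : F ∈ lieTens K (tdeg deg)) (x : I ⊕ I) :
    lead x (norm (tdeg deg) (iota deg (concat F))) ∈ lieSeries K (tdeg deg) := by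
  refine map_mem_of_lieTens (L := lead x ∘ₗ norm (tdeg deg) ∘ₗ iota deg ∘ₗ concat)
    ((continuous_lead x).comp ((continuous_norm _).comp (continuous_der.comp continuous_concat)))
    (isClosed_closedSpan _) (fun u v p n q m hu hv => ?_) hF
  change lead x (norm (tdeg deg) (iota deg (nmul u v))) ∈ _
  rw [iota, der_nmul v hu.isPure, map_add, map_units_smul, map_add, lead_units_smul]
  exact add_mem (lead_norm_nmul_mem (der_mem_lieSeries (eI_tdeg deg) hu.mem) hv.mem x)
    (units_smul_mem_submodule _
      (lead_norm_nmul_mem hu.mem (der_mem_lieSeries (eI_tdeg deg) hv.mem) x))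

theorem zetaLie_mem (deg : I → ℤ) (F : lieTens K (tdeg deg)) :
    zetaLie deg F ∈ commutators (K := K) deg (lieSeries K deg) (lieSeries K deg) := by
  rw [zetaLie_apply, zetaMap_apply, ← headBracket_scale]
  refine headBracket_mem (isClosed_closedSpan _) fun x i => subset_closedSpan
    ⟨_, gen_mem_lieSeries x, _, ?_, rfl⟩
  rw [lead_scale]
  exact scale_mem_lieSeries _
    (res_mem_lieSeries (tdeg_inl deg) (lead_norm_iota_concat_mem F.2 (Sum.inr i)))

theorem dgen_tens_incl_mem (deg : I → ℤ) (x : I → K) {y : Series K I} (hy : y ∈ lieSeries K deg) :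
    tens (dgen x) (incl y) ∈ lieTens K (tdeg deg) :=
  subset_closedSpan ⟨_, gen_mem_lieSeries _, _, incl_mem_lieSeries (tdeg_inl deg) hy, rfl⟩

theorem norm_concat_etaLie {deg : I → ℤ} {h : Series K I}
    (hh : h ∈ commutators (K := K) deg (lieSeries K deg) (lieSeries K deg)) :
    norm (tdeg deg) (concat (etaLie deg h).1) = norm (tdeg deg) (etaMap deg h) := by
  let L : Series K I →ₗ[K] Series K (I ⊕ I) :=
    norm (tdeg deg) ∘ₗ concat ∘ₗ splitLie (tdeg deg) ∘ₗ etaMap deg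
  have hL : Continuous L := (continuous_norm _).comp
    (continuous_concat.comp (continuous_splitLie.comp (continuous_etaMap deg)))
  have hh' := commutators_lieSeries_le hh
  refine eq_on_closedSpan (L := L) (L' := norm (tdeg deg) ∘ₗ etaMap deg) hL
    ((continuous_norm _).comp (continuous_etaMap deg)) ?_ hh'
  rintro _ ⟨x, y, hy, rfl⟩
  have hF := diff2_mem_lieTens deg (dgen_tens_incl_mem deg x hy)
  have e : norm (tdeg deg) (etaMap deg (bracket deg (gen x) y)) =
      norm (tdeg deg) (concat (diff2 deg (tens (dgen x) (incl y)))) := by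
    rw [etaMap_bracket_norm, ← diff_concat]; rfl
  change norm (tdeg deg) (concat (splitLie (tdeg deg) (etaMap deg (bracket deg (gen x) y)))) =
    norm (tdeg deg) (etaMap deg (bracket deg (gen x) y))
  rw [splitLie_congr e, e]
  exact norm_concat_splitLie hF

theorem mem_closedLie_iff {deg : I → ℤ} {F : lieTens K (tdeg deg)} :
    (Submodule.Quotient.mk F : DRLie K deg) ∈ closedLie K deg ↔
      (∃ G ∈ formsL K deg 2, norm (tdeg deg) (concat F.1) = norm (tdeg deg) (concat G.1)) ∧
      norm (tdeg deg) (diff deg (concat F.1)) = 0 := by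
  unfold closedLie
  rw [Submodule.mem_inf]
  have key : ∀ G : lieTens K (tdeg deg), F - G ∈ (lieRel K (tdeg deg)).submoduleOf
      (lieTens K (tdeg deg)) ↔
        norm (tdeg deg) (concat F.1) = norm (tdeg deg) (concat G.1) := by
    intro G
    refine (mem_lieRel_iff (F - G).2).trans ?_
    rw [← sub_eq_zero (b := norm (tdeg deg) (concat G.1)), ← map_sub, ← map_sub]
    rfl
  refine and_congr ⟨?_, ?_⟩ ?_
  · rintro ⟨G, hG, h⟩
    exact ⟨G, hG, (key G).mp ((Submodule.Quotient.eq _).mp h.symm)⟩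
  · rintro ⟨G, hG, h⟩
    exact ⟨G, hG, ((Submodule.Quotient.eq _).mpr ((key G).mpr h)).symm⟩
  · rw [LinearMap.mem_ker, diff_concat, ← mem_lieRel_iff (diff2_mem_lieTens deg F.2)]
    exact Submodule.Quotient.mk_eq_zero _

theorem etaLie_mem {deg : I → ℤ} {h : Series K I}
    (hh : h ∈ commutators (K := K) deg (lieSeries K deg) (lieSeries K deg)) :
    (Submodule.Quotient.mk (etaLie deg h) : DRLie K deg) ∈ closedLie K deg := by
  refine mem_closedLie_iff.mpr ⟨⟨etaLie deg h, fun p hp => ?_, rfl⟩, ?_⟩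
  · have := mem_only.mp (graded_splitLie (δ := tdeg deg) (divClosed_only 2)
      (graded_etaMap_form deg h) p) hp
    rw [wdeg_formWt, wdeg_formWt] at this
    exact_mod_cast this
  · rw [norm_diff, norm_concat_etaLie hh, ← norm_diff, etaMap_apply, diff_diff, map_zero]

theorem zetaLie_etaLie {deg : I → ℤ} {h : Series K I}
    (hh : h ∈ commutators (K := K) deg (lieSeries K deg) (lieSeries K deg)) :
    zetaLie deg (etaLie deg h) = h := by
  have h1 : h ∈ commutators (K := K) deg Set.univ Set.univ := by
    refine closedSpan_le (isClosed_closedSpan _) ?_ hh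
    rintro _ ⟨a, -, b, -, rfl⟩
    exact subset_closedSpan ⟨a, trivial, b, trivial, rfl⟩
  rw [mem_commutators_iff] at h1
  rw [zetaLie_apply, zetaMap_congr (norm_concat_etaLie hh), zetaMap_etaMap h1.1 h1.2]

theorem mem_lieRel_of_zetaLie {deg : I → ℤ} {F : lieTens K (tdeg deg)}
    (hF : (Submodule.Quotient.mk F : DRLie K deg) ∈ closedLie K deg) (hZ : zetaLie deg F = 0) :
    F ∈ (lieRel K (tdeg deg)).submoduleOf (lieTens K (tdeg deg)) := by
  obtain ⟨⟨G, hG, hFG⟩, hd⟩ := mem_closedLie_iff.mp hF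
  refine (mem_lieRel_iff F.2).mpr ?_
  have hG' : Graded formWt (only K 2) (concat G.1) := Graded.concat fun p => mem_only.mpr fun h => by
    rw [wdeg_formWt, wdeg_formWt]
    exact_mod_cast hG p h
  change norm (tdeg deg) (concat F.1) = 0
  rw [hFG]
  refine norm_eq_zero_of_zetaMap hG' ?_ ?_
  · rw [norm_diff, ← hFG, ← norm_diff, hd]
  · rw [← zetaMap_congr hFG]; exact hZ

theorem exists_zeta_lie (𝒦 : ℤ → AddSubgroup K) [GradedRing 𝒦] (deg : I → ℤ) :
    ∃ ζ : closedLie K deg ≃L[K]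
        commutators (K := K) deg (lieSeries K deg) (lieSeries K deg),
      (∀ (m : ℤ) (ω : closedLie K deg),
        HomogLie 𝒦 deg m ω ↔ IsHomog 𝒦 (wdeg deg) m (ζ ω : Series K I)) ∧
      ∀ (x : I → K), ∀ y ∈ lieSeries K deg, ∀ (F : lieTens K (tdeg deg)) (ω : closedLie K deg),
        (F : Series2 K (I ⊕ I)) = tens (dgen x) (incl y) →
        (ω : DRLie K deg) = dLie K deg (Submodule.Quotient.mk F) →
        (ζ ω : Series K I) = bracket deg (gen x) y := by
  obtain ⟨ζ, hζ, hη⟩ := exists_equiv_of_maps (C := closedLie K deg)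
    (T := commutators (K := K) deg (lieSeries K deg) (lieSeries K deg))
    (zetaLie deg) (continuous_zetaLie deg) (etaLie deg) (continuous_etaLie deg)
    (fun F hF => zetaMap_of_norm (norm_concat_of_mem_lieRel hF))
    (fun F _ => zetaLie_mem deg F) (fun _ hh => etaLie_mem hh) (fun _ hh => zetaLie_etaLie hh)
    (fun _ hF hZ => mem_lieRel_of_zetaLie hF hZ)
  refine ⟨ζ, fun m ω => ⟨?_, fun h => ?_⟩, ?_⟩
  · rintro ⟨F, hF, hω⟩
    rw [hζ ω F hω]
    exact Graded.zetaMap (divClosed_grading 𝒦 m)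
      (Graded.concat (A := fun j => 𝒦 (m - j)) (ω := ideg deg) hF)
  · exact ⟨etaLie deg (ζ ω), graded_splitLie (δ := tdeg deg) (divClosed_grading 𝒦 m)
      (Graded.etaMap (divClosed_grading 𝒦 m) h), hη ω⟩
  · intro x y _ F ω hF hω
    refine (hζ ω _ hω).trans ?_
    change zetaMap deg (concat (diff2 deg F.1)) = _
    rw [hF, ← diff_concat]
    exact zetaMap_diff_dgen deg x y

end Lie

end FormalGeom

theorem mainTheorem4
    {K : Type*} [CommRing K] [Algebra ℚ K] [TopologicalSpace K] [DiscreteTopology K]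
    (𝒦 : ℤ → AddSubgroup K) [GradedRing 𝒦] (heven : ∀ m, Odd m → 𝒦 m = ⊥)
    {I : Type*} (deg : I → ℤ) :
    (∃ ζ : closedAss K deg ≃L[K] commutators (K := K) deg Set.univ Set.univ,
      (∀ (m : ℤ) (ω : closedAss K deg),
        HomogAss 𝒦 deg m ω ↔ IsHomog 𝒦 (wdeg deg) m (ζ ω : Series K I)) ∧
      ∀ (x : I → K) (y : Series K I) (ω : closedAss K deg),
        (ω : DRAss K deg) = dAss K deg (Submodule.Quotient.mk (nmul (dgen x) (incl y))) →
        (ζ ω : Series K I) = bracket deg (gen x) y) ∧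
    (∃ ζ : closedCom K deg ≃L[K]
        commutators deg (Set.range (gen : (I → K) →ₗ[K] Series K I)) (symInvariants K deg),
      (∀ (m : ℤ) (ω : closedCom K deg),
        HomogCom 𝒦 deg m ω ↔ IsHomog 𝒦 (wdeg deg) m (ζ ω : Series K I)) ∧
      ∀ (x : I → K) (y : Series K I) (ω : closedCom K deg),
        (ω : DRCom K deg) = dCom K deg (Submodule.Quotient.mk (nmul (dgen x) (incl y))) →
        (ζ ω : Series K I) = bracket deg (gen x) (symmetrise deg y)) ∧
    (∃ ζ : closedLie K deg ≃L[K]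
        commutators (K := K) deg (lieSeries K deg) (lieSeries K deg),
      (∀ (m : ℤ) (ω : closedLie K deg),
        HomogLie 𝒦 deg m ω ↔ IsHomog 𝒦 (wdeg deg) m (ζ ω : Series K I)) ∧
      ∀ (x : I → K), ∀ y ∈ lieSeries K deg, ∀ (F : lieTens K (tdeg deg)) (ω : closedLie K deg),
        (F : Series2 K (I ⊕ I)) = tens (dgen x) (incl y) →
        (ω : DRLie K deg) = dLie K deg (Submodule.Quotient.mk F) →
        (ζ ω : Series K I) = bracket deg (gen x) y) :=
  ⟨exists_zeta_ass 𝒦 deg, exists_zeta_com 𝒦 deg, exists_zeta_lie 𝒦 deg⟩
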